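/- Let $P\subset\mathbb{R}^2$ be a closed polygonal environment: the closed region bounded by a simple polygon, from which the open regions enclosed by finitely many (possibly zero) simple polygons (holes, or obstacles) have been removed, where the closed regions bounded by the holes are pairwise disjoint and lie in the open region enclosed by the outer polygon. For $x,y\in P$ let $d(x,y)$ be the length of a shortest path from $x$ to $y$ in the visibility graph on the vertices of $P$ (including those of the holes) together with $x$ and $y$, in which two points are joined by an edge if the segment between them is contained in $P$; for $R\subseteq P$ put $d(x,R)=\min_{y\in R}d(x,y)$. A vertex is reflex if the interior angle of $P$ at it exceeds $\pi$. An arc is either a circular arc (a full circle and a single point are allowed) or a segment (an arc with centre at infinity). **Lemma.** Let $U\subseteq P$ be a region whose boundary $\partial U$ is a finite union of arcs, let $d_I>0$, and let $$\gamma(U)=\{p\in P\setminus U : d(p,\partial U)=d_I\}$$ be its expanded boundary. For a vertex $v$ let $\gamma_v$ be the set of those $p\in\gamma(U)$, $p\ne v$, from which some shortest path to $\partial U$ starts with the segment from $p$ to $v$. Then: 1. $\gamma(U)$ is the union of a finite set of arcs. This set can be chosen such that each of its arcs either consists of points that are joined to $\partial U$ by a shortest path which is a single segment, or is, for some reflex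 vertex $v$, a circular arc centred at $v$ with radius $d_I-d(v,\partial U)$ that is contained in $\gamma_v$. 2. For every reflex vertex $v$, the set $\gamma_v$ is a finite (possibly empty) union of circular arcs centred at $v$ with radius $d_I-d(v,\partial U)$. 3. For every $p\in\gamma(U)$, each shortest path from $p$ to $\partial U$ either is a single segment or has an initial part that is a segment from $p$ to a reflex vertex $v$ on the path; in the latter case $p\in\gamma_v$. -/

import Mathlib

open Set Filter Topology
open scoped ENNReal

noncomputable section

namespace PolygonalGeodesic

/-- The Euclidean plane. -/
abbrev Plane : Type := EuclideanSpace ℝ (Fin 2)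

/-! ### Polygons with polygonal holes -/

/-- A simple polygon: at least three vertices, pairwise distinct; consecutive edges meet exactly in
their common vertex, and all other pairs of distinct edges are disjoint. -/
structure SimplePolygon where
  n : ℕ
  three_le : 3 ≤ n
  poly : Polygon Plane n
  vertices_injective : Function.Injective poly.vertices
  inter_next : ∀ i : Fin n,
    poly.edgeSet ℝ i ∩ poly.edgeSet ℝ (finRotate n i) = {poly (finRotate n i)}
  disjoint_of_not_adjacent : ∀ i j : Fin n, i ≠ j → finRotate n i ≠ j → finRotate n j ≠ i →
    Disjoint (poly.edgeSet ℝ i) (poly.edgeSet ℝ j)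

namespace SimplePolygon

/-- The closed curve formed by the edges. -/
def boundary (Q : SimplePolygon) : Set Plane := Q.poly.boundary ℝ

/-- The open region enclosed by the polygon: the points off the boundary curve that lie in a bounded
connected component of its complement. -/
def inside (Q : SimplePolygon) : Set Plane :=
  {x | x ∉ Q.boundary ∧ Bornology.IsBounded (connectedComponentIn Q.boundaryᶜ x)}

/-- The closed region bounded by the polygon. -/
def region (Q : SimplePolygon) : Set Plane := Q.boundary ∪ Q.inside

end SimplePolygon

/-- A polygonal environment with (zero or more) polygonal holes, which act as obstacles. The holes
are pairwise disjoint and lie in the open region enclosed by the outer polygon. -/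
structure PolygonWithHoles where
  outer : SimplePolygon
  numHoles : ℕ
  hole : Fin numHoles → SimplePolygon
  hole_subset : ∀ k, (hole k).region ⊆ outer.inside
  hole_disjoint : ∀ k l, k ≠ l → Disjoint (hole k).region (hole l).region

namespace PolygonWithHoles

variable (P : PolygonWithHoles)

/-- The closed environment: the closed outer region without the open regions of the holes. -/
def carrier : Set Plane := P.outer.region \ ⋃ k, (P.hole k).inside

/-- `Q` is one of the boundary polygons: the outer polygon or a hole. -/
def IsBoundaryPolygon (Q : SimplePolygon) : Prop := Q = P.outer ∨ ∃ k, Q = P.hole k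

/-- `v` is a vertex of the outer polygon or of a hole. -/
def IsVertex (v : Plane) : Prop :=
  ∃ Q, P.IsBoundaryPolygon Q ∧ ∃ i : Fin Q.n, v = Q.poly i

open Classical in
/-- The interior angle of the environment at a vertex `v` with neighbouring vertices `a` and `b`.
It is the convex angle between the two edges if the environment contains the points close to `v`
on the bisecting direction between the edges, and `2π` minus that angle otherwise. -/
def interiorAngle (a v b : Plane) : ℝ :=
  if ∀ᶠ t : ℝ in 𝓝[>] 0, v + t • ((a - v) + (b - v)) ∈ P.carrier
  then EuclideanGeometry.angle a v b
  else 2 * Real.pi - EuclideanGeometry.angle a v b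

/-- `v` is a reflex vertex: a vertex of the outer polygon or of a hole at which the interior angle
of the environment exceeds `π`. -/
def IsReflexVertex (v : Plane) : Prop :=
  ∃ Q, P.IsBoundaryPolygon Q ∧ ∃ i : Fin Q.n, v = Q.poly (finRotate Q.n i) ∧
    Real.pi < P.interiorAngle
      (Q.poly i) (Q.poly (finRotate Q.n i)) (Q.poly (finRotate Q.n (finRotate Q.n i)))

/-! ### Geodesic distance -/

/-- Two points see each other if the segment joining them is contained in the environment. -/
def Visible (x y : Plane) : Prop := segment ℝ x y ⊆ P.carrier

end PolygonWithHoles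

/-- The length of the polygonal chain through the points of a list, in the given order. -/
def chainLength : List Plane → ℝ≥0∞
  | [] => 0
  | [_] => 0
  | x :: y :: l => edist x y + chainLength (y :: l)

namespace PolygonWithHoles

variable (P : PolygonWithHoles)

/-- The chain `x, l, y` is a path from `x` to `y` in the visibility graph on the vertices of the
environment together with `x` and `y`. -/
def IsPath (x : Plane) (l : List Plane) (y : Plane) : Prop :=
  (∀ w ∈ l, P.IsVertex w) ∧ (x :: (l ++ [y])).IsChain P.Visible

/-- The distance `d(x, y)`: the length of a shortest path from `x` to `y` in the visibility graph
(`⊤` if there is no path). -/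
def geoDist (x y : Plane) : ℝ≥0∞ :=
  ⨅ (l : List Plane) (_ : P.IsPath x l y), chainLength (x :: (l ++ [y]))

/-- The distance `d(x, R)` from a point to a set (`⊤` if `R` is empty). -/
def geoDistSet (x : Plane) (R : Set Plane) : ℝ≥0∞ := ⨅ y ∈ R, P.geoDist x y

/-- The chain `x, l, y` is a shortest path from `x` to the set `R`, ending at `y ∈ R`. -/
def IsShortestPathTo (R : Set Plane) (x : Plane) (l : List Plane) (y : Plane) : Prop :=
  y ∈ R ∧ P.IsPath x l y ∧ chainLength (x :: (l ++ [y])) = P.geoDistSet x R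

/-- The expanded boundary of a region `U`: the points of the environment outside `U` whose distance
to the boundary of `U` is exactly `δ`. -/
def expandedBoundary (U : Set Plane) (δ : ℝ) : Set Plane :=
  {p | p ∈ P.carrier \ U ∧ P.geoDistSet p (frontier U) = ENNReal.ofReal δ}

/-- The points of the expanded boundary that are joined to the boundary of `U` by a shortest path
which is a single segment. -/
def directPart (U : Set Plane) (δ : ℝ) : Set Plane :=
  {p | p ∈ P.expandedBoundary U δ ∧ ∃ q, P.IsShortestPathTo (frontier U) p [] q}

/-- The points of the expanded boundary from which some shortest path to the boundary of `U` starts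
with the (nondegenerate) segment from `p` to `v`. -/
def partVia (U : Set Plane) (δ : ℝ) (v : Plane) : Set Plane :=
  {p | p ∈ P.expandedBoundary U δ ∧ p ≠ v ∧
    ∃ l q, P.IsShortestPathTo (frontier U) p (v :: l) q}

end PolygonWithHoles

/-! ### Arcs -/

/-- `s` is an arc of the circle with centre `c` and radius `r`. Full circles and single points are
allowed. -/
def IsCircularArc (c : Plane) (r : ℝ) (s : Set Plane) : Prop :=
  0 ≤ r ∧ ∃ θ₁ θ₂ : ℝ, θ₁ ≤ θ₂ ∧ θ₂ ≤ θ₁ + 2 * Real.pi ∧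
    s = (fun θ : ℝ => c + r • (!₂[Real.cos θ, Real.sin θ] : Plane)) '' Icc θ₁ θ₂

/-- `s` is an arc of a circle, or a segment (an arc with centre at infinity). -/
def IsArc (s : Set Plane) : Prop :=
  (∃ c r, IsCircularArc c r s) ∨ ∃ a b : Plane, s = segment ℝ a b

/-- A set consists of arcs if it is a finite union of circular arcs and segments. -/
def ConsistsOfArcs (X : Set Plane) : Prop :=
  ∃ S : Set (Set Plane), S.Finite ∧ (∀ s ∈ S, IsArc s) ∧ ⋃₀ S = X

/-- `s` is an arc centred at `v` whose radius `r` is `δ - d(v, ∂U)`. -/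
def IsViaArc (P : PolygonWithHoles) (U : Set Plane) (δ : ℝ) (v : Plane) (s : Set Plane) : Prop :=
  ∃ r, ENNReal.ofReal r + P.geoDistSet v (frontier U) = ENNReal.ofReal δ ∧ IsCircularArc v r s

end PolygonalGeodesic

end

namespace PolygonalGeodesic

/-! ### The cross product of plane vectors -/

/-- The cross product (signed area) of two plane vectors. -/
def cross (a b : Plane) : ℝ := a 0 * b 1 - a 1 * b 0

lemma cross_add_right (a b c : Plane) : cross a (b + c) = cross a b + cross a c := by
  simp [cross]; ring

lemma cross_sub_right (a b c : Plane) : cross a (b - c) = cross a b - cross a c := by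
  simp [cross]; ring

lemma cross_smul_right (a b : Plane) (s : ℝ) : cross a (s • b) = s * cross a b := by
  simp [cross]; ring

lemma cross_smul_left (a b : Plane) (s : ℝ) : cross (s • a) b = s * cross a b := by
  simp [cross]; ring

lemma cross_neg_right (a b : Plane) : cross a (-b) = -cross a b := by
  simp [cross]; ring

lemma cross_self (a : Plane) : cross a a = 0 := by simp [cross]; ring

lemma cross_swap (a b : Plane) : cross a b = -cross b a := by simp [cross]; ring

@[fun_prop]
lemma continuous_cross {X : Type*} [TopologicalSpace X] {f g : X → Plane} (hf : Continuous f)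
    (hg : Continuous g) : Continuous fun x => cross (f x) (g x) := by
  unfold cross; fun_prop

lemma exists_smul_of_cross_eq_zero {a b : Plane} (ha : a ≠ 0) (h : cross a b = 0) :
    ∃ c : ℝ, b = c • a := by
  have h2 : a 0 ≠ 0 ∨ a 1 ≠ 0 := by
    by_contra! hc
    exact ha (by ext i; fin_cases i <;> simp [hc])
  unfold cross at h
  rcases h2 with h0 | h1
  · refine ⟨b 0 / a 0, ?_⟩
    ext i; fin_cases i
    · simp [h0]
    · simp; field_simp; linarith
  · refine ⟨b 1 / a 1, ?_⟩
    ext i; fin_cases i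
    · simp; field_simp; linarith
    · simp [h1]

lemma cross_eq_zero_trans {a b c : Plane} (hb : b ≠ 0) (h1 : cross a b = 0) (h2 : cross b c = 0) :
    cross a c = 0 := by
  rw [cross_swap, neg_eq_zero] at h1
  obtain ⟨r, rfl⟩ := exists_smul_of_cross_eq_zero hb h1
  rw [cross_smul_left, h2, mul_zero]

lemma eq_smul_add_smul_of_cross_ne_zero {a b : Plane} (h : cross a b ≠ 0) (x : Plane) :
    x = (cross x b / cross a b) • a + (cross a x / cross a b) • b := by
  ext i; fin_cases i
  · simp; field_simp; unfold cross; ring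
  · simp; field_simp; unfold cross; ring

lemma exists_neg_smul_of_not_sameRay {a b : Plane} (ha : a ≠ 0) (hb : b ≠ 0) (h : cross a b = 0)
    (hab : ¬ SameRay ℝ a b) : ∃ c : ℝ, 0 < c ∧ b = -(c • a) := by
  obtain ⟨c, rfl⟩ := exists_smul_of_cross_eq_zero ha h
  refine ⟨-c, ?_, by simp⟩
  rcases lt_trichotomy c 0 with hc | hc | hc
  · linarith
  · simp [hc] at hb
  · exact (hab (SameRay.sameRay_pos_smul_right a hc)).elim

/-! ### Edges and vertices -/

lemma mem_segment_iff_smul {a b x : Plane} :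
    x ∈ segment ℝ a b ↔ ∃ s : ℝ, 0 ≤ s ∧ s ≤ 1 ∧ x = a + s • (b - a) := by
  rw [segment_eq_image']
  simp only [mem_image, mem_Icc]
  constructor
  · rintro ⟨s, ⟨h0, h1⟩, rfl⟩; exact ⟨s, h0, h1, rfl⟩
  · rintro ⟨s, h0, h1, rfl⟩; exact ⟨s, ⟨h0, h1⟩, rfl⟩

/-- A point of a segment cuts it into two segments. -/
lemma mem_segment_or_mem_segment {a b x y : Plane} (hx : x ∈ segment ℝ a b)
    (hy : y ∈ segment ℝ a b) : y ∈ segment ℝ x a ∨ y ∈ segment ℝ x b := by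
  obtain ⟨s, h0, h1, hs⟩ := mem_segment_iff_smul.1 hx
  obtain ⟨t, ht0, ht1, rfl⟩ := mem_segment_iff_smul.1 hy
  rcases le_total t s with hts | hts
  · left
    rcases eq_or_lt_of_le h0 with h0 | h0
    · have : t = 0 := by linarith
      rw [this, zero_smul, add_zero]; exact right_mem_segment _ _ _
    · refine mem_segment_iff_smul.2 ⟨1 - t / s, ?_, ?_, ?_⟩
      · rw [sub_nonneg, div_le_one h0]; exact hts
      · have : 0 ≤ t / s := by positivity
        linarith
      · rw [hs]
        have : s * (t / s) = t := by field_simp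
        linear_combination (norm := module) (-this) • (b - a)
  · right
    rcases eq_or_lt_of_le h1 with h1 | h1
    · have : t = 1 := by linarith
      rw [this, one_smul, add_sub_cancel]; exact right_mem_segment _ _ _
    · have h1' : 0 < 1 - s := by linarith
      refine mem_segment_iff_smul.2 ⟨(t - s) / (1 - s), ?_, ?_, ?_⟩
      · apply div_nonneg <;> linarith
      · rw [div_le_one h1']; linarith
      · rw [hs]
        have : (t - s) / (1 - s) * (1 - s) = t - s := by field_simp
        linear_combination (norm := module) (-this) • (b - a)

lemma eventually_add_mem_segment_iff {a b : Plane} (hab : b ≠ a) :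
    ∀ᶠ h in 𝓝 (0 : Plane), (a + h ∈ segment ℝ a b ↔ ∃ s : ℝ, 0 ≤ s ∧ h = s • (b - a)) := by
  have hpos : 0 < ‖b - a‖ := norm_pos_iff.2 (sub_ne_zero.2 hab)
  filter_upwards [Metric.ball_mem_nhds 0 hpos] with h hh
  rw [mem_segment_iff_smul]
  constructor
  · rintro ⟨s, h0, h1, hs⟩
    exact ⟨s, h0, add_left_cancel hs⟩
  · rintro ⟨s, h0, rfl⟩
    refine ⟨s, h0, ?_, rfl⟩
    rw [mem_ball_zero_iff, norm_smul, Real.norm_of_nonneg h0] at hh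
    by_contra! hc
    nlinarith

lemma SimplePolygon.edgeSet_eq (Q : SimplePolygon) (i : Fin Q.n) :
    Q.poly.edgeSet ℝ i = segment ℝ (Q.poly i) (Q.poly (finRotate Q.n i)) :=
  affineSegment_eq_segment ℝ _ _

lemma SimplePolygon.finRotate_ne (Q : SimplePolygon) (i : Fin Q.n) : finRotate Q.n i ≠ i := by
  have h3 := Q.three_le
  obtain ⟨m, hm⟩ : ∃ m, Q.n = m + 2 := ⟨Q.n - 2, by omega⟩
  revert i
  rw [hm]
  intro i h
  rw [finRotate_apply] at h
  have h1 : (1 : Fin (m + 2)) = 0 := by simp at h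
  have := congrArg Fin.val h1
  rw [Fin.val_one, Fin.val_zero] at this
  omega

lemma SimplePolygon.poly_finRotate_ne (Q : SimplePolygon) (i : Fin Q.n) :
    Q.poly (finRotate Q.n i) ≠ Q.poly i :=
  fun h => Q.finRotate_ne i (Q.vertices_injective h)

/-- A point on two different edges is their common vertex. -/
lemma SimplePolygon.eq_vertex_of_mem_edges (Q : SimplePolygon) {i j : Fin Q.n} (hij : i ≠ j)
    {x : Plane} (hi : x ∈ Q.poly.edgeSet ℝ i) (hj : x ∈ Q.poly.edgeSet ℝ j) :
    (finRotate Q.n i = j ∧ x = Q.poly j) ∨ (finRotate Q.n j = i ∧ x = Q.poly i) := by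
  by_cases h1 : finRotate Q.n i = j
  · left
    refine ⟨h1, ?_⟩
    have := Q.inter_next i
    rw [h1] at this
    exact this.subset ⟨hi, hj⟩
  by_cases h2 : finRotate Q.n j = i
  · right
    refine ⟨h2, ?_⟩
    have := Q.inter_next j
    rw [h2] at this
    exact this.subset ⟨hj, hi⟩
  exact ((Q.disjoint_of_not_adjacent i j hij h1 h2).le_bot ⟨hi, hj⟩).elim

lemma SimplePolygon.vertex_mem_edgeSet (Q : SimplePolygon) (i : Fin Q.n) :
    Q.poly i ∈ Q.poly.edgeSet ℝ i := by
  rw [Q.edgeSet_eq]; exact left_mem_segment _ _ _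

lemma SimplePolygon.next_vertex_mem_edgeSet (Q : SimplePolygon) (i : Fin Q.n) :
    Q.poly (finRotate Q.n i) ∈ Q.poly.edgeSet ℝ i := by
  rw [Q.edgeSet_eq]; exact right_mem_segment _ _ _

/-- The only edges containing a vertex are the two edges incident to it. -/
lemma SimplePolygon.eq_or_eq_of_vertex_mem_edge (Q : SimplePolygon) {i j : Fin Q.n}
    (h : Q.poly (finRotate Q.n i) ∈ Q.poly.edgeSet ℝ j) : j = i ∨ j = finRotate Q.n i := by
  by_contra! hc
  rcases Q.eq_vertex_of_mem_edges hc.1 h (Q.next_vertex_mem_edgeSet i) with ⟨-, h2⟩ | ⟨h2, -⟩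
  · exact Q.poly_finRotate_ne i h2
  · exact hc.2 h2.symm

/-! ### The boundary near one of its points -/

namespace PolygonWithHoles

variable (P : PolygonWithHoles)

/-- The edges of the boundary polygons, as pairs of end points. -/
def edges : Set (Plane × Plane) :=
  {e | ∃ Q, P.IsBoundaryPolygon Q ∧ ∃ i : Fin Q.n, e = (Q.poly i, Q.poly (finRotate Q.n i))}

/-- The union of all edges. -/
def bdry : Set Plane := ⋃ e ∈ P.edges, segment ℝ e.1 e.2

lemma finite_boundaryPolygons : {Q | P.IsBoundaryPolygon Q}.Finite := by
  have : {Q | P.IsBoundaryPolygon Q} = {P.outer} ∪ range P.hole := by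
    ext Q; simp [IsBoundaryPolygon, eq_comm]
  rw [this]
  exact (finite_singleton _).union (finite_range _)

lemma finite_edges : P.edges.Finite := by
  have : P.edges = ⋃ Q ∈ {Q | P.IsBoundaryPolygon Q},
      range fun i : Fin Q.n => (Q.poly i, Q.poly (finRotate Q.n i)) := by
    ext e; simp [edges, eq_comm]
  rw [this]
  exact P.finite_boundaryPolygons.biUnion fun Q _ => finite_range _

lemma finite_vertices : {v | P.IsVertex v}.Finite := by
  have : {v | P.IsVertex v} = ⋃ Q ∈ {Q | P.IsBoundaryPolygon Q}, range fun i : Fin Q.n => Q.poly i := by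
    ext e; simp [IsVertex, eq_comm]
  rw [this]
  exact P.finite_boundaryPolygons.biUnion fun Q _ => finite_range _

lemma mem_bdry_iff {x : Plane} :
    x ∈ P.bdry ↔ ∃ Q, P.IsBoundaryPolygon Q ∧ ∃ i : Fin Q.n, x ∈ Q.poly.edgeSet ℝ i := by
  simp only [bdry, edges, mem_iUnion, exists_prop]
  constructor
  · rintro ⟨e, ⟨Q, hQ, i, rfl⟩, hx⟩
    exact ⟨Q, hQ, i, by rwa [Q.edgeSet_eq]⟩
  · rintro ⟨Q, hQ, i, hx⟩
    exact ⟨_, ⟨Q, hQ, i, rfl⟩, by rwa [Q.edgeSet_eq] at hx⟩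

lemma mem_bdry_iff_boundary {x : Plane} :
    x ∈ P.bdry ↔ ∃ Q, P.IsBoundaryPolygon Q ∧ x ∈ Q.boundary := by
  simp only [mem_bdry_iff, SimplePolygon.boundary, Polygon.boundary, mem_iUnion]

lemma isClosed_segment (a b : Plane) : IsClosed (segment ℝ a b) := by
  rw [segment_eq_image']
  exact (isCompact_Icc.image (by fun_prop)).isClosed

variable {P}

lemma IsBoundaryPolygon.eq_of_mem_boundary {Q R : SimplePolygon} (hQ : P.IsBoundaryPolygon Q)
    (hR : P.IsBoundaryPolygon R) {x : Plane} (hx : x ∈ Q.boundary) (hx' : x ∈ R.boundary) :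
    Q = R := by
  rcases hQ with rfl | ⟨k, rfl⟩ <;> rcases hR with rfl | ⟨l, rfl⟩
  · rfl
  · exact ((P.hole_subset l (Or.inl hx')).1 hx).elim
  · exact ((P.hole_subset k (Or.inl hx)).1 hx').elim
  · by_cases h : k = l
    · rw [h]
    · exact ((P.hole_disjoint k l h).le_bot ⟨Or.inl hx, Or.inl hx'⟩).elim

lemma IsBoundaryPolygon.eq_of_mem_edge {Q R : SimplePolygon} (hQ : P.IsBoundaryPolygon Q)
    (hR : P.IsBoundaryPolygon R) {x : Plane} {i : Fin Q.n} {j : Fin R.n}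
    (hx : x ∈ Q.poly.edgeSet ℝ i) (hx' : x ∈ R.poly.edgeSet ℝ j) : Q = R :=
  hQ.eq_of_mem_boundary hR (mem_iUnion.2 ⟨i, hx⟩) (mem_iUnion.2 ⟨j, hx'⟩)

/-- Near `x`, the boundary consists of two rays from `x` in different directions. -/
structure LocalRays (P : PolygonWithHoles) (x d₁ d₂ : Plane) : Prop where
  ne₁ : d₁ ≠ 0
  ne₂ : d₂ ≠ 0
  not_sameRay : ¬ SameRay ℝ d₁ d₂
  eventually_mem_iff : ∀ᶠ h in 𝓝 (0 : Plane),
    (x + h ∈ P.bdry ↔ (∃ s : ℝ, 0 ≤ s ∧ h = s • d₁) ∨ (∃ s : ℝ, 0 ≤ s ∧ h = s • d₂))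

lemma not_sameRay_of_inter_segment {x p q : Plane} (hp : p ≠ x) (hq : q ≠ x)
    (h : segment ℝ x p ∩ segment ℝ x q ⊆ {x}) : ¬ SameRay ℝ (p - x) (q - x) := by
  intro hs
  obtain ⟨r₁, r₂, h1, h2, h3⟩ := hs.exists_pos (sub_ne_zero.2 hp) (sub_ne_zero.2 hq)
  have hsum : 0 < r₁ + r₂ := by positivity
  have hm : x + (r₁ / (r₁ + r₂)) • (p - x) ∈ ({x} : Set Plane) := by
    refine h ⟨mem_segment_iff_smul.2 ⟨_, by positivity, ?_, rfl⟩,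
      mem_segment_iff_smul.2 ⟨r₂ / (r₁ + r₂), by positivity, ?_, ?_⟩⟩
    · rw [div_le_one hsum]; linarith
    · rw [div_le_one hsum]; linarith
    · rw [div_eq_inv_mul, div_eq_inv_mul, mul_smul, mul_smul, h3]
  have h0 : (r₁ / (r₁ + r₂)) • (p - x) = 0 := by simpa using hm
  rcases smul_eq_zero.1 h0 with h0 | h0
  · have : 0 < r₁ / (r₁ + r₂) := by positivity
    linarith
  · exact hp (sub_eq_zero.1 h0)

lemma localRays_of_eventually_segments {x p q : Plane} (hp : p ≠ x) (hq : q ≠ x)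
    (h : segment ℝ x p ∩ segment ℝ x q ⊆ {x})
    (hev : ∀ᶠ y in 𝓝 x, (y ∈ P.bdry ↔ y ∈ segment ℝ x p ∨ y ∈ segment ℝ x q)) :
    LocalRays P x (p - x) (q - x) := by
  refine ⟨sub_ne_zero.2 hp, sub_ne_zero.2 hq, not_sameRay_of_inter_segment hp hq h, ?_⟩
  have ht : Tendsto (fun h : Plane => x + h) (𝓝 0) (𝓝 x) := by
    have : Continuous fun h : Plane => x + h := by fun_prop
    simpa using this.tendsto 0
  filter_upwards [ht.eventually hev, eventually_add_mem_segment_iff hp,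
    eventually_add_mem_segment_iff hq] with h h1 h2 h3
  rw [h1, h2, h3]

/-- Close to `x`, only the edges containing `x` are relevant. -/
lemma eventually_mem_edge (P : PolygonWithHoles) (x : Plane) : ∀ᶠ y in 𝓝 x, ∀ e ∈ P.edges,
    y ∈ segment ℝ e.1 e.2 → x ∈ segment ℝ e.1 e.2 := by
  rw [eventually_all_finite P.finite_edges]
  intro e he
  by_cases hx : x ∈ segment ℝ e.1 e.2
  · exact Eventually.of_forall fun y _ => hx
  · filter_upwards [(isClosed_segment e.1 e.2).isOpen_compl.mem_nhds hx] with y hy hy'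
    exact (hy hy').elim

/-- Distinct boundary polygons are disjoint and `Q` is simple, so only the two edges of `Q` incident
to the vertex come near it. -/
lemma localRays_vertex {Q : SimplePolygon} (hQ : P.IsBoundaryPolygon Q) (i : Fin Q.n) :
    LocalRays P (Q.poly (finRotate Q.n i)) (Q.poly i - Q.poly (finRotate Q.n i))
      (Q.poly (finRotate Q.n (finRotate Q.n i)) - Q.poly (finRotate Q.n i)) := by
  apply localRays_of_eventually_segments
  · exact (Q.poly_finRotate_ne i).symm
  · exact Q.poly_finRotate_ne _
  · rw [segment_symm, ← Q.edgeSet_eq, ← Q.edgeSet_eq, Q.inter_next i]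
  · filter_upwards [P.eventually_mem_edge (Q.poly (finRotate Q.n i))] with y hy
    rw [segment_symm, ← Q.edgeSet_eq, ← Q.edgeSet_eq, P.mem_bdry_iff]
    constructor
    · rintro ⟨R, hR, j, hj⟩
      have := hy _ ⟨R, hR, j, rfl⟩ (by rwa [R.edgeSet_eq] at hj)
      rw [← R.edgeSet_eq] at this
      obtain rfl := hQ.eq_of_mem_edge hR (Q.vertex_mem_edgeSet _) this
      rcases Q.eq_or_eq_of_vertex_mem_edge this with rfl | rfl
      · exact Or.inl hj
      · exact Or.inr hj
    · rintro (h | h)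
      · exact ⟨Q, hQ, _, h⟩
      · exact ⟨Q, hQ, _, h⟩

lemma localRays_edge {Q : SimplePolygon} (hQ : P.IsBoundaryPolygon Q) {i : Fin Q.n} {x : Plane}
    (hx : x ∈ Q.poly.edgeSet ℝ i) (hv : ¬ P.IsVertex x) :
    LocalRays P x (Q.poly i - x) (Q.poly (finRotate Q.n i) - x) := by
  have hxi : ∀ j : Fin Q.n, Q.poly j ≠ x := fun j h => hv ⟨Q, hQ, j, h.symm⟩
  have hxs := hx
  rw [Q.edgeSet_eq] at hxs
  obtain ⟨s, h0, h1, hs⟩ := mem_segment_iff_smul.1 hxs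
  set a := Q.poly i
  set b := Q.poly (finRotate Q.n i)
  have hba : b - a ≠ 0 := sub_ne_zero.2 (Q.poly_finRotate_ne i)
  apply localRays_of_eventually_segments (hxi _) (hxi _)
  · rintro y ⟨hy1, hy2⟩
    obtain ⟨t, ht0, ht1, rfl⟩ := mem_segment_iff_smul.1 hy1
    obtain ⟨t', ht0', ht1', ht'⟩ := mem_segment_iff_smul.1 hy2
    have e1 : a - x = (-s) • (b - a) := by rw [hs]; module
    have e2 : b - x = (1 - s) • (b - a) := by rw [hs]; module
    have : t * -s = t' * (1 - s) := by
      have := add_left_cancel ht'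
      rw [e1, e2, smul_smul, smul_smul] at this
      exact smul_left_injective ℝ hba this
    -- The left side of the preceding equation is nonpositive and its right side nonnegative, so
    -- both vanish.
    have h3 : t * -s = 0 := by nlinarith [mul_nonneg ht0 h0, mul_nonneg ht0' (sub_nonneg.2 h1)]
    rw [mem_singleton_iff, e1, smul_smul, h3, zero_smul, add_zero]
  · filter_upwards [P.eventually_mem_edge x] with y hy
    have hun : y ∈ segment ℝ x a ∨ y ∈ segment ℝ x b ↔ y ∈ Q.poly.edgeSet ℝ i := by
      rw [Q.edgeSet_eq]
      constructor
      · rintro (h | h)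
        · exact (convex_segment a b).segment_subset hxs (left_mem_segment _ _ _) h
        · exact (convex_segment a b).segment_subset hxs (right_mem_segment _ _ _) h
      · exact mem_segment_or_mem_segment hxs
    rw [hun, P.mem_bdry_iff]
    constructor
    · rintro ⟨R, hR, j, hj⟩
      have := hy _ ⟨R, hR, j, rfl⟩ (by rwa [R.edgeSet_eq] at hj)
      rw [← R.edgeSet_eq] at this
      obtain rfl := hQ.eq_of_mem_edge hR hx this
      by_cases hij : j = i
      · rwa [← hij]
      · rcases Q.eq_vertex_of_mem_edges hij this hx with ⟨-, h⟩ | ⟨-, h⟩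
        · exact (hxi _ h.symm).elim
        · exact (hxi _ h.symm).elim
    · intro h; exact ⟨Q, hQ, _, h⟩

/-- The local structure of the boundary: two rays along edges, opposite unless at a vertex. -/
lemma exists_localRays {x : Plane} (hx : x ∈ P.bdry) : ∃ d₁ d₂, LocalRays P x d₁ d₂ ∧
    (¬ P.IsVertex x → cross d₁ d₂ = 0) ∧
    ∀ u : Plane, (∀ e ∈ P.edges, x ∈ segment ℝ e.1 e.2 → cross (e.2 - e.1) u = 0) →
      cross d₁ u = 0 ∧ cross d₂ u = 0 := by
  by_cases hv : P.IsVertex x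
  · obtain ⟨Q, hQ, j, rfl⟩ := hv
    obtain ⟨i, rfl⟩ := (finRotate Q.n).surjective j
    refine ⟨_, _, localRays_vertex hQ i, fun h => (h ⟨Q, hQ, _, rfl⟩).elim, fun u hu => ⟨?_, ?_⟩⟩
    · have := hu _ ⟨Q, hQ, i, rfl⟩ (right_mem_segment _ _ _)
      rw [← neg_sub, ← neg_one_smul ℝ, cross_smul_left, this, mul_zero]
    · exact hu _ ⟨Q, hQ, _, rfl⟩ (left_mem_segment _ _ _)
  · obtain ⟨Q, hQ, i, hi⟩ := P.mem_bdry_iff.1 hx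
    refine ⟨_, _, localRays_edge hQ hi hv, fun _ => ?_, fun u hu => ?_⟩
    · rw [Q.edgeSet_eq] at hi
      obtain ⟨s, -, -, rfl⟩ := mem_segment_iff_smul.1 hi
      simp [cross]; ring
    · rw [Q.edgeSet_eq] at hi
      have := hu _ ⟨Q, hQ, i, rfl⟩ hi
      obtain ⟨s, -, -, rfl⟩ := mem_segment_iff_smul.1 hi
      simp only at this
      constructor
      · rw [show Q.poly i - (Q.poly i + s • (Q.poly (finRotate Q.n i) - Q.poly i)) =
          (-s) • (Q.poly (finRotate Q.n i) - Q.poly i) by module, cross_smul_left, this, mul_zero]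
      · rw [show Q.poly (finRotate Q.n i) - (Q.poly i + s • (Q.poly (finRotate Q.n i) - Q.poly i)) =
          (1 - s) • (Q.poly (finRotate Q.n i) - Q.poly i) by module, cross_smul_left, this,
          mul_zero]

end PolygonWithHoles

/-! ### The environment as a closed set -/

lemma SimplePolygon.isClosed_boundary (Q : SimplePolygon) : IsClosed Q.boundary := by
  refine isClosed_iUnion_of_finite fun i => ?_
  rw [Q.edgeSet_eq]
  exact PolygonWithHoles.isClosed_segment _ _

/-- The component of `x` in the complement of the curve is open, and each of its points has this
same component. -/
lemma SimplePolygon.eventually_mem_inside_iff (Q : SimplePolygon) {x : Plane}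
    (hx : x ∉ Q.boundary) : ∀ᶠ y in 𝓝 x, y ∉ Q.boundary ∧ (y ∈ Q.inside ↔ x ∈ Q.inside) := by
  have ho : IsOpen (connectedComponentIn Q.boundaryᶜ x) :=
    Q.isClosed_boundary.isOpen_compl.connectedComponentIn
  filter_upwards [ho.mem_nhds (mem_connectedComponentIn hx)] with y hy
  have hy' : y ∉ Q.boundary := connectedComponentIn_subset _ _ hy
  refine ⟨hy', ?_⟩
  simp only [inside, mem_ofPred_eq, hx, hy', not_false_eq_true, true_and,
    connectedComponentIn_eq hy]

namespace PolygonWithHoles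

variable {P : PolygonWithHoles}

lemma eventually_mem_carrier_iff {x : Plane} (hx : x ∉ P.bdry) :
    ∀ᶠ y in 𝓝 x, (y ∈ P.carrier ↔ x ∈ P.carrier) := by
  have h : ∀ Q, P.IsBoundaryPolygon Q → x ∉ Q.boundary := fun Q hQ h =>
    hx (P.mem_bdry_iff_boundary.2 ⟨Q, hQ, h⟩)
  have ho := h _ (Or.inl rfl)
  have hk : ∀ᶠ y in 𝓝 x, ∀ k, (y ∈ (P.hole k).inside ↔ x ∈ (P.hole k).inside) := by
    rw [eventually_all]
    intro k
    filter_upwards [(P.hole k).eventually_mem_inside_iff (h _ (Or.inr ⟨k, rfl⟩))] with y hy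
    exact hy.2
  filter_upwards [P.outer.eventually_mem_inside_iff ho, hk] with y hy hyk
  simp only [carrier, SimplePolygon.region, Set.mem_sdiff, mem_union, mem_iUnion, hyk, hy.1, hy.2, ho]

lemma frontier_carrier_subset : frontier P.carrier ⊆ P.bdry := by
  intro x hx
  by_contra hb
  have h := eventually_mem_carrier_iff hb
  by_cases hc : x ∈ P.carrier
  · exact hx.2 (mem_interior_iff_mem_nhds.2 (h.mono fun y hy => hy.2 hc))
  · exact (mem_closure_iff_frequently.1 hx.1) (h.mono fun y hy hy' => hc (hy.1 hy'))

/-- Only the open regions of the holes are removed, and disjointness of the holes keeps the edges of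
one out of the inside of another. This makes the environment closed. -/
lemma bdry_subset_carrier : P.bdry ⊆ P.carrier := by
  intro x hx
  obtain ⟨Q, hQ, hxQ⟩ := P.mem_bdry_iff_boundary.1 hx
  rcases hQ with rfl | ⟨k, rfl⟩
  · refine ⟨Or.inl hxQ, fun h => ?_⟩
    obtain ⟨k, hk⟩ := mem_iUnion.1 h
    exact (P.hole_subset k (Or.inr hk)).1 hxQ
  · refine ⟨Or.inr (P.hole_subset k (Or.inl hxQ)), fun h => ?_⟩
    obtain ⟨l, hl⟩ := mem_iUnion.1 h
    by_cases hkl : k = l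
    · subst hkl; exact hl.1 hxQ
    · exact (P.hole_disjoint k l hkl).le_bot ⟨Or.inl hxQ, Or.inr hl⟩

lemma isClosed_carrier : IsClosed P.carrier :=
  frontier_subset_iff_isClosed.1 (frontier_carrier_subset.trans bdry_subset_carrier)

/-- A connected set that avoids the relevant boundary and meets the environment lies in it. -/
lemma subset_carrier_of_isPreconnected {S : Set Plane} (hS : IsPreconnected S)
    (hd : ∀ y ∈ S, y ∉ frontier P.carrier) {x : Plane} (hx : x ∈ S) (hxP : x ∈ P.carrier) :
    S ⊆ P.carrier := by
  intro y hy
  by_contra hyP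
  have hi : ∀ z ∈ S, z ∈ P.carrier → z ∈ interior P.carrier := fun z hz hzP => by
    by_contra h
    exact hd z hz ⟨subset_closure hzP, h⟩
  obtain ⟨z, -, hz, hz'⟩ := hS _ _ isOpen_interior isClosed_carrier.isOpen_compl
    (fun z hz => (em (z ∈ P.carrier)).imp (hi z hz) id) ⟨x, hx, hi x hx hxP⟩ ⟨y, hy, hyP⟩
  exact hz' (interior_subset hz)

lemma eventually_mem_carrier_of_notMem_bdry {x : Plane} (hx : x ∈ P.carrier) (hb : x ∉ P.bdry) :
    ∀ᶠ y in 𝓝 x, y ∈ P.carrier :=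
  (eventually_mem_carrier_iff hb).mono fun _ h => h.2 hx

/-- Close to each of its points, the environment is a cone. -/
lemma exists_cone {x : Plane} (hx : x ∈ P.carrier) : ∃ ε > 0, ∀ h : Plane, ‖h‖ < ε →
    ∀ s : ℝ, 0 < s → s ≤ 1 → (x + s • h ∈ P.carrier ↔ x + h ∈ P.carrier) := by
  have hsm : ∀ (ε : ℝ) (h : Plane), ‖h‖ < ε → ∀ s : ℝ, 0 < s → s ≤ 1 → ‖s • h‖ < ε := by
    intro ε h hh s h0 h1
    rw [norm_smul, Real.norm_of_nonneg h0.le]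
    nlinarith [norm_nonneg h]
  by_cases hb : x ∈ P.bdry
  · obtain ⟨d₁, d₂, hL, -, -⟩ := exists_localRays hb
    obtain ⟨ε, hε, hball⟩ := Metric.eventually_nhds_iff_ball.1 hL.eventually_mem_iff
    refine ⟨ε, hε, fun h hh s h0 h1 => ?_⟩
    have hxh := hball h (by simpa using hh)
    have hxs : ∀ s : ℝ, 0 < s → s ≤ 1 → (x + s • h ∈ P.bdry ↔ x + h ∈ P.bdry) := by
      intro s h0 h1
      have key : ∀ (r : ℝ) (d : Plane), s • h = r • d → h = (r / s) • d := by
        intro r d hrd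
        rw [div_eq_inv_mul, mul_smul, ← hrd, smul_smul, inv_mul_cancel₀ h0.ne', one_smul]
      rw [hxh, hball _ (by simpa using hsm ε h hh s h0 h1)]
      constructor
      · rintro (⟨r, hr, hrd⟩ | ⟨r, hr, hrd⟩)
        · exact Or.inl ⟨r / s, by positivity, key r _ hrd⟩
        · exact Or.inr ⟨r / s, by positivity, key r _ hrd⟩
      · rintro (⟨t, ht, rfl⟩ | ⟨t, ht, rfl⟩)
        · exact Or.inl ⟨s * t, by positivity, by rw [smul_smul]⟩
        · exact Or.inr ⟨s * t, by positivity, by rw [smul_smul]⟩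
    by_cases hyb : x + h ∈ P.bdry
    · exact iff_of_true (bdry_subset_carrier ((hxs s h0 h1).2 hyb)) (bdry_subset_carrier hyb)
    -- Off the boundary, the half-open ray from `x` through `x + h` avoids the boundary, since the
    -- two local rays are invariant under scaling. So it lies wholly inside or wholly outside.
    · have hS : IsPreconnected ((fun s : ℝ => x + s • h) '' Ioc 0 1) :=
        isPreconnected_Ioc.image _ (by fun_prop)
      have hfr : ∀ y ∈ (fun s : ℝ => x + s • h) '' Ioc 0 1, y ∉ frontier P.carrier := by
        rintro _ ⟨t, ⟨ht0, ht1⟩, rfl⟩ ht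
        exact hyb ((hxs t ht0 ht1).1 (frontier_carrier_subset ht))
      constructor
      · intro h2
        exact subset_carrier_of_isPreconnected hS hfr ⟨s, ⟨h0, h1⟩, rfl⟩ h2 ⟨1, by simp, by simp⟩
      · intro h2
        exact subset_carrier_of_isPreconnected hS hfr ⟨1, by simp, by simp⟩ h2 ⟨s, ⟨h0, h1⟩, rfl⟩
  · obtain ⟨ε, hε, hball⟩ := Metric.eventually_nhds_iff_ball.1
      (eventually_mem_carrier_of_notMem_bdry hx hb)
    refine ⟨ε, hε, fun h hh s h0 h1 => iff_of_true (hball _ ?_) (hball _ ?_)⟩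
    · simpa using hsm ε h hh s h0 h1
    · simpa using hh

lemma eventually_segment_subset {x : Plane} (hx : x ∈ P.carrier) :
    ∀ᶠ y in 𝓝 x, y ∈ P.carrier → segment ℝ x y ⊆ P.carrier := by
  obtain ⟨ε, hε, hcone⟩ := exists_cone hx
  filter_upwards [Metric.ball_mem_nhds x hε] with y hy hyP z hz
  obtain ⟨s, h0, h1, rfl⟩ := mem_segment_iff_smul.1 hz
  rcases eq_or_lt_of_le h0 with h0 | h0
  · rw [← h0]; simpa using hx
  · rw [hcone (y - x) (by simpa [dist_eq_norm] using hy) s h0 h1]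
    simpa using hyP

/-! ### Local convexity away from reflex vertices -/

/-- The environment is convex in a neighbourhood of `x`. -/
def LocallyConvexAt (P : PolygonWithHoles) (x : Plane) : Prop :=
  ∃ ε > 0, Convex ℝ (P.carrier ∩ Metric.ball x ε)

lemma convex_halfDisc (x e : Plane) (ε : ℝ) :
    Convex ℝ {y | y ∈ Metric.ball x ε ∧ 0 < cross e (y - x)} := by
  intro y hy z hz a b ha hb hab
  refine ⟨convex_ball x ε hy.1 hz.1 ha hb hab, ?_⟩
  have : a • y + b • z - x = a • (y - x) + b • (z - x) := by
    linear_combination (norm := module) hab • x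
  rw [this, cross_add_right, cross_smul_right, cross_smul_right]
  rcases eq_or_lt_of_le ha with rfl | ha
  · have : b = 1 := by linarith
    subst this; simpa using hz.2
  · have := mul_pos ha hy.2
    have := mul_nonneg hb hz.2.le
    linarith

/-- A half disc that avoids the boundary and meets the environment lies in it. -/
lemma halfDisc_subset {x e : Plane} {ε : ℝ}
    (hd : ∀ y ∈ Metric.ball x ε, 0 < cross e (y - x) → y ∉ P.bdry) {y : Plane}
    (hy : y ∈ Metric.ball x ε) (hye : 0 < cross e (y - x)) (hyP : y ∈ P.carrier) :
    {y | y ∈ Metric.ball x ε ∧ 0 < cross e (y - x)} ⊆ P.carrier :=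
  subset_carrier_of_isPreconnected (convex_halfDisc x e ε).isPreconnected
    (fun z hz hz' => hd z hz.1 hz.2 (frontier_carrier_subset hz')) ⟨hy, hye⟩ hyP

/-- Parallel rays with different directions are opposite, so together they fill a line. -/
lemma LocalRays.exists_flat_ball {x d₁ d₂ : Plane} (hL : LocalRays P x d₁ d₂)
    (hc : cross d₁ d₂ = 0) : ∃ ε > 0, ∀ y ∈ Metric.ball x ε,
      (y ∈ P.bdry ↔ cross d₁ (y - x) = 0) := by
  obtain ⟨ε, hε, hball⟩ := Metric.eventually_nhds_iff_ball.1 hL.eventually_mem_iff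
  refine ⟨ε, hε, fun y hy => ?_⟩
  obtain ⟨c, hcpos, rfl⟩ := exists_neg_smul_of_not_sameRay hL.ne₁ hL.ne₂ hc hL.not_sameRay
  have h := hball (y - x) (by simpa [dist_eq_norm] using hy)
  rw [add_sub_cancel] at h
  rw [h]
  constructor
  · rintro (⟨s, -, hs⟩ | ⟨s, -, hs⟩)
    · rw [hs, cross_smul_right, cross_self, mul_zero]
    · rw [hs, cross_smul_right, cross_neg_right, cross_smul_right, cross_self]; simp
  · intro h0
    obtain ⟨s, hs⟩ := exists_smul_of_cross_eq_zero hL.ne₁ h0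
    rcases le_total 0 s with h | h
    · exact Or.inl ⟨s, h, hs⟩
    · refine Or.inr ⟨-s / c, div_nonneg (by linarith) hcpos.le, ?_⟩
      rw [hs, smul_neg, smul_smul, ← neg_smul]
      congr 1; field_simp

/-- The diameter belongs to the environment, and each open half disc lies either inside or outside
it. All of these combinations are convex, so the Jordan curve theorem is not needed to tell the
sides apart. -/
lemma LocalRays.locallyConvexAt_of_flat {x d₁ d₂ : Plane} (hL : LocalRays P x d₁ d₂)
    (hc : cross d₁ d₂ = 0) : P.LocallyConvexAt x := by
  obtain ⟨ε, hε, hball⟩ := hL.exists_flat_ball hc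
  refine ⟨ε, hε, ?_⟩
  intro y hy z hz a b ha hb hab
  have hw : a • y + b • z ∈ Metric.ball x ε := convex_ball x ε hy.2 hz.2 ha hb hab
  refine ⟨?_, hw⟩
  have key : ∀ e : Plane, (∀ y ∈ Metric.ball x ε, 0 < cross e (y - x) → y ∉ P.bdry) →
      0 < cross e (a • y + b • z - x) → a • y + b • z ∈ P.carrier := by
    intro e he hpos
    have : a • y + b • z - x = a • (y - x) + b • (z - x) := by
      linear_combination (norm := module) hab • x
    have h2 := hpos
    rw [this, cross_add_right, cross_smul_right, cross_smul_right] at h2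
    by_cases hy0 : 0 < cross e (y - x)
    · exact halfDisc_subset he hy.2 hy0 hy.1 ⟨hw, hpos⟩
    · by_cases hz0 : 0 < cross e (z - x)
      · exact halfDisc_subset he hz.2 hz0 hz.1 ⟨hw, hpos⟩
      · nlinarith
  rcases lt_trichotomy (cross d₁ (a • y + b • z - x)) 0 with h | h | h
  · refine key (-d₁) (fun y hy h1 h2 => ?_) ?_
    · have := (hball y hy).1 h2
      rw [← neg_one_smul ℝ, cross_smul_left, this] at h1; simp at h1
    · rw [← neg_one_smul ℝ, cross_smul_left]; linarith
  · exact bdry_subset_carrier ((hball _ hw).2 h)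
  · exact key d₁ (fun y hy h1 h2 => h1.ne' ((hball y hy).1 h2)) h

/-- If the convex sector between the boundary rays belongs to the environment, then the
environment is locally convex. -/
lemma LocalRays.locallyConvexAt_of_sector {x d₁ d₂ : Plane} (hL : LocalRays P x d₁ d₂)
    (hc : cross d₁ d₂ ≠ 0)
    (hev : ∀ᶠ t : ℝ in 𝓝[>] 0, x + t • (d₁ + d₂) ∈ P.carrier) : P.LocallyConvexAt x := by
  obtain ⟨ε, hε, hball⟩ := Metric.eventually_nhds_iff_ball.1 hL.eventually_mem_iff
  -- By Cramer's rule, `cross e₁` and `cross e₂` are the coordinate functionals of the basis `d₁`,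
  -- `d₂`. In these coordinates the sector is the closed positive quadrant.
  obtain ⟨e₁, he₁⟩ : ∃ e, ∀ h, cross e h = cross h d₂ / cross d₁ d₂ :=
    ⟨(-(1 / cross d₁ d₂)) • d₂, fun h => by rw [cross_smul_left, cross_swap d₂ h]; ring⟩
  obtain ⟨e₂, he₂⟩ : ∃ e, ∀ h, cross e h = cross d₁ h / cross d₁ d₂ :=
    ⟨(1 / cross d₁ d₂) • d₁, fun h => by rw [cross_smul_left]; ring⟩
  have hrep : ∀ h, h = cross e₁ h • d₁ + cross e₂ h • d₂ := fun h => by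
    rw [he₁, he₂]; exact eq_smul_add_smul_of_cross_ne_zero hc h
  have hb : ∀ y ∈ Metric.ball x ε, (y ∈ P.bdry ↔
      (0 ≤ cross e₁ (y - x) ∧ cross e₂ (y - x) = 0) ∨
      (cross e₁ (y - x) = 0 ∧ 0 ≤ cross e₂ (y - x))) := by
    intro y hy
    have h := hball (y - x) (by simpa [dist_eq_norm] using hy)
    rw [add_sub_cancel] at h
    rw [h]
    constructor
    · rintro (⟨s, hs0, hs⟩ | ⟨s, hs0, hs⟩)
      · left
        rw [hs, he₁, he₂, cross_smul_left, cross_smul_right, cross_self, mul_div_assoc, div_self hc]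
        simpa using hs0
      · right
        rw [hs, he₁, he₂, cross_smul_left, cross_smul_right, cross_self, mul_div_assoc,
          mul_div_assoc, div_self hc]
        simpa using hs0
    · rintro (⟨h1, h2⟩ | ⟨h1, h2⟩)
      · exact Or.inl ⟨_, h1, by conv_lhs => rw [hrep (y - x), h2, zero_smul, add_zero]⟩
      · exact Or.inr ⟨_, h2, by conv_lhs => rw [hrep (y - x), h1, zero_smul, zero_add]⟩
  have hsum : ∀ (t : ℝ) (e : Plane), cross e (t • (d₁ + d₂)) = t * (cross e d₁ + cross e d₂) :=
    fun t e => by rw [cross_smul_right, cross_add_right]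
  have h11 : cross e₁ d₁ = 1 := by rw [he₁, div_self hc]
  have h12 : cross e₁ d₂ = 0 := by rw [he₁, cross_self, zero_div]
  have h21 : cross e₂ d₁ = 0 := by rw [he₂, cross_self, zero_div]
  have h22 : cross e₂ d₂ = 1 := by rw [he₂, div_self hc]
  have hsmall : ∀ᶠ t : ℝ in 𝓝[>] 0, x + t • (d₁ + d₂) ∈ Metric.ball x ε := by
    have hcont : Continuous fun t : ℝ => x + t • (d₁ + d₂) := by fun_prop
    exact ((hcont.tendsto' 0 x (by simp)).eventually (Metric.ball_mem_nhds x hε)).filter_mono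
      nhdsWithin_le_nhds
  have hsmall' : ∀ᶠ t : ℝ in 𝓝[>] 0, x + (-t) • (d₁ + d₂) ∈ Metric.ball x ε := by
    have hcont : Continuous fun t : ℝ => x + (-t) • (d₁ + d₂) := by fun_prop
    exact ((hcont.tendsto' 0 x (by simp)).eventually (Metric.ball_mem_nhds x hε)).filter_mono
      nhdsWithin_le_nhds
  have hsector : ∀ y ∈ Metric.ball x ε, 0 < cross e₁ (y - x) → 0 < cross e₂ (y - x) →
      y ∈ P.carrier := by
    intro y hy h1 h2
    obtain ⟨t, ⟨ht1, ht2⟩, ht⟩ := ((hev.and hsmall).and self_mem_nhdsWithin).exists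
    have ht : 0 < t := ht
    refine subset_carrier_of_isPreconnected
      ((convex_halfDisc x e₁ ε).inter (convex_halfDisc x e₂ ε)).isPreconnected ?_
      (x := x + t • (d₁ + d₂)) ?_ ht1 ⟨⟨hy, h1⟩, hy, h2⟩
    · rintro z ⟨hz1, hz2⟩ hz
      rcases (hb z hz1.1).1 (frontier_carrier_subset hz) with h | h
      · exact hz2.2.ne' h.2
      · exact hz1.2.ne' h.1
    · refine ⟨⟨ht2, ?_⟩, ht2, ?_⟩
      · rw [add_sub_cancel_left, hsum, h11, h12]; linarith
      · rw [add_sub_cancel_left, hsum, h21, h22]; linarith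
  refine ⟨ε, hε, ?_⟩
  intro y hy z hz a b ha hb' hab
  have hw : a • y + b • z ∈ Metric.ball x ε := convex_ball x ε hy.2 hz.2 ha hb' hab
  refine ⟨?_, hw⟩
  have hneg : ∀ e h : Plane, cross (-e) h = -cross e h := fun e h => by
    rw [← neg_one_smul ℝ, cross_smul_left]; ring
  by_cases hS : 0 ≤ cross e₁ (a • y + b • z - x) ∧ 0 ≤ cross e₂ (a • y + b • z - x)
  · rcases eq_or_lt_of_le hS.1 with h1 | h1
    · exact bdry_subset_carrier ((hb _ hw).2 (Or.inr ⟨h1.symm, hS.2⟩))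
    · rcases eq_or_lt_of_le hS.2 with h2 | h2
      · exact bdry_subset_carrier ((hb _ hw).2 (Or.inl ⟨hS.1, h2.symm⟩))
      · exact hsector _ hw h1 h2
  · have hlin : ∀ e : Plane, cross e (a • y + b • z - x) =
        a * cross e (y - x) + b * cross e (z - x) := by
      intro e
      have : a • y + b • z - x = a • (y - x) + b • (z - x) := by
        linear_combination (norm := module) hab • x
      rw [this, cross_add_right, cross_smul_right, cross_smul_right]
    -- The complement of the closed sector is a union of two half discs that meet on the ray
    -- opposite to `d₁ + d₂`; hence it is connected, and it avoids the boundary.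
    have hS2 : IsPreconnected ({y | y ∈ Metric.ball x ε ∧ 0 < cross (-e₁) (y - x)} ∪
        {y | y ∈ Metric.ball x ε ∧ 0 < cross (-e₂) (y - x)}) := by
      obtain ⟨t, ht1, ht⟩ := (hsmall'.and self_mem_nhdsWithin).exists
      have ht : 0 < t := ht
      refine IsPreconnected.union (x + (-t) • (d₁ + d₂)) ⟨ht1, ?_⟩ ⟨ht1, ?_⟩
        (convex_halfDisc x _ ε).isPreconnected (convex_halfDisc x _ ε).isPreconnected
      · rw [add_sub_cancel_left, hneg, hsum, h11, h12]; linarith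
      · rw [add_sub_cancel_left, hneg, hsum, h21, h22]; linarith
    have hfr : ∀ w ∈ ({y | y ∈ Metric.ball x ε ∧ 0 < cross (-e₁) (y - x)} ∪
        {y | y ∈ Metric.ball x ε ∧ 0 < cross (-e₂) (y - x)}), w ∉ frontier P.carrier := by
      rintro w (⟨hw1, hw2⟩ | ⟨hw1, hw2⟩) hwf <;> rw [hneg] at hw2 <;>
        rcases (hb w hw1).1 (frontier_carrier_subset hwf) with h | h <;> linarith [h.1, h.2]
    have hmem : ∀ w ∈ Metric.ball x ε, ¬ (0 ≤ cross e₁ (w - x) ∧ 0 ≤ cross e₂ (w - x)) →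
        w ∈ ({y | y ∈ Metric.ball x ε ∧ 0 < cross (-e₁) (y - x)} ∪
          {y | y ∈ Metric.ball x ε ∧ 0 < cross (-e₂) (y - x)}) := by
      intro w hw hn
      by_cases h1 : 0 ≤ cross e₁ (w - x)
      · right; refine ⟨hw, ?_⟩; rw [hneg]; have := not_le.1 fun h => hn ⟨h1, h⟩; linarith
      · left; refine ⟨hw, ?_⟩; rw [hneg]; linarith
    -- The closed sector is convex, so if the combination lies outside it then so does `y` or `z`;
    -- that point then carries the whole connected complement into the environment.
    by_cases hyS : 0 ≤ cross e₁ (y - x) ∧ 0 ≤ cross e₂ (y - x)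
    · by_cases hzS : 0 ≤ cross e₁ (z - x) ∧ 0 ≤ cross e₂ (z - x)
      · exact (hS ⟨by rw [hlin]; have := hyS.1; have := hzS.1; positivity,
          by rw [hlin]; have := hyS.2; have := hzS.2; positivity⟩).elim
      · exact subset_carrier_of_isPreconnected hS2 hfr (hmem z hz.2 hzS) hz.1 (hmem _ hw hS)
    · exact subset_carrier_of_isPreconnected hS2 hfr (hmem y hy.2 hyS) hy.1 (hmem _ hw hS)

lemma locallyConvexAt_of_not_isVertex {x : Plane} (hx : x ∈ P.carrier) (hv : ¬ P.IsVertex x) :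
    P.LocallyConvexAt x := by
  by_cases hb : x ∈ P.bdry
  · obtain ⟨d₁, d₂, hL, hc, -⟩ := exists_localRays hb
    exact hL.locallyConvexAt_of_flat (hc hv)
  · obtain ⟨ε, hε, hball⟩ := Metric.eventually_nhds_iff_ball.1
      (eventually_mem_carrier_of_notMem_bdry hx hb)
    refine ⟨ε, hε, ?_⟩
    rw [inter_eq_right.2 (show Metric.ball x ε ⊆ P.carrier from hball)]
    exact convex_ball x ε

/-- If the edges are not collinear, the angle between them is less than `π`. Failure of the bisector
test in `interiorAngle` would then give an interior angle above `π`, so the convex sector belongs to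
the environment. -/
lemma locallyConvexAt_of_not_isReflexVertex {v : Plane} (hv : P.IsVertex v)
    (hr : ¬ P.IsReflexVertex v) : P.LocallyConvexAt v := by
  obtain ⟨Q, hQ, j, rfl⟩ := hv
  obtain ⟨i, rfl⟩ := (finRotate Q.n).surjective j
  have hL := localRays_vertex hQ i
  by_cases hc : cross (Q.poly i - Q.poly (finRotate Q.n i))
      (Q.poly (finRotate Q.n (finRotate Q.n i)) - Q.poly (finRotate Q.n i)) = 0
  · exact hL.locallyConvexAt_of_flat hc
  · refine hL.locallyConvexAt_of_sector hc ?_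
    by_contra hev
    refine hr ⟨Q, hQ, i, rfl, ?_⟩
    rw [interiorAngle, if_neg hev]
    have hle := EuclideanGeometry.angle_le_pi (Q.poly i) (Q.poly (finRotate Q.n i))
      (Q.poly (finRotate Q.n (finRotate Q.n i)))
    have hne : EuclideanGeometry.angle (Q.poly i) (Q.poly (finRotate Q.n i))
      (Q.poly (finRotate Q.n (finRotate Q.n i))) ≠ Real.pi := by
      intro h
      obtain ⟨-, r, -, hr⟩ := InnerProductGeometry.angle_eq_pi_iff.1 h
      rw [vsub_eq_sub, vsub_eq_sub] at hr
      exact hc (by rw [hr, cross_smul_right, cross_self, mul_zero])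
    have := lt_of_le_of_ne hle hne
    linarith

end PolygonWithHoles
namespace PolygonWithHoles

variable {P : PolygonWithHoles}

/-! ### Stability of visibility -/

lemma Visible.symm {x y : Plane} (h : P.Visible x y) : P.Visible y x := by
  rw [Visible, segment_symm]; exact h

lemma Visible.left_mem {x y : Plane} (h : P.Visible x y) : x ∈ P.carrier :=
  h (left_mem_segment _ _ _)

lemma Visible.right_mem {x y : Plane} (h : P.Visible x y) : y ∈ P.carrier :=
  h (right_mem_segment _ _ _)

lemma Visible.mono {x y a b : Plane} (h : P.Visible x y) (ha : a ∈ segment ℝ x y)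
    (hb : b ∈ segment ℝ x y) : P.Visible a b :=
  ((convex_segment x y).segment_subset ha hb).trans h

lemma visible_self {x : Plane} (hx : x ∈ P.carrier) : P.Visible x x := by
  rw [Visible, segment_same]; simpa using hx

lemma visible_iff {x y : Plane} :
    P.Visible x y ↔ ∀ s : ℝ, 0 ≤ s → s ≤ 1 → x + s • (y - x) ∈ P.carrier := by
  constructor
  · intro h s h0 h1
    exact h (mem_segment_iff_smul.2 ⟨s, h0, h1, rfl⟩)
  · intro h z hz
    obtain ⟨s, h0, h1, rfl⟩ := mem_segment_iff_smul.1 hz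
    exact h s h0 h1

lemma isClosed_visible : IsClosed {z : Plane × Plane | P.Visible z.1 z.2} := by
  simp only [visible_iff, ofPred_forall]
  refine isClosed_iInter fun s => isClosed_iInter fun _ => isClosed_iInter fun _ => ?_
  exact isClosed_carrier.preimage (by fun_prop)

lemma isClosed_bdry (P : PolygonWithHoles) : IsClosed P.bdry :=
  P.finite_edges.isClosed_biUnion fun _ _ => isClosed_segment _ _

/-- Moving the end point of a visible segment slightly: the part of the new segments close to the
end point stays in the environment. -/
lemma LocallyConvexAt.eventually_end_subset {u w : Plane} (huw : P.Visible u w)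
    (hw : P.LocallyConvexAt w) : ∃ η : ℝ, 0 < η ∧ η < 1 ∧ ∀ᶠ w' in 𝓝 w, w' ∈ P.carrier →
      ∀ s : ℝ, 1 - η ≤ s → s ≤ 1 → u + s • (w' - u) ∈ P.carrier := by
  obtain ⟨ε₁, hε₁, hconv⟩ := hw
  obtain ⟨ε₂, hε₂, hcone⟩ := exists_cone huw.right_mem
  set ε := min ε₁ ε₂
  have hε : 0 < ε := lt_min hε₁ hε₂
  have hpos : 0 < 2 * ‖u - w‖ + 1 := by positivity
  -- The first bound keeps `2 * (1 - s) ≤ 1`, so that the auxiliary point stays on the segment; the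
  -- second keeps that point within `ε` of `w`.
  refine ⟨min (1 / 2) (ε / (2 * ‖u - w‖ + 1)), by positivity,
    lt_of_le_of_lt (min_le_left _ _) (by norm_num), ?_⟩
  filter_upwards [Metric.ball_mem_nhds w (half_pos hε)] with w' hw' hP s hs hs1
  have hw' : ‖w' - w‖ < ε / 2 := by simpa [dist_eq_norm] using hw'
  have hs2 : 1 / 2 ≤ s := by have := min_le_left (1 / 2) (ε / (2 * ‖u - w‖ + 1)); linarith
  have hs3 : (1 - s) * (2 * ‖u - w‖ + 1) ≤ ε := by
    rw [← le_div_iff₀ hpos]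
    have := min_le_right (1 / 2) (ε / (2 * ‖u - w‖ + 1)); linarith
  -- The point `u + s • (w' - u)` is the midpoint of `w + (2 * (1 - s)) • (u - w)`, which lies on
  -- the old segment, and `w + (2 * s) • (w' - w)`, which lies in the environment by the cone
  -- property.
  have h1 : w + (2 * (1 - s)) • (u - w) ∈ P.carrier ∩ Metric.ball w ε₁ := by
    refine ⟨visible_iff.1 huw.symm _ (by linarith) (by linarith), ?_⟩
    rw [mem_ball_iff_norm, add_sub_cancel_left, norm_smul, Real.norm_of_nonneg (by linarith)]
    rcases eq_or_lt_of_le hs1 with h | h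
    · rw [h]; simpa using hε₁
    · exact lt_of_lt_of_le (by nlinarith) (min_le_left ε₁ ε₂)
  have hn : ‖(2 * s) • (w' - w)‖ < ε := by
    rw [norm_smul, Real.norm_of_nonneg (by linarith)]
    nlinarith [norm_nonneg (w' - w)]
  have h2 : w + (2 * s) • (w' - w) ∈ P.carrier ∩ Metric.ball w ε₁ := by
    refine ⟨?_, ?_⟩
    · rw [← hcone _ (hn.trans_le (min_le_right _ _)) (1 / (2 * s)) (by positivity)
        (by rw [div_le_one (by positivity)]; linarith), smul_smul,
        one_div_mul_cancel (by positivity)]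
      simpa using hP
    · rw [mem_ball_iff_norm, add_sub_cancel_left]
      exact hn.trans_le (min_le_left _ _)
  have h3 := (hconv h1 h2 (a := 1 / 2) (b := 1 / 2) (by norm_num) (by norm_num) (by norm_num)).1
  convert h3 using 1
  module

/-- Moving the end point of a visible segment slightly: the part of the new segments away from the
end point does not cross the boundary of the environment. -/
lemma eventually_notMem_frontier {u w : Plane} (huw : P.Visible u w)
    (hv : ∀ z ∈ openSegment ℝ u w, ¬ P.IsVertex z) (hne : w ≠ u) {s₀ : ℝ} (h0 : 0 ≤ s₀)
    (h1 : s₀ < 1) : ∀ᶠ z : Plane × ℝ in 𝓝 (w, s₀), 0 < z.2 → cross (w - u) (z.1 - u) ≠ 0 →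
      u + z.2 • (z.1 - u) ∉ frontier P.carrier := by
  have hD : w - u ≠ 0 := sub_ne_zero.2 hne
  have hcont : Continuous fun z : Plane × ℝ => u + z.2 • (z.1 - u) := by fun_prop
  have hy : Tendsto (fun z : Plane × ℝ => u + z.2 • (z.1 - u)) (𝓝 (w, s₀))
    (𝓝 (u + s₀ • (w - u))) := hcont.tendsto _
  rcases eq_or_lt_of_le h0 with rfl | h0
  · rw [zero_smul, add_zero] at hy
    by_cases hb : u ∈ P.bdry
    · obtain ⟨d₁, d₂, hL, -, -⟩ := exists_localRays hb
      have hh : Tendsto (fun z : Plane × ℝ => z.2 • (z.1 - u)) (𝓝 (w, 0)) (𝓝 0) := by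
        have hcont : Continuous fun z : Plane × ℝ => z.2 • (z.1 - u) := by fun_prop
        exact hcont.tendsto' _ _ (by simp)
      -- A boundary ray from `u` is either parallel to `w - u`, and then contains no point off that
      -- line, or transversal to it, and then no direction close to `w - u` lies on it.
      have key : ∀ d : Plane, d ≠ 0 → ∀ᶠ z : Plane × ℝ in 𝓝 (w, 0), 0 < z.2 →
          cross (w - u) (z.1 - u) ≠ 0 → ∀ s : ℝ, z.2 • (z.1 - u) ≠ s • d := by
        intro d hd
        by_cases hc : cross d (w - u) = 0
        · refine Eventually.of_forall fun z hz hz' s hs => hz' ?_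
          refine cross_eq_zero_trans hd (by rw [cross_swap, hc, neg_zero]) ?_
          have := congrArg (cross d) hs
          rw [cross_smul_right, cross_smul_right, cross_self, mul_zero] at this
          exact (mul_eq_zero.1 this).resolve_left hz.ne'
        · have hcont : Continuous fun z : Plane × ℝ => cross d (z.1 - u) := by fun_prop
          filter_upwards [hcont.continuousAt.eventually_ne (x := (w, (0 : ℝ))) hc] with z hz hz0 _ s hs
          have := congrArg (cross d) hs
          rw [cross_smul_right, cross_smul_right, cross_self, mul_zero] at this
          exact hz ((mul_eq_zero.1 this).resolve_left hz0.ne')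
      filter_upwards [hh.eventually hL.eventually_mem_iff, key d₁ hL.ne₁, key d₂ hL.ne₂]
        with z hz hz1 hz2 hpos hcr hfr
      rcases hz.1 (frontier_carrier_subset hfr) with ⟨s, -, hs⟩ | ⟨s, -, hs⟩
      · exact hz1 hpos hcr s hs
      · exact hz2 hpos hcr s hs
    · filter_upwards [hy.eventually (P.isClosed_bdry.isOpen_compl.mem_nhds hb)] with z hz _ _ hf
      exact hz (frontier_carrier_subset hf)
  · set x := u + s₀ • (w - u) with hx
    by_cases hf : x ∈ frontier P.carrier
    · have hnv : ¬ P.IsVertex x := hv x (by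
        rw [openSegment_eq_image']; exact ⟨s₀, ⟨h0, h1⟩, rfl⟩)
      obtain ⟨d₁, d₂, hL, hc, -⟩ := exists_localRays (frontier_carrier_subset hf)
      obtain ⟨ε, hε, hball⟩ := hL.exists_flat_ball (hc hnv)
      have hxu : cross (w - u) (x - u) = 0 := by
        rw [hx, add_sub_cancel_left, cross_smul_right, cross_self, mul_zero]
      by_cases hd : cross d₁ (w - u) = 0
      · filter_upwards [hy.eventually (Metric.ball_mem_nhds x hε)] with z hz hpos hcr hfr
        have h2 := (hball _ hz).1 (frontier_carrier_subset hfr)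
        have h3 : cross (w - u) (u + z.2 • (z.1 - u) - x) = 0 :=
          cross_eq_zero_trans hL.ne₁ (by rw [cross_swap, hd, neg_zero]) h2
        have h4 : u + z.2 • (z.1 - u) - x = z.2 • (z.1 - u) - (x - u) := by abel
        rw [h4, cross_sub_right, hxu, sub_zero, cross_smul_right] at h3
        exact hcr ((mul_eq_zero.1 h3).resolve_left hpos.ne')
      -- The visible segment would cross the boundary line transversally, so both half discs at `x`
      -- would meet the environment and hence lie in it, making `x` an interior point. This is why
      -- the statement concerns the frontier and not all edges.
      · exfalso
        refine hf.2 (mem_interior_iff_mem_nhds.2 (mem_of_superset (Metric.ball_mem_nhds x hε) ?_))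
        have hcont : Continuous fun r : ℝ => x + r • (w - u) := by fun_prop
        have hev : ∀ᶠ r : ℝ in 𝓝 0, x + r • (w - u) ∈ Metric.ball x ε ∧ x + r • (w - u) ∈ P.carrier := by
          refine ((hcont.tendsto' 0 x (by simp)).eventually (Metric.ball_mem_nhds x hε)).and ?_
          filter_upwards [Ioo_mem_nhds (neg_lt_zero.2 h0) (sub_pos.2 h1)] with r hr
          have := visible_iff.1 huw (s₀ + r) (by linarith [hr.1]) (by linarith [hr.2])
          rwa [add_smul, ← add_assoc] at this
        have hneg : Tendsto (fun r : ℝ => -r) (𝓝 0) (𝓝 0) := continuous_neg.tendsto' _ _ (by simp)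
        obtain ⟨r, ⟨⟨hr1, hr2⟩, hr3, hr4⟩, hr⟩ :=
          (((hev.and (hneg.eventually hev)).filter_mono nhdsWithin_le_nhds).and
            (self_mem_nhdsWithin (s := Ioi 0))).exists
        have hr : 0 < r := hr
        have side : ∀ e : Plane, e = d₁ ∨ e = -d₁ → ∀ y ∈ Metric.ball x ε, 0 < cross e (y - x) →
            y ∈ P.carrier := by
          intro e he y hy hpos
          have havoid : ∀ y ∈ Metric.ball x ε, 0 < cross e (y - x) → y ∉ P.bdry := by
            intro y hy hy2 hb
            have := (hball y hy).1 hb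
            rcases he with rfl | rfl
            · exact hy2.ne' this
            · rw [← neg_one_smul ℝ, cross_smul_left, this] at hy2; simp at hy2
          have hed : cross e (w - u) ≠ 0 := by
            rcases he with rfl | rfl
            · exact hd
            · rw [← neg_one_smul ℝ, cross_smul_left]; simpa using hd
          rcases hed.lt_or_gt with h | h
          · refine halfDisc_subset havoid hr3 ?_ hr4 ⟨hy, hpos⟩
            rw [add_sub_cancel_left, cross_smul_right]; nlinarith
          · refine halfDisc_subset havoid hr1 ?_ hr2 ⟨hy, hpos⟩
            rw [add_sub_cancel_left, cross_smul_right]; positivity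
        intro y hy
        rcases lt_trichotomy (cross d₁ (y - x)) 0 with h | h | h
        · exact side (-d₁) (Or.inr rfl) y hy (by
            rw [← neg_one_smul ℝ, cross_smul_left]; linarith)
        · exact bdry_subset_carrier ((hball y hy).2 h)
        · exact side d₁ (Or.inl rfl) y hy h
    · filter_upwards [hy.eventually (isClosed_frontier.isOpen_compl.mem_nhds hf)] with z hz _ _
      exact hz

/-- Visibility from `u` is stable under small motions of the end point `w` inside the environment,
if the environment is locally convex at `w` and no vertex lies strictly between `u` and `w`. -/
lemma eventually_visible {u w : Plane} (huw : P.Visible u w)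
    (hv : ∀ z ∈ openSegment ℝ u w, ¬ P.IsVertex z) (hw : P.LocallyConvexAt w) :
    ∀ᶠ w' in 𝓝 w, w' ∈ P.carrier → P.Visible u w' := by
  by_cases hne : w = u
  · subst hne; exact eventually_segment_subset huw.right_mem
  have hD : w - u ≠ 0 := sub_ne_zero.2 hne
  obtain ⟨η, hη0, hη1, hend⟩ := hw.eventually_end_subset huw
  have hmid := (isCompact_Icc (a := (0 : ℝ)) (b := 1 - η)).eventually_forall_of_forall_eventually
    (x₀ := w) (P := fun w' s => 0 < s → cross (w - u) (w' - u) ≠ 0 →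
      u + s • (w' - u) ∉ frontier P.carrier)
    (fun s hs => eventually_notMem_frontier huw hv hne hs.1 (by linarith [hs.2]))
  have hnn : (0 : ℝ) < ‖w - u‖ ^ 2 := by positivity
  have hcont : Continuous fun w' : Plane => inner ℝ (w - u) (w' - u) := by fun_prop
  have hin : Tendsto (fun w' : Plane => inner ℝ (w - u) (w' - u)) (𝓝 w) (𝓝 (‖w - u‖ ^ 2)) :=
    hcont.tendsto' _ _ (real_inner_self_eq_norm_sq _)
  -- This range of the inner product serves for `w'` on the line through `u` and `w`: if `w' - u = c
  -- • (w - u)`, it gives `0 < c` and `c * (1 - η) < 1`, so the first part of the new segment stays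
  -- on the old one.
  have hlt : ‖w - u‖ ^ 2 < ‖w - u‖ ^ 2 / (1 - η) := by
    rw [lt_div_iff₀ (by linarith)]; nlinarith
  filter_upwards [hend, hmid, hin.eventually (Ioo_mem_nhds hnn hlt)] with w' h1 h2 h3 hP
  rw [visible_iff]
  intro s hs0 hs1
  by_cases hs : 1 - η ≤ s
  · exact h1 hP s hs hs1
  push Not at hs
  rcases eq_or_lt_of_le hs0 with rfl | hs0
  · simpa using huw.left_mem
  by_cases hc : cross (w - u) (w' - u) = 0
  · obtain ⟨c, hc⟩ := exists_smul_of_cross_eq_zero hD hc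
    rw [hc, real_inner_smul_right, real_inner_self_eq_norm_sq] at h3
    have hc0 : 0 < c := by
      by_contra! h; nlinarith [h3.1]
    have hc1 : c * (1 - η) < 1 := by
      have := (lt_div_iff₀ (by linarith)).1 h3.2
      by_contra! h; nlinarith
    rw [hc, smul_smul]
    exact visible_iff.1 huw _ (by positivity) (by nlinarith)
  -- Off that line, the part of the segment up to `1 - η` avoids the frontier, and its far end is in
  -- the environment by the end estimate.
  · have hS : IsPreconnected ((fun s : ℝ => u + s • (w' - u)) '' Ioc 0 (1 - η)) :=
      isPreconnected_Ioc.image _ (by fun_prop)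
    refine subset_carrier_of_isPreconnected hS ?_ ⟨1 - η, ⟨by linarith, le_rfl⟩, rfl⟩
      (h1 hP _ le_rfl (by linarith)) ⟨s, ⟨hs0, hs.le⟩, rfl⟩
    rintro _ ⟨t, ⟨ht0, ht1⟩, rfl⟩
    exact h2 t ⟨ht0.le, ht1⟩ ht0 hc

end PolygonWithHoles

lemma chainLength_cons_cons (x y : Plane) (l : List Plane) :
    chainLength (x :: y :: l) = edist x y + chainLength (y :: l) := rfl

lemma chainLength_pair (x y : Plane) : chainLength [x, y] = edist x y := by
  simp [chainLength]

lemma edist_add_edist_of_mem_segment {x y z : Plane} (h : y ∈ segment ℝ x z) :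
    edist x y + edist y z = edist x z := by
  rw [edist_dist, edist_dist, edist_dist, ← ENNReal.ofReal_add dist_nonneg dist_nonneg,
    dist_add_dist_of_mem_segment h]

lemma mem_segment_of_edist_add_edist {x y z : Plane} (h : edist x y + edist y z = edist x z) :
    y ∈ segment ℝ x z := by
  rw [edist_dist, edist_dist, edist_dist, ← ENNReal.ofReal_add dist_nonneg dist_nonneg,
    ENNReal.ofReal_eq_ofReal_iff (by positivity) dist_nonneg] at h
  rwa [mem_segment_iff_wbtw, ← dist_add_dist_eq_iff]

/-! ### Cutting corners -/

namespace PolygonWithHoles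

variable {P : PolygonWithHoles}

lemma Visible.trans_of_mem_segment {u w y : Plane} (h1 : P.Visible u w) (h2 : P.Visible w y)
    (hw : w ∈ segment ℝ u y) : P.Visible u y := by
  intro z hz
  rcases mem_segment_or_mem_segment hw hz with h | h
  · exact h1.symm h
  · exact h2 h

/-- A corner at which the environment is locally convex can be cut off. -/
lemma exists_shortcut {u w y : Plane} (huw : P.Visible u w)
    (hv : ∀ z ∈ openSegment ℝ u w, ¬ P.IsVertex z) (hw : P.LocallyConvexAt w)
    (hwy : P.Visible w y) (hc : w ∉ segment ℝ u y) :
    ∃ w', P.Visible u w' ∧ P.Visible w' y ∧ edist u w' + edist w' y < edist u w + edist w y := by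
  have hcont : Continuous fun t : ℝ => w + t • (y - w) := by fun_prop
  have hev := (hcont.tendsto' 0 w (by simp)).eventually (eventually_visible huw hv hw)
  obtain ⟨t, ⟨ht1, ht2⟩, ht0⟩ := (((hev.and (Iio_mem_nhds one_pos)).filter_mono
    nhdsWithin_le_nhds).and (self_mem_nhdsWithin (s := Ioi 0))).exists
  have ht0 : 0 < t := ht0
  have ht2 : t < 1 := ht2
  have hmem : w + t • (y - w) ∈ segment ℝ w y := mem_segment_iff_smul.2 ⟨t, ht0.le, ht2.le, rfl⟩
  refine ⟨_, ht1 (hwy hmem), hwy.mono hmem (right_mem_segment _ _ _), ?_⟩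
  rw [← edist_add_edist_of_mem_segment hmem, ← add_assoc]
  refine ENNReal.add_lt_add_right (edist_ne_top _ _) ?_
  -- Equality in the triangle inequality would put `w` on the segment from `u` to the new point,
  -- hence on the segment from `u` to `y`.
  refine lt_of_le_of_ne (edist_triangle _ _ _) fun heq => hc ?_
  have := mem_segment_of_edist_add_edist heq.symm
  rw [mem_segment_iff_sameRay] at this ⊢
  rw [add_sub_cancel_left] at this
  have h2 := this.pos_smul_right (inv_pos.2 ht0)
  rwa [smul_smul, inv_mul_cancel₀ ht0.ne', one_smul] at h2

/-! ### The distance to a set -/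

lemma isPath_nil {x y : Plane} : P.IsPath x [] y ↔ P.Visible x y := by
  simp [IsPath]

lemma isPath_cons {x w y : Plane} {l : List Plane} :
    P.IsPath x (w :: l) y ↔ P.IsVertex w ∧ P.Visible x w ∧ P.IsPath w l y := by
  simp only [IsPath, List.mem_cons, forall_eq_or_imp, List.cons_append, List.isChain_cons_cons]
  tauto

variable {R : Set Plane}

lemma geoDistSet_le_of_isPath {x q : Plane} {l : List Plane} (h : P.IsPath x l q) (hq : q ∈ R) :
    P.geoDistSet x R ≤ chainLength (x :: (l ++ [q])) :=
  (iInf₂_le q hq).trans (iInf₂_le l h)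

lemma geoDistSet_le_edist {x q : Plane} (h : P.Visible x q) (hq : q ∈ R) :
    P.geoDistSet x R ≤ edist x q := by
  simpa [chainLength] using geoDistSet_le_of_isPath (isPath_nil.2 h) hq

/-- A path from a vertex `w` may be prolonged by the segment from `x`. For a `w` that is no vertex
this is not a path of the graph, and `geoDistSet_le_add` takes its place. -/
lemma geoDistSet_le_add_of_isVertex {x w : Plane} (h : P.Visible x w) (hw : P.IsVertex w) :
    P.geoDistSet x R ≤ edist x w + P.geoDistSet w R := by
  conv_rhs => rw [geoDistSet, ENNReal.add_iInf]
  refine le_iInf fun q => ?_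
  rw [ENNReal.add_iInf]
  refine le_iInf fun hq => ?_
  rw [geoDist, ENNReal.add_iInf]
  refine le_iInf fun l => ?_
  rw [ENNReal.add_iInf]
  refine le_iInf fun hl => ?_
  exact geoDistSet_le_of_isPath (isPath_cons.2 ⟨hw, h, hl⟩) hq

/-- Initial repetitions of `x` in the chain are skipped, so that the first vertex differs from `x`;
the recursion for shortest paths needs this for a strict decrease. -/
lemma exists_le_chainLength {q : Plane} (hq : q ∈ R) (l : List Plane) : ∀ {x : Plane},
    P.IsPath x l q →
      (∃ q' ∈ R, P.Visible x q' ∧ edist x q' ≤ chainLength (x :: (l ++ [q]))) ∨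
      ∃ w, P.IsVertex w ∧ w ≠ x ∧ P.Visible x w ∧
        edist x w + P.geoDistSet w R ≤ chainLength (x :: (l ++ [q])) := by
  induction l with
  | nil => intro x h; exact Or.inl ⟨q, hq, isPath_nil.1 h, by simp [chainLength]⟩
  | cons w l ih =>
    intro x h
    obtain ⟨hw, hxw, hl⟩ := isPath_cons.1 h
    by_cases hwx : w = x
    · subst hwx
      simpa [chainLength] using ih hl
    · refine Or.inr ⟨w, hw, hwx, hxw, ?_⟩
      rw [List.cons_append, chainLength_cons_cons]
      gcongr
      exact geoDistSet_le_of_isPath hl hq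

/-- The distance is attained by a straight segment or via some vertex. -/
lemma exists_geoDistSet_eq (hR : IsCompact R) {x : Plane} (hx : P.geoDistSet x R ≠ ⊤) :
    (∃ q ∈ R, P.Visible x q ∧ P.geoDistSet x R = edist x q) ∨
    ∃ w, P.IsVertex w ∧ w ≠ x ∧ P.Visible x w ∧
      P.geoDistSet x R = edist x w + P.geoDistSet w R := by
  -- `c₁` is the least length of a straight path and `c₂` the least length via a vertex, with value
  -- `⊤` when there is no candidate.
  obtain ⟨c₁, h1, h1'⟩ : ∃ c₁ : ℝ≥0∞, (∀ q ∈ R, P.Visible x q → c₁ ≤ edist x q) ∧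
      (c₁ = ⊤ ∨ ∃ q ∈ R, P.Visible x q ∧ c₁ = edist x q) := by
    by_cases hne : (R ∩ {q | P.Visible x q}).Nonempty
    · have hcl : IsClosed {q | P.Visible x q} :=
        isClosed_visible.preimage (f := fun q : Plane => (x, q)) (by fun_prop)
      obtain ⟨q, hq, hmin⟩ := (hR.inter_right hcl).exists_isMinOn hne
        (f := fun q => edist x q) (by fun_prop)
      exact ⟨edist x q, fun q' h h' => hmin ⟨h, h'⟩, Or.inr ⟨q, hq.1, hq.2, rfl⟩⟩
    · exact ⟨⊤, fun q h h' => (hne ⟨q, h, h'⟩).elim, Or.inl rfl⟩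
  obtain ⟨c₂, h2, h2'⟩ : ∃ c₂ : ℝ≥0∞,
      (∀ w, P.IsVertex w → w ≠ x → P.Visible x w → c₂ ≤ edist x w + P.geoDistSet w R) ∧
      (c₂ = ⊤ ∨ ∃ w, P.IsVertex w ∧ w ≠ x ∧ P.Visible x w ∧
        c₂ = edist x w + P.geoDistSet w R) := by
    by_cases hne : {w | P.IsVertex w ∧ w ≠ x ∧ P.Visible x w}.Nonempty
    · obtain ⟨w, hw, hmin⟩ := Set.exists_min_image {w | P.IsVertex w ∧ w ≠ x ∧ P.Visible x w}
        (fun w => edist x w + P.geoDistSet w R) (P.finite_vertices.subset fun w hw => hw.1) hne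
      exact ⟨_, fun w' h h' h'' => hmin w' ⟨h, h', h''⟩, Or.inr ⟨w, hw.1, hw.2.1, hw.2.2, rfl⟩⟩
    · exact ⟨⊤, fun w h h' h'' => (hne ⟨w, h, h', h''⟩).elim, Or.inl rfl⟩
  have hge : min c₁ c₂ ≤ P.geoDistSet x R := by
    refine le_iInf₂ fun q hq => le_iInf₂ fun l hl => ?_
    rcases exists_le_chainLength hq l hl with ⟨q', hq', hv, hle⟩ | ⟨w, hw, hne, hv, hle⟩
    · exact (min_le_left _ _).trans ((h1 q' hq' hv).trans hle)
    · exact (min_le_right _ _).trans ((h2 w hw hne hv).trans hle)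
  rcases min_le_iff.1 hge with h | h
  · rcases h1' with rfl | ⟨q, hq, hv, rfl⟩
    · exact (hx (top_le_iff.1 h)).elim
    · exact Or.inl ⟨q, hq, hv, le_antisymm (geoDistSet_le_edist hv hq) h⟩
  · rcases h2' with rfl | ⟨w, hw, hne, hv, rfl⟩
    · exact (hx (top_le_iff.1 h)).elim
    · exact Or.inr ⟨w, hw, hne, hv, le_antisymm (geoDistSet_le_add_of_isVertex hv hw) h⟩

/-- Shortest paths exist. -/
lemma exists_isShortestPathTo (hR : IsCompact R) {x : Plane} (hx : P.geoDistSet x R ≠ ⊤) :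
    ∃ l q, P.IsShortestPathTo R x l q := by
  -- Induction on the number of vertices strictly nearer to `R`: passing to the first vertex of an
  -- optimal route lowers it, because that vertex no longer counts itself.
  induction hn : {v | P.IsVertex v ∧ P.geoDistSet v R < P.geoDistSet x R}.ncard
    using Nat.strong_induction_on generalizing x with
  | _ n ih =>
    rcases exists_geoDistSet_eq hR hx with ⟨q, hq, hv, heq⟩ | ⟨w, hw, hne, hv, heq⟩
    · exact ⟨[], q, hq, isPath_nil.2 hv, by simp [chainLength, heq]⟩
    · have hwt : P.geoDistSet w R ≠ ⊤ := fun h => hx (by rw [heq, h, add_top])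
      have hlt : P.geoDistSet w R < P.geoDistSet x R := by
        rw [heq]
        rw [add_comm]; exact ENNReal.lt_add_right hwt (edist_pos.2 hne.symm).ne'
      obtain ⟨l, q, hq, hl, hlen⟩ := ih _ (by
        rw [← hn]
        refine Set.ncard_lt_ncard ⟨fun v hv => ⟨hv.1, hv.2.trans hlt⟩, fun h => ?_⟩
          (P.finite_vertices.subset fun v hv => hv.1)
        exact lt_irrefl _ (h (⟨hw, hlt⟩ : w ∈ {v | P.IsVertex v ∧ _})).2) hwt rfl
      exact ⟨w :: l, q, hq, isPath_cons.2 ⟨hw, hv, hl⟩, by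
        rw [List.cons_append, chainLength_cons_cons, hlen, heq]⟩

/-! ### The Lipschitz property -/

/-- By `exists_geoDistSet_eq` a sublevel set is the projection, along the compact `R`, of a closed
set, together with finitely many closed sets, one for each vertex. -/
lemma lowerSemicontinuous_geoDistSet (hR : IsCompact R) :
    LowerSemicontinuous fun x => P.geoDistSet x R := by
  rw [lowerSemicontinuous_iff_isClosed_preimage]
  intro c
  by_cases hc : c = ⊤
  · subst hc; simp
  have heq : (fun x => P.geoDistSet x R) ⁻¹' Iic c =
      (Prod.fst '' {z : Plane × R | P.Visible z.1 z.2 ∧ edist z.1 (z.2 : Plane) ≤ c}) ∪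
      ⋃ w ∈ {w | P.IsVertex w}, {x | P.Visible x w ∧ edist x w + P.geoDistSet w R ≤ c} := by
    ext x
    simp only [mem_preimage, mem_Iic, mem_union, mem_iUnion, mem_image, mem_ofPred_eq]
    constructor
    · intro h
      rcases exists_geoDistSet_eq hR (ne_top_of_le_ne_top hc h) with ⟨q, hq, hv, he⟩ | ⟨w, hw, -, hv, he⟩
      · exact Or.inl ⟨(x, ⟨q, hq⟩), ⟨hv, he ▸ h⟩, rfl⟩
      · exact Or.inr ⟨w, hw, hv, he ▸ h⟩
    · rintro (⟨⟨y, q, hq⟩, ⟨hv, he⟩, rfl⟩ | ⟨w, hw, hv, he⟩)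
      · exact (geoDistSet_le_edist hv hq).trans he
      · exact (geoDistSet_le_add_of_isVertex hv hw).trans he
  rw [heq]
  have : CompactSpace R := isCompact_iff_compactSpace.1 hR
  refine IsClosed.union (isClosedMap_fst_of_compactSpace _ ?_)
    (P.finite_vertices.isClosed_biUnion fun w _ => ?_)
  · refine IsClosed.inter (isClosed_visible.preimage
      (f := fun z : Plane × R => (z.1, (z.2 : Plane))) (by fun_prop)) ?_
    exact isClosed_le (continuous_fst.edist (continuous_subtype_val.comp continuous_snd))
      continuous_const
  · refine IsClosed.inter (isClosed_visible.preimage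
      (f := fun x : Plane => (x, w)) (by fun_prop)) ?_
    exact isClosed_le ((continuous_id.edist continuous_const).add continuous_const)
      continuous_const

/-- Only points within a finite bound `M` of `x` compete, so a lower semicontinuous function is
minimised over a compact set. It supplies the extremal point in the Lipschitz argument. -/
lemma exists_min_edist_add_geoDistSet (hR : IsCompact R) {x w₀ : Plane} (h0 : P.Visible x w₀) :
    ∃ w, P.Visible x w ∧ ∀ w', P.Visible x w' →
      edist x w + P.geoDistSet w R ≤ edist x w' + P.geoDistSet w' R := by
  by_cases htop : edist x w₀ + P.geoDistSet w₀ R = ⊤ ∧ ∀ w', P.Visible x w' →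
      edist x w' + P.geoDistSet w' R = ⊤
  · exact ⟨w₀, h0, fun w' hw' => by rw [htop.1, htop.2 w' hw']⟩
  obtain ⟨w₁, h1, hlt⟩ : ∃ w₁, P.Visible x w₁ ∧ edist x w₁ + P.geoDistSet w₁ R ≠ ⊤ := by
    by_contra! h
    exact htop ⟨h _ h0, h⟩
  set M := edist x w₁ + P.geoDistSet w₁ R with hM
  have hcpt : IsCompact {w | P.Visible x w ∧ edist w x ≤ M} := by
    refine Metric.isCompact_of_isClosed_isBounded ?_ ?_
    · refine IsClosed.inter (isClosed_visible.preimage (f := fun w : Plane => (x, w))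
        (by fun_prop)) ?_
      exact isClosed_le (continuous_id.edist continuous_const) continuous_const
    · refine (Metric.isBounded_closedBall (x := x) (r := M.toReal)).subset fun w hw => ?_
      rw [Metric.mem_closedBall, dist_edist]
      exact ENNReal.toReal_mono hlt hw.2
  have hlsc : LowerSemicontinuous fun w => edist x w + P.geoDistSet w R :=
    (Continuous.lowerSemicontinuous (f := fun w => edist x w) (by fun_prop)).add
      (lowerSemicontinuous_geoDistSet hR)
  obtain ⟨w, hw, hmin⟩ := (hlsc.lowerSemicontinuousOn _).exists_isMinOn
    (⟨w₁, h1, by rw [edist_comm]; exact le_self_add⟩ : {w | P.Visible x w ∧ edist w x ≤ M}.Nonempty)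
    hcpt
  refine ⟨w, hw.1, fun w' hw' => ?_⟩
  by_cases hle : edist w' x ≤ M
  · exact hmin ⟨hw', hle⟩
  · have h2 : edist x w + P.geoDistSet w R ≤ M := hmin ⟨h1, by rw [edist_comm]; exact le_self_add⟩
    refine h2.trans ((not_le.1 hle).le.trans ?_)
    rw [edist_comm]; exact le_self_add

/-- The distance to a set is `1`-Lipschitz along visible segments. -/
theorem geoDistSet_le_add (hR : IsCompact R) {x w : Plane} (h : P.Visible x w) :
    P.geoDistSet x R ≤ edist x w + P.geoDistSet w R := by
  by_contra hlt
  -- `X` collects the points among `x` and the vertices at which the inequality fails. A member `u`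
  -- with the smallest optimal value is taken, together with an optimal `w`.
  set X : Set Plane := {u | (u = x ∨ P.IsVertex u) ∧
    ∃ w, P.Visible u w ∧ edist u w + P.geoDistSet w R < P.geoDistSet u R} with hX
  have hfin : X.Finite := ((finite_singleton x).union P.finite_vertices).subset fun u hu => by
    rcases hu.1 with rfl | h
    · exact Or.inl rfl
    · exact Or.inr h
  obtain ⟨u, hu, hmin⟩ := Set.exists_min_image X
    (fun u => ⨅ (w) (_ : P.Visible u w), (edist u w + P.geoDistSet w R)) hfin
    ⟨x, Or.inl rfl, w, h, not_le.1 hlt⟩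
  obtain ⟨w₀, hw₀, hlt₀⟩ := hu.2
  obtain ⟨w, hw, hwmin⟩ := exists_min_edist_add_geoDistSet hR hw₀
  have hbad : edist u w + P.geoDistSet w R < P.geoDistSet u R := (hwmin _ hw₀).trans_lt hlt₀
  have hbadtop : edist u w + P.geoDistSet w R ≠ ⊤ := hbad.ne_top
  have hval : (⨅ (w) (_ : P.Visible u w), (edist u w + P.geoDistSet w R)) =
      edist u w + P.geoDistSet w R := le_antisymm (iInf₂_le w hw) (le_iInf₂ hwmin)
  -- A vertex `z` strictly between would also violate the inequality with `w`, and with a smaller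
  -- value than `u`.
  have hnv : ∀ z ∈ openSegment ℝ u w, ¬ P.IsVertex z := by
    intro z hz hzv
    have hzs := openSegment_subset_segment _ _ _ hz
    have huz := hw.mono (left_mem_segment _ _ _) hzs
    have hzw := hw.mono hzs (right_mem_segment _ _ _)
    have hadd := edist_add_edist_of_mem_segment hzs
    have hne : u ≠ z := by
      rintro rfl
      rcases eq_or_ne u w with rfl | huw
      · exact absurd (geoDistSet_le_add_of_isVertex hw hzv) (not_le.2 hbad)
      · exact huw (left_mem_openSegment_iff.1 hz)
    have hzX : z ∈ X := by
      refine ⟨Or.inr hzv, w, hzw, ?_⟩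
      by_contra hle
      refine absurd hbad (not_lt.2 ?_)
      rw [← hadd, add_assoc]
      exact (geoDistSet_le_add_of_isVertex huz hzv).trans (by gcongr; exact not_lt.1 hle)
    have h1 := hmin z hzX
    simp only [hval] at h1
    have h2 := h1.trans (iInf₂_le w hzw)
    rw [← hadd, add_assoc] at h2
    refine absurd h2 (not_le.2 ?_)
    rw [add_comm (edist u z)]
    refine ENNReal.lt_add_right ?_ (edist_pos.2 hne).ne'
    rw [← hadd, add_assoc] at hbadtop
    exact fun h => hbadtop (by rw [h, add_top])
  have hwv : ¬ P.IsVertex w := fun hv =>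
    absurd (geoDistSet_le_add_of_isVertex hw hv) (not_le.2 hbad)
  have hwtop : P.geoDistSet w R ≠ ⊤ := fun h => hbadtop (by rw [h, add_top])
  -- `y` is the end of the first leg of an optimal route from `w` and `E` the remaining cost: `0` if
  -- `y` lies in `R`, the distance of `y` otherwise. If `w` lies on the segment from `u` to `y`,
  -- then `u` sees `y` directly; if not, the corner at `w` can be cut, against its optimality.
  obtain ⟨y, E, hwy, hE, hEle⟩ : ∃ y E, P.Visible w y ∧ P.geoDistSet w R = edist w y + E ∧
      ∀ z, P.Visible z y → P.geoDistSet z R ≤ edist z y + E := by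
    rcases exists_geoDistSet_eq hR hwtop with ⟨q, hq, hv, he⟩ | ⟨y, hy, -, hv, he⟩
    · exact ⟨q, 0, hv, by rw [he, add_zero], fun z hz => by
        rw [add_zero]; exact geoDistSet_le_edist hz hq⟩
    · exact ⟨y, _, hv, he, fun z hz => geoDistSet_le_add_of_isVertex hz hy⟩
  have hEtop : E ≠ ⊤ := fun h => hwtop (by rw [hE, h, add_top])
  by_cases hc : w ∈ segment ℝ u y
  · refine absurd (hEle u (hw.trans_of_mem_segment hwy hc)) (not_le.2 ?_)
    rwa [← edist_add_edist_of_mem_segment hc, add_assoc, ← hE]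
  · obtain ⟨w', h1, h2, h3⟩ := exists_shortcut hw hnv
      (locallyConvexAt_of_not_isVertex hw.right_mem hwv) hwy hc
    refine absurd (hwmin w' h1) (not_le.2 ?_)
    calc edist u w' + P.geoDistSet w' R ≤ edist u w' + (edist w' y + E) := by
          gcongr; exact hEle w' h2
      _ = edist u w' + edist w' y + E := by rw [add_assoc]
      _ < edist u w + edist w y + E := ENNReal.add_lt_add_right hEtop h3
      _ = edist u w + P.geoDistSet w R := by rw [add_assoc, hE]

end PolygonWithHoles

namespace PolygonWithHoles

variable {P : PolygonWithHoles} {R : Set Plane}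

/-! ### Turning points of shortest paths -/

/-- The last vertex before the end point of a segment. -/
lemma exists_last_vertex (P : PolygonWithHoles) {p v : Plane} (hpv : p ≠ v) :
    ∃ s : ℝ, 0 ≤ s ∧ s < 1 ∧
      ∀ z ∈ openSegment ℝ (p + s • (v - p)) v, ¬ P.IsVertex z := by
  have hfin : {z | z ∈ segment ℝ p v ∧ z ≠ v ∧ (z = p ∨ P.IsVertex z)}.Finite :=
    ((finite_singleton p).union P.finite_vertices).subset fun u hu => by
      rcases hu.2.2 with rfl | h
      · exact Or.inl rfl
      · exact Or.inr h
  obtain ⟨u, hu, hmin⟩ := Set.exists_min_image _ (fun z => dist z v) hfin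
    ⟨p, left_mem_segment _ _ _, hpv, Or.inl rfl⟩
  obtain ⟨s, h0, h1, rfl⟩ := mem_segment_iff_smul.1 hu.1
  refine ⟨s, h0, lt_of_le_of_ne h1 ?_, ?_⟩
  · rintro rfl; exact hu.2.1 (by simp)
  · intro z hz hzv
    have hzs := openSegment_subset_segment _ _ _ hz
    have hzne : z ≠ v := by
      rintro rfl; exact hu.2.1 (right_mem_openSegment_iff.1 hz)
    have hzne' : p + s • (v - p) ≠ z := by
      rintro h; rw [← h] at hz
      exact hu.2.1 (left_mem_openSegment_iff.1 hz)
    have h2 := hmin z ⟨(convex_segment p v).segment_subset hu.1 (right_mem_segment _ _ _) hzs,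
      hzne, Or.inr hzv⟩
    have h3 := dist_add_dist_of_mem_segment hzs
    have h4 := dist_pos.2 hzne'
    linarith

/-- A path that turns at a point where the environment is locally convex is not shortest. -/
lemma geoDistSet_lt_of_turn (hR : IsCompact R) {p v y : Plane} {E : ℝ≥0∞} (hE : E ≠ ⊤)
    (hEle : ∀ z, P.Visible z y → P.geoDistSet z R ≤ edist z y + E) (hpv : P.Visible p v)
    (hv : P.LocallyConvexAt v) (hvy : P.Visible v y) (hc : v ∉ segment ℝ p y) :
    P.geoDistSet p R < edist p v + (edist v y + E) := by
  have hne : p ≠ v := by rintro rfl; exact hc (left_mem_segment _ _ _)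
  -- A shortcut needs a leg without inner vertices, so only the part from the last vertex `u` is
  -- altered.
  obtain ⟨s, h0, h1, hnv⟩ := P.exists_last_vertex hne
  have hu : p + s • (v - p) ∈ segment ℝ p v := mem_segment_iff_smul.2 ⟨s, h0, h1.le, rfl⟩
  have hcu : v ∉ segment ℝ (p + s • (v - p)) y := by
    intro h
    refine hc ?_
    rw [mem_segment_iff_sameRay] at h ⊢
    rw [show v - (p + s • (v - p)) = (1 - s) • (v - p) by module] at h
    have h2 := h.pos_smul_left (inv_pos.2 (sub_pos.2 h1))
    rwa [smul_smul, inv_mul_cancel₀ (sub_pos.2 h1).ne', one_smul] at h2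
  set u := p + s • (v - p)
  obtain ⟨w, huw, hwy, hlt⟩ := exists_shortcut (hpv.mono hu (right_mem_segment _ _ _)) hnv hv hvy hcu
  calc P.geoDistSet p R ≤ edist p u + P.geoDistSet u R :=
        geoDistSet_le_add hR (hpv.mono (left_mem_segment _ _ _) hu)
    _ ≤ edist p u + (edist u w + P.geoDistSet w R) := by gcongr; exact geoDistSet_le_add hR huw
    _ ≤ edist p u + (edist u w + (edist w y + E)) := by gcongr; exact hEle w hwy
    _ = edist p u + ((edist u w + edist w y) + E) := by rw [add_assoc]
    _ < edist p u + ((edist u v + edist v y) + E) :=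
        ENNReal.add_lt_add_left (edist_ne_top _ _) (ENNReal.add_lt_add_right hE hlt)
    _ = edist p v + (edist v y + E) := by
        rw [← edist_add_edist_of_mem_segment hu]; ring

lemma chainLength_append (a b : List Plane) (v : Plane) :
    chainLength (a ++ v :: b) = chainLength (a ++ [v]) + chainLength (v :: b) := by
  induction a with
  | nil => simp [chainLength]
  | cons x a ih =>
    cases a with
    | nil => simp [chainLength]
    | cons y a =>
      simp only [List.cons_append, chainLength_cons_cons] at ih ⊢
      rw [ih, add_assoc]

/-- A shortest path whose part up to `v` is straight is either straight or turns first at a reflex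
vertex. -/
lemma straight_or_exists_reflex_turn (hR : IsCompact R) {p q : Plane} (hq : q ∈ R)
    (hp : P.geoDistSet p R ≠ ⊤) (l : List Plane) : ∀ (l₁ : List Plane) (v : Plane),
    P.IsVertex v → P.IsPath v l q → P.Visible p v →
    edist p v + chainLength (v :: (l ++ [q])) = P.geoDistSet p R →
    chainLength (p :: (l₁ ++ [v])) = edist p v →
    (P.Visible p q ∧ P.geoDistSet p R = edist p q) ∨
    ∃ l₁' v' l₂, l₁ ++ v :: l = l₁' ++ v' :: l₂ ∧ P.IsReflexVertex v' ∧
      chainLength (p :: (l₁' ++ [v'])) = edist p v' ∧ p ≠ v' ∧ P.IsVertex v' ∧ P.Visible p v' ∧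
      P.IsPath v' l₂ q ∧ edist p v' + chainLength (v' :: (l₂ ++ [q])) = P.geoDistSet p R := by
  induction l with
  | nil =>
    intro l₁ v hv hl hpv hlen hstr
    have hvq := isPath_nil.1 hl
    by_cases hc : v ∈ segment ℝ p q
    · refine Or.inl ⟨hpv.trans_of_mem_segment hvq hc, ?_⟩
      rw [← hlen, List.nil_append, chainLength_pair, edist_add_edist_of_mem_segment hc]
    · refine Or.inr ⟨l₁, v, [], rfl, ?_, hstr, ?_, hv, hpv, hl, hlen⟩
      · by_contra hr
        have := geoDistSet_lt_of_turn (E := 0) hR (by simp) (fun z hz => by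
          rw [add_zero]; exact geoDistSet_le_edist hz hq) hpv
          (locallyConvexAt_of_not_isReflexVertex hv hr) hvq hc
        rw [← hlen, List.nil_append, chainLength_pair, add_zero] at this
        exact lt_irrefl _ this
      · rintro rfl; exact hc (left_mem_segment _ _ _)
  | cons x l ih =>
    intro l₁ v hv hl hpv hlen hstr
    obtain ⟨hx, hvx, hl'⟩ := isPath_cons.1 hl
    rw [List.cons_append, chainLength_cons_cons] at hlen
    by_cases hc : v ∈ segment ℝ p x
    · have hlen' := hlen
      rw [← add_assoc, edist_add_edist_of_mem_segment hc] at hlen'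
      have hstr' : chainLength (p :: ((l₁ ++ [v]) ++ [x])) = edist p x := by
        have := chainLength_append (p :: l₁) [x] v
        rw [List.cons_append, List.cons_append, hstr, chainLength_pair,
          edist_add_edist_of_mem_segment hc] at this
        rw [← this]; simp
      rcases ih (l₁ ++ [v]) x hx hl' (hpv.trans_of_mem_segment hvx hc) hlen' hstr' with
        h | ⟨l₁', v', l₂, h1, h2⟩
      · exact Or.inl h
      · exact Or.inr ⟨l₁', v', l₂, by rw [← h1]; simp, h2⟩
    · refine Or.inr ⟨l₁, v, x :: l, rfl, ?_, hstr, ?_, hv, hpv, hl, ?_⟩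
      · by_contra hr
        have := geoDistSet_lt_of_turn (R := R) (E := chainLength (x :: (l ++ [q]))) hR
          (fun h => hp (by rw [← hlen, h]; simp)) (fun z hz => by
            rw [← chainLength_cons_cons]
            exact geoDistSet_le_of_isPath (l := x :: l) (isPath_cons.2 ⟨hx, hz, hl'⟩) hq) hpv
          (locallyConvexAt_of_not_isReflexVertex hv hr) hvx hc
        rw [hlen] at this
        exact lt_irrefl _ this
      · rintro rfl; exact hc (left_mem_segment _ _ _)
      · rw [List.cons_append, chainLength_cons_cons, hlen]

lemma straight_or_reflex_of_isShortestPathTo {U : Set Plane} {δ : ℝ}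
    (hR : IsCompact (frontier U)) {p : Plane} (hp : p ∈ P.expandedBoundary U δ) {l : List Plane}
    {q : Plane} (hl : P.IsShortestPathTo (frontier U) p l q) :
    (p ∈ P.directPart U δ ∧ chainLength (p :: (l ++ [q])) = edist p q) ∨
      ∃ l₁ v l₂, l = l₁ ++ v :: l₂ ∧ P.IsReflexVertex v ∧
        chainLength (p :: (l₁ ++ [v])) = edist p v ∧ p ∈ P.partVia U δ v := by
  obtain ⟨hq, hpath, hlen⟩ := hl
  have htop : P.geoDistSet p (frontier U) ≠ ⊤ := by rw [hp.2]; exact ENNReal.ofReal_ne_top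
  have hdir : ∀ {q}, q ∈ frontier U → P.Visible p q → P.geoDistSet p (frontier U) = edist p q →
      p ∈ P.directPart U δ := fun hq hv he =>
    ⟨hp, _, hq, isPath_nil.2 hv, by rw [List.nil_append, chainLength_pair, he]⟩
  cases l with
  | nil =>
    refine Or.inl ⟨⟨hp, q, hq, hpath, hlen⟩, ?_⟩
    rw [List.nil_append, chainLength_pair]
  | cons v l =>
    obtain ⟨hv, hpv, hl'⟩ := isPath_cons.1 hpath
    rcases straight_or_exists_reflex_turn hR hq htop l [] v hv hl' hpv
      (by rw [← hlen, List.cons_append, chainLength_cons_cons]) (chainLength_pair _ _) with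
      ⟨h1, h2⟩ | ⟨l₁, v', l₂, h1, h2, h3, h4, h5, h6, h7, h8⟩
    · exact Or.inl ⟨hdir hq h1 h2, by rw [hlen, h2]⟩
    · refine Or.inr ⟨l₁, v', l₂, h1, h2, h3, hp, h4, l₂, q, hq, isPath_cons.2 ⟨h5, h6, h7⟩, ?_⟩
      rw [← h8, List.cons_append, chainLength_cons_cons]

/-- First-order condition for straight shortest paths ending in a smooth curve. -/
lemma inner_deriv_eq_zero_of_straight (hR : IsCompact R) (hRP : R ⊆ P.carrier) {p q : Plane}
    (hpq : P.Visible p q) (hd : P.geoDistSet p R = edist p q) (hq : ¬ P.IsVertex q)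
    {κ : ℝ → Plane} {t₀ : ℝ} {κ' : Plane} (hκ : HasDerivAt κ κ' t₀) (hκq : κ t₀ = q)
    (hmem : ∀ᶠ t in 𝓝 t₀, κ t ∈ R) : inner ℝ (p - q) κ' = 0 := by
  rcases eq_or_ne p q with rfl | hne
  · simp
  obtain ⟨s, h0, h1, hnv⟩ := P.exists_last_vertex hne
  have hu : p + s • (q - p) ∈ segment ℝ p q := mem_segment_iff_smul.2 ⟨s, h0, h1.le, rfl⟩
  have hqu : q - (p + s • (q - p)) = -((1 - s) • (p - q)) := by module
  set u := p + s • (q - p)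
  have huq := hpq.mono hu (right_mem_segment _ _ _)
  have hev := eventually_visible huq hnv (locallyConvexAt_of_not_isVertex hpq.right_mem hq)
  -- Near `t₀` the curve is visible from `u`, though perhaps not from `p`. A point of it closer to
  -- `u` than `q` would shorten the route from `p` through `u`.
  have hmin : IsLocalMin (fun t => ‖κ t - u‖ ^ 2) t₀ := by
    have hκc : Tendsto κ (𝓝 t₀) (𝓝 q) := hκq ▸ hκ.continuousAt.tendsto
    filter_upwards [hmem, hκc.eventually hev] with t ht hv
    have h2 : P.geoDistSet p R ≤ edist p u + edist u (κ t) :=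
      (geoDistSet_le_add hR (hpq.mono (left_mem_segment _ _ _) hu)).trans (by
        gcongr; exact geoDistSet_le_edist (hv (hRP ht)) ht)
    rw [hd, ← edist_add_edist_of_mem_segment hu,
      ENNReal.add_le_add_iff_left (edist_ne_top _ _)] at h2
    rw [edist_dist, edist_dist, ENNReal.ofReal_le_ofReal_iff dist_nonneg, dist_comm u, dist_comm u,
      dist_eq_norm, dist_eq_norm] at h2
    rw [hκq]
    gcongr
  have h3 := hmin.hasDerivAt_eq_zero (hκ.sub_const u).norm_sq
  rw [hκq, hqu, inner_neg_left, real_inner_smul_left] at h3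
  have : (1 - s) ≠ 0 := by linarith
  have h4 : (1 - s) * inner ℝ (p - q) κ' = 0 := by linarith
  exact (mul_eq_zero.1 h4).resolve_left this

end PolygonWithHoles

/-! ### One-sided germs -/

/-- The germ of `f` at `0` from the right is that of a meromorphic function. -/
def MeroRight {E : Type*} [NormedAddCommGroup E] [NormedSpace ℝ E] (f : ℝ → E) : Prop :=
  ∃ g : ℝ → E, MeromorphicAt g 0 ∧ f =ᶠ[𝓝[>] 0] g

/-- The predicate holds on an interval to the right of `0`, or its negation does. -/
def Decided (p : ℝ → Prop) : Prop := (∀ᶠ t in 𝓝[>] 0, p t) ∨ ∀ᶠ t in 𝓝[>] 0, ¬ p t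

namespace Decided

variable {p q : ℝ → Prop}

lemma const (a : Prop) : Decided fun _ => a := by
  by_cases h : a
  · exact Or.inl (Eventually.of_forall fun _ => h)
  · exact Or.inr (Eventually.of_forall fun _ => h)

lemma congr (hp : Decided p) (h : ∀ᶠ t in 𝓝[>] 0, (q t ↔ p t)) : Decided q := by
  rcases hp with hp | hp
  · left; filter_upwards [hp, h] with t h1 h2 using h2.2 h1
  · right; filter_upwards [hp, h] with t h1 h2 using fun h3 => h1 (h2.1 h3)

lemma not (hp : Decided p) : Decided fun t => ¬ p t :=
  hp.symm.imp id fun h => h.mono fun _ h => not_not.2 h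

lemma and (hp : Decided p) (hq : Decided q) : Decided fun t => p t ∧ q t := by
  rcases hp with hp | hp
  · exact hq.congr (hp.mono fun t h => and_iff_right h)
  · exact Or.inr (hp.mono fun t h h' => h h'.1)

lemma imp (hp : Decided p) (hq : Decided q) : Decided fun t => p t → q t := by
  have := (hp.and hq.not).not
  refine this.congr (Eventually.of_forall fun t => by tauto)

lemma or (hp : Decided p) (hq : Decided q) : Decided fun t => p t ∨ q t := by
  have := (hp.not.and hq.not).not
  refine this.congr (Eventually.of_forall fun t => by tauto)

lemma forall_mem {ι : Type*} {s : Set ι} (hs : s.Finite) {p : ι → ℝ → Prop}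
    (h : ∀ i ∈ s, Decided (p i)) : Decided fun t => ∀ i ∈ s, p i t := by
  by_cases hall : ∀ i ∈ s, ∀ᶠ t in 𝓝[>] 0, p i t
  · exact Or.inl ((eventually_all_finite hs).2 hall)
  · push Not at hall
    obtain ⟨i, hi, hni⟩ := hall
    exact Or.inr (((h i hi).resolve_left (not_eventually.2 hni)).mono fun t ht h' => ht (h' i hi))

lemma exists_mem {ι : Type*} {s : Set ι} (hs : s.Finite) {p : ι → ℝ → Prop}
    (h : ∀ i ∈ s, Decided (p i)) : Decided fun t => ∃ i ∈ s, p i t := by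
  refine (forall_mem hs fun i hi => (h i hi).not).not.congr (Eventually.of_forall fun t => ?_)
  push Not; rfl

end Decided

namespace MeroRight

variable {E : Type*} [NormedAddCommGroup E] [NormedSpace ℝ E]

lemma of_analyticAt {f : ℝ → E} (h : AnalyticAt ℝ f 0) : MeroRight f :=
  ⟨f, h.meromorphicAt, EventuallyEq.rfl⟩

lemma const (a : E) : MeroRight fun _ => a := of_analyticAt analyticAt_const

lemma congr {f g : ℝ → E} (hf : MeroRight f) (h : g =ᶠ[𝓝[>] 0] f) : MeroRight g := by
  obtain ⟨k, hk, hfk⟩ := hf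
  exact ⟨k, hk, h.trans hfk⟩

lemma add {f g : ℝ → E} (hf : MeroRight f) (hg : MeroRight g) : MeroRight fun t => f t + g t := by
  obtain ⟨f', hf', hf⟩ := hf
  obtain ⟨g', hg', hg⟩ := hg
  exact ⟨f' + g', hf'.add hg', hf.add hg⟩

lemma sub {f g : ℝ → E} (hf : MeroRight f) (hg : MeroRight g) : MeroRight fun t => f t - g t := by
  obtain ⟨f', hf', hf⟩ := hf
  obtain ⟨g', hg', hg⟩ := hg
  exact ⟨f' - g', hf'.sub hg', hf.sub hg⟩

lemma smul {f : ℝ → ℝ} {g : ℝ → E} (hf : MeroRight f) (hg : MeroRight g) :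
    MeroRight fun t => f t • g t := by
  obtain ⟨f', hf', hf⟩ := hf
  obtain ⟨g', hg', hg⟩ := hg
  exact ⟨f' • g', hf'.smul hg', hf.smul hg⟩

lemma mul {f g : ℝ → ℝ} (hf : MeroRight f) (hg : MeroRight g) : MeroRight fun t => f t * g t :=
  hf.smul hg

lemma div {f g : ℝ → ℝ} (hf : MeroRight f) (hg : MeroRight g) : MeroRight fun t => f t / g t := by
  obtain ⟨f', hf', hf⟩ := hf
  obtain ⟨g', hg', hg⟩ := hg
  exact ⟨f' / g', hf'.div hg', hf.div hg⟩

lemma apply {f : ℝ → Plane} (hf : MeroRight f) (i : Fin 2) : MeroRight fun t => f t i := by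
  obtain ⟨g, hg, hfg⟩ := hf
  obtain ⟨n, h, hh, hgh⟩ := MeromorphicAt.iff_eventuallyEq_zpow_smul_analyticAt.1 hg
  refine ⟨fun t => g t i, MeromorphicAt.iff_eventuallyEq_zpow_smul_analyticAt.2
    ⟨n, fun t => h t i, ?_, ?_⟩, hfg.mono fun t ht => by simp only [ht]⟩
  · exact ((EuclideanSpace.proj i : Plane →L[ℝ] ℝ).analyticAt _).comp hh
  · filter_upwards [hgh] with t ht
    rw [ht]; rfl

lemma cross {f g : ℝ → Plane} (hf : MeroRight f) (hg : MeroRight g) :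
    MeroRight fun t => cross (f t) (g t) :=
  ((hf.apply 0).mul (hg.apply 1)).sub ((hf.apply 1).mul (hg.apply 0))

lemma inner {f g : ℝ → Plane} (hf : MeroRight f) (hg : MeroRight g) :
    MeroRight fun t => inner ℝ (f t) (g t) := by
  refine (((hf.apply 0).mul (hg.apply 0)).add ((hf.apply 1).mul (hg.apply 1))).congr
    (Eventually.of_forall fun t => ?_)
  simp [PiLp.inner_apply, mul_comm]

/-- A germ that is not eventually zero is a power times a nonvanishing analytic function. -/
lemma eventually_zero_or_exists {f : ℝ → E} (hf : MeroRight f) :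
    (∀ᶠ t in 𝓝[>] 0, f t = 0) ∨ ∃ (n : ℤ) (h : ℝ → E), AnalyticAt ℝ h 0 ∧ h 0 ≠ 0 ∧
      ∀ᶠ t in 𝓝[>] 0, f t = t ^ n • h t := by
  obtain ⟨g, hg, hfg⟩ := hf
  have hle : 𝓝[>] (0 : ℝ) ≤ 𝓝[≠] 0 := nhdsWithin_mono _ fun t ht => ne_of_gt ht
  by_cases htop : meromorphicOrderAt g 0 = ⊤
  · left
    filter_upwards [(meromorphicOrderAt_eq_top_iff.1 htop).filter_mono hle, hfg] with t h1 h2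
    rw [h2, h1]
  · right
    obtain ⟨h, h1, h2, h3⟩ := (meromorphicOrderAt_ne_top_iff hg).1 htop
    refine ⟨(meromorphicOrderAt g 0).untop₀, h, h1, h2, ?_⟩
    filter_upwards [h3.filter_mono hle, hfg] with t h4 h5
    rw [h5, h4, sub_zero]

/-- Write the germ as `t ^ n • h t` with `h 0 ≠ 0`: the norm is analytic away from the origin, and
`t ^ n` is positive for `t > 0`. This is where one-sidedness is essential. -/
lemma norm {f : ℝ → Plane} (hf : MeroRight f) : MeroRight fun t => ‖f t‖ := by
  rcases hf.eventually_zero_or_exists with h | ⟨n, h, h1, h2, h3⟩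
  · exact (const (0 : ℝ)).congr (h.mono fun t ht => by simp [ht])
  · have hn : AnalyticAt ℝ (fun t => ‖h t‖) 0 :=
      (h1.contDiffAt.norm ℝ h2).analyticAt
    refine ⟨fun t => t ^ n • ‖h t‖, MeromorphicAt.iff_eventuallyEq_zpow_smul_analyticAt.2
      ⟨n, _, hn, Eventually.of_forall fun t => by simp⟩, ?_⟩
    filter_upwards [h3, self_mem_nhdsWithin] with t ht ht0
    have ht0 : 0 < t := ht0
    rw [ht, norm_smul, Real.norm_of_nonneg (zpow_pos ht0 n).le, smul_eq_mul]

/-- Sign trichotomy for germs. -/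
lemma eventually_sign {f : ℝ → ℝ} (hf : MeroRight f) :
    (∀ᶠ t in 𝓝[>] 0, f t = 0) ∨ (∀ᶠ t in 𝓝[>] 0, 0 < f t) ∨ ∀ᶠ t in 𝓝[>] 0, f t < 0 := by
  rcases hf.eventually_zero_or_exists with h | ⟨n, h, h1, h2, h3⟩
  · exact Or.inl h
  · right
    rcases h2.lt_or_gt with h2 | h2
    · right
      filter_upwards [h3, self_mem_nhdsWithin,
        (h1.continuousAt.eventually (gt_mem_nhds h2)).filter_mono nhdsWithin_le_nhds]
        with t ht ht0 h4
      have ht0 : 0 < t := ht0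
      rw [ht, smul_eq_mul]
      exact mul_neg_of_pos_of_neg (zpow_pos ht0 n) h4
    · left
      filter_upwards [h3, self_mem_nhdsWithin,
        (h1.continuousAt.eventually (lt_mem_nhds h2)).filter_mono nhdsWithin_le_nhds]
        with t ht ht0 h4
      have ht0 : 0 < t := ht0
      rw [ht, smul_eq_mul]
      exact mul_pos (zpow_pos ht0 n) h4

lemma decided_le {f g : ℝ → ℝ} (hf : MeroRight f) (hg : MeroRight g) :
    Decided fun t => f t ≤ g t := by
  rcases (hg.sub hf).eventually_sign with h | h | h
  · exact Or.inl (h.mono fun t ht => by linarith)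
  · exact Or.inl (h.mono fun t ht => by linarith)
  · exact Or.inr (h.mono fun t ht => by linarith)

lemma decided_eq {f g : ℝ → ℝ} (hf : MeroRight f) (hg : MeroRight g) :
    Decided fun t => f t = g t :=
  ((hf.decided_le hg).and (hg.decided_le hf)).congr
    (Eventually.of_forall fun _ => le_antisymm_iff)

lemma eventually_continuousAt {f : ℝ → E} (hf : MeroRight f) :
    ∀ᶠ t in 𝓝[>] 0, ContinuousAt f t := by
  obtain ⟨g, hg, hfg⟩ := hf
  have hle : 𝓝[>] (0 : ℝ) ≤ 𝓝[≠] 0 := nhdsWithin_mono _ fun t ht => ne_of_gt ht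
  filter_upwards [hg.eventually_continuousAt.filter_mono hle,
    eventually_eventually_nhdsWithin.2 hfg, self_mem_nhdsWithin] with t h1 h2 h3
  rw [isOpen_Ioi.nhdsWithin_eq h3] at h2
  exact h1.congr_of_eventuallyEq h2

end MeroRight

lemma mem_segment_iff_cross {a b x : Plane} (hab : a ≠ b) :
    x ∈ segment ℝ a b ↔ cross (b - a) (x - a) = 0 ∧ 0 ≤ inner ℝ (x - a) (b - a) ∧
      inner ℝ (x - a) (b - a) ≤ ‖b - a‖ ^ 2 := by
  have hne : b - a ≠ 0 := sub_ne_zero.2 hab.symm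
  have hpos : 0 < ‖b - a‖ ^ 2 := by positivity
  rw [mem_segment_iff_smul]
  constructor
  · rintro ⟨s, h0, h1, rfl⟩
    rw [add_sub_cancel_left, cross_smul_right, cross_self, real_inner_smul_left,
      real_inner_self_eq_norm_sq]
    exact ⟨by simp, by positivity, by nlinarith⟩
  · rintro ⟨h, h0, h1⟩
    obtain ⟨s, hs⟩ := exists_smul_of_cross_eq_zero hne h
    rw [hs, real_inner_smul_left, real_inner_self_eq_norm_sq] at h0 h1
    refine ⟨s, ?_, ?_, ?_⟩
    · by_contra! hc; nlinarith
    · by_contra! hc; nlinarith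
    · rw [← hs]; abel

lemma MeroRight.decided_mem_segment {m : ℝ → Plane} (hm : MeroRight m) {a b : Plane}
    (hab : a ≠ b) : Decided fun t => m t ∈ segment ℝ a b := by
  have hma := hm.sub (MeroRight.const a)
  refine (((((MeroRight.const (b - a)).cross hma).decided_eq (MeroRight.const 0)).and
    (((MeroRight.const 0).decided_le (hma.inner (MeroRight.const (b - a)))).and
    ((hma.inner (MeroRight.const (b - a))).decided_le (MeroRight.const (‖b - a‖ ^ 2)))))).congr
    (Eventually.of_forall fun t => mem_segment_iff_cross hab)

/-! ### Membership and visibility along germs -/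

namespace PolygonWithHoles

variable {P : PolygonWithHoles}

lemma ne_of_mem_edges {e : Plane × Plane} (he : e ∈ P.edges) : e.1 ≠ e.2 := by
  obtain ⟨Q, -, i, rfl⟩ := he
  exact (Q.poly_finRotate_ne i).symm

/-- Either the curve eventually runs in the edges, which belong to the environment, or it is
continuous and off the edges on some interval `(0, ε)`; there it cannot cross the frontier. -/
lemma decided_mem_carrier {m : ℝ → Plane} (hm : MeroRight m) :
    Decided fun t => m t ∈ P.carrier := by
  have hb : Decided fun t => m t ∈ P.bdry :=
    (Decided.exists_mem P.finite_edges fun e he =>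
      hm.decided_mem_segment (ne_of_mem_edges he)).congr
      (Eventually.of_forall fun t => by simp [bdry])
  rcases hb with hb | hb
  · exact Or.inl (hb.mono fun t ht => bdry_subset_carrier ht)
  · obtain ⟨ε, hε, hsub⟩ := mem_nhdsGT_iff_exists_Ioo_subset.1 (hb.and hm.eventually_continuousAt)
    have hε : 0 < ε := hε
    have hS : IsPreconnected (m '' Ioo 0 ε) := isPreconnected_Ioo.image _ fun t ht =>
      (hsub ht).2.continuousWithinAt
    have hfr : ∀ y ∈ m '' Ioo 0 ε, y ∉ frontier P.carrier := by
      rintro _ ⟨t, ht, rfl⟩ h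
      exact (hsub ht).1 (frontier_carrier_subset h)
    have hmem : Ioo 0 ε ∈ 𝓝[>] (0 : ℝ) := Ioo_mem_nhdsGT hε
    by_cases hex : ∃ t ∈ Ioo 0 ε, m t ∈ P.carrier
    · obtain ⟨t, ht, htP⟩ := hex
      left
      filter_upwards [hmem] with s hs
      exact subset_carrier_of_isPreconnected hS hfr ⟨t, ht, rfl⟩ htP ⟨s, hs, rfl⟩
    · push Not at hex
      right
      filter_upwards [hmem] with s hs using hex s hs

/-- The parameter at which the segment from `p` to `y` meets the line through the edge `e`
(a junk value if they are parallel). -/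
noncomputable def breakpoint (e : Plane × Plane) (p y : Plane) : ℝ :=
  cross (e.2 - e.1) (e.1 - p) / cross (e.2 - e.1) (y - p)

/-- The parameters on a segment that separate possible changes of membership. -/
noncomputable def breakpoints (P : PolygonWithHoles) : Set (Plane → Plane → ℝ) :=
  {fun _ _ => 0, fun _ _ => 1} ∪ breakpoint '' P.edges

lemma finite_breakpoints (P : PolygonWithHoles) : P.breakpoints.Finite :=
  ((finite_singleton _).insert _).union (P.finite_edges.image _)

/-- At a boundary point of the segment that is no breakpoint, all edges through it are parallel to
the segment. The boundary is then locally a line, and the segment runs along it. -/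
lemma eventually_mem_carrier_of_not_breakpoint {p y : Plane} {s : ℝ}
    (hs : p + s • (y - p) ∈ P.carrier) (hbp : ∀ e ∈ P.edges, breakpoint e p y ≠ s) :
    ∀ᶠ s' in 𝓝 s, p + s' • (y - p) ∈ P.carrier := by
  have hcont : Continuous fun s' : ℝ => p + s' • (y - p) := by fun_prop
  have ht : Tendsto (fun s' : ℝ => p + s' • (y - p)) (𝓝 s) (𝓝 (p + s • (y - p))) := hcont.tendsto s
  by_cases hb : p + s • (y - p) ∈ P.bdry
  · rcases eq_or_ne (y - p) 0 with h0 | h0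
    · rw [h0] at hs ⊢
      simp only [smul_zero] at hs ⊢
      exact Eventually.of_forall fun _ => hs
    obtain ⟨d₁, d₂, hL, -, hpar⟩ := exists_localRays hb
    obtain ⟨h1, h2⟩ := hpar (y - p) (fun e he hx => by
      by_contra hc
      refine hbp e he ?_
      obtain ⟨k, -, -, hk⟩ := mem_segment_iff_smul.1 hx
      rw [breakpoint, div_eq_iff hc]
      have h3 : e.1 - p = s • (y - p) - k • (e.2 - e.1) := by
        rw [sub_eq_sub_iff_add_eq_add, ← add_comm p, hk]
      rw [h3, cross_sub_right, cross_smul_right, cross_smul_right, cross_self]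
      ring)
    have hc : cross d₁ d₂ = 0 := cross_eq_zero_trans h0 h1 (by rw [cross_swap, h2, neg_zero])
    obtain ⟨ε, hε, hball⟩ := hL.exists_flat_ball hc
    filter_upwards [ht.eventually (Metric.ball_mem_nhds _ hε)] with s' hs'
    refine bdry_subset_carrier ((hball _ hs').2 ?_)
    rw [show p + s' • (y - p) - (p + s • (y - p)) = (s' - s) • (y - p) by module,
      cross_smul_right, h1, mul_zero]
  · exact ht.eventually (eventually_mem_carrier_of_notMem_bdry hs hb)

/-- Visibility can be tested at finitely many points. -/
lemma visible_iff_breakpoints {p y : Plane} : P.Visible p y ↔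
    ∀ τ ∈ P.breakpoints, ∀ τ' ∈ P.breakpoints, 0 ≤ τ p y → τ p y ≤ 1 → 0 ≤ τ' p y → τ' p y ≤ 1 →
      p + ((τ p y + τ' p y) / 2) • (y - p) ∈ P.carrier := by
  constructor
  · intro h τ _ τ' _ h1 h2 h3 h4
    exact visible_iff.1 h _ (by linarith) (by linarith)
  · intro h
    rw [visible_iff]
    intro s h0 h1
    by_contra hs
    set T : Set ℝ := {r | 0 ≤ r ∧ r ≤ 1 ∧ ∃ τ ∈ P.breakpoints, τ p y = r} with hT
    have hTf : T.Finite := (P.finite_breakpoints.image fun τ : Plane → Plane → ℝ => τ p y).subset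
      fun r hr => hr.2.2
    have hT0 : (0 : ℝ) ∈ T := ⟨le_rfl, zero_le_one, _, Or.inl (Or.inl rfl), rfl⟩
    have hT1 : (1 : ℝ) ∈ T := ⟨zero_le_one, le_rfl, _, Or.inl (Or.inr rfl), rfl⟩
    have htest : ∀ r ∈ T, ∀ r' ∈ T, p + ((r + r') / 2) • (y - p) ∈ P.carrier := by
      rintro _ ⟨a1, a2, τ, hτ, rfl⟩ _ ⟨b1, b2, τ', hτ', rfl⟩
      exact h τ hτ τ' hτ' a1 a2 b1 b2
    -- Choosing `τ = τ'` in the hypothesis tests the breakpoints themselves.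
    have hsT : s ∉ T := fun hsT => hs (by
      have := htest s hsT s hsT
      rwa [add_self_div_two] at this)
    obtain ⟨r, ⟨hrT, hrs⟩, hrmax⟩ := Set.exists_max_image (T ∩ Iic s) id
      (hTf.inter_of_left _) ⟨0, hT0, h0⟩
    obtain ⟨r', ⟨hrT', hrs'⟩, hrmin⟩ := Set.exists_min_image (T ∩ Ici s) id
      (hTf.inter_of_left _) ⟨1, hT1, h1⟩
    have hrs : r < s := lt_of_le_of_ne hrs fun h => hsT (h ▸ hrT)
    have hrs' : s < r' := lt_of_le_of_ne hrs' fun h => hsT (h ▸ hrT')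
    have hgap : ∀ a ∈ Ioo r r', ∀ e ∈ P.edges, breakpoint e p y ≠ a := by
      rintro a ⟨ha1, ha2⟩ e he hea
      have haT : a ∈ T := ⟨hrT.1.trans ha1.le, ha2.le.trans hrT'.2.1, _, Or.inr ⟨e, he, rfl⟩, hea⟩
      rcases le_total a s with h | h
      · exact absurd (hrmax a ⟨haT, h⟩) (not_le.2 ha1)
      · exact absurd (hrmin a ⟨haT, h⟩) (not_le.2 ha2)
    have hmid : (r + r') / 2 ∈ Ioo r r' := ⟨by linarith, by linarith⟩
    -- Between consecutive breakpoints the admissible parameters form a relatively open and closed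
    -- set, so the midpoint decides the whole gap.
    set V : Set ℝ := {a | p + a • (y - p) ∈ P.carrier}
    have hVc : IsClosed V := isClosed_carrier.preimage (by fun_prop)
    have hint : ∀ a ∈ Ioo r r', a ∈ V → a ∈ interior V := fun a ha haV =>
      mem_interior_iff_mem_nhds.2 (eventually_mem_carrier_of_not_breakpoint haV (hgap a ha))
    obtain ⟨z, -, hz1, hz2⟩ := isPreconnected_Ioo (interior V) Vᶜ isOpen_interior hVc.isOpen_compl
      (fun a ha => (em (a ∈ V)).imp (hint a ha) id)
      ⟨_, hmid, hint _ hmid (htest r hrT r' hrT')⟩ ⟨s, ⟨hrs, hrs'⟩, hs⟩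
    exact hz2 (interior_subset hz1)

lemma decided_visible {p y : ℝ → Plane} (hp : MeroRight p) (hy : MeroRight y) :
    Decided fun t => P.Visible (p t) (y t) := by
  have hbp : ∀ τ ∈ P.breakpoints, MeroRight fun t => τ (p t) (y t) := by
    rintro τ ((rfl | rfl) | ⟨e, -, rfl⟩)
    · exact MeroRight.const 0
    · exact MeroRight.const 1
    · exact ((MeroRight.const (e.2 - e.1)).cross ((MeroRight.const e.1).sub hp)).div
        ((MeroRight.const (e.2 - e.1)).cross (hy.sub hp))
  have h0 := MeroRight.const (0 : ℝ)
  have h1 := MeroRight.const (1 : ℝ)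
  refine (Decided.forall_mem P.finite_breakpoints fun τ hτ =>
    Decided.forall_mem P.finite_breakpoints fun τ' hτ' =>
    (h0.decided_le (hbp τ hτ)).imp <| ((hbp τ hτ).decided_le h1).imp <|
    (h0.decided_le (hbp τ' hτ')).imp <| ((hbp τ' hτ').decided_le h1).imp <|
    decided_mem_carrier (P := P) (hp.add ((((hbp τ hτ).add (hbp τ' hτ')).div
      (MeroRight.const 2)).smul (hy.sub hp)))).congr
    (Eventually.of_forall fun t => visible_iff_breakpoints)

end PolygonWithHoles

/-- A compact set of reals with decided one-sided germs is a finite union of intervals. -/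
lemma exists_finite_Icc_cover {S : Set ℝ} (hS : IsCompact S)
    (h : ∀ s, Decided (fun t => s + t ∈ S) ∧ Decided fun t => s - t ∈ S) :
    ∃ F : Set (ℝ × ℝ), F.Finite ∧ (∀ x ∈ F, x.1 ≤ x.2 ∧ Icc x.1 x.2 ⊆ S) ∧
      S ⊆ ⋃ x ∈ F, Icc x.1 x.2 := by
  have hev : ∀ p : ℝ → Prop, (∀ᶠ t in 𝓝[>] 0, p t) → ∃ ε > 0, ∀ t, 0 < t → t ≤ ε → p t := by
    intro p hp
    obtain ⟨ε, hε, hsub⟩ := mem_nhdsGT_iff_exists_Ioc_subset.1 hp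
    exact ⟨ε, hε, fun t h0 h1 => hsub ⟨h0, h1⟩⟩
  have hloc : ∀ s ∈ S, ∃ x : ℝ × ℝ, (x.1 ≤ x.2 ∧ Icc x.1 x.2 ⊆ S) ∧
      ∀ᶠ y in 𝓝 s, y ∈ S → y ∈ Icc x.1 x.2 := by
    intro s hs
    -- To the right of `s` the set contains a full interval or nothing; accordingly `b` is `s + ε`
    -- or `s`. The left end `a` is found in the same way.
    obtain ⟨b, hsb, hb, hb'⟩ : ∃ b, s ≤ b ∧ Icc s b ⊆ S ∧ ∀ᶠ y in 𝓝 s, y ∈ S → y ≤ b := by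
      rcases (h s).1 with hd | hd <;> obtain ⟨ε, hε, hd⟩ := hev _ hd
      · refine ⟨s + ε, by linarith, fun y hy => ?_, ?_⟩
        · rcases eq_or_lt_of_le hy.1 with rfl | hlt
          · exact hs
          · have := hd (y - s) (by linarith) (by linarith [hy.2])
            rwa [add_sub_cancel] at this
        · filter_upwards [Iio_mem_nhds (show s < s + ε by linarith)] with y hy _ using hy.le
      · refine ⟨s, le_rfl, by simpa using hs, ?_⟩
        filter_upwards [Iio_mem_nhds (show s < s + ε by linarith)] with y hy hyS
        have hy : y < s + ε := hy
        by_contra! hc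
        refine hd (y - s) (by linarith) (by linarith) ?_
        simpa using hyS
    obtain ⟨a, has, ha, ha'⟩ : ∃ a, a ≤ s ∧ Icc a s ⊆ S ∧ ∀ᶠ y in 𝓝 s, y ∈ S → a ≤ y := by
      rcases (h s).2 with hd | hd <;> obtain ⟨ε, hε, hd⟩ := hev _ hd
      · refine ⟨s - ε, by linarith, fun y hy => ?_, ?_⟩
        · rcases eq_or_lt_of_le hy.2 with rfl | hlt
          · exact hs
          · have := hd (s - y) (by linarith) (by linarith [hy.1])
            rwa [sub_sub_cancel] at this
        · filter_upwards [Ioi_mem_nhds (show s - ε < s by linarith)] with y hy _ using hy.le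
      · refine ⟨s, le_rfl, by simpa using hs, ?_⟩
        filter_upwards [Ioi_mem_nhds (show s - ε < s by linarith)] with y hy hyS
        have hy : s - ε < y := hy
        by_contra! hc
        refine hd (s - y) (by linarith) (by linarith) ?_
        simpa using hyS
    refine ⟨(a, b), ⟨has.trans hsb, ?_⟩, ?_⟩
    · rw [← Icc_union_Icc_eq_Icc has hsb]
      exact union_subset ha hb
    · filter_upwards [ha', hb'] with y h1 h2 hy using ⟨h1 hy, h2 hy⟩
  choose! x hx hxev using hloc
  obtain ⟨T, hT, hcov⟩ := hS.elim_nhds_subcover (fun s => {y | y ∈ S → y ∈ Icc (x s).1 (x s).2})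
    fun s hs => hxev s hs
  refine ⟨x '' T, T.finite_toSet.image _, ?_, fun y hy => ?_⟩
  · rintro _ ⟨s, hs, rfl⟩; exact hx s (hT s hs)
  · obtain ⟨s, hs, hys⟩ := mem_iUnion₂.1 (hcov hy)
    exact mem_iUnion₂.2 ⟨x s, ⟨s, hs, rfl⟩, hys hy⟩

/-! ### Arcs -/

/-- The unit vector of direction `θ`. -/
noncomputable def unitVec (θ : ℝ) : Plane := !₂[Real.cos θ, Real.sin θ]

@[simp] lemma unitVec_zero (θ : ℝ) : unitVec θ 0 = Real.cos θ := rfl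

@[simp] lemma unitVec_one (θ : ℝ) : unitVec θ 1 = Real.sin θ := rfl

@[simp] lemma norm_unitVec (θ : ℝ) : ‖unitVec θ‖ = 1 := by
  rw [EuclideanSpace.norm_eq]; simp

lemma unitVec_eq (θ : ℝ) :
    unitVec θ = Real.cos θ • unitVec 0 + Real.sin θ • unitVec (Real.pi / 2) := by
  ext i; fin_cases i <;> simp

lemma hasDerivAt_unitVec (θ : ℝ) : HasDerivAt unitVec (unitVec (θ + Real.pi / 2)) θ := by
  rw [unitVec_eq (θ + _), Real.cos_add_pi_div_two, Real.sin_add_pi_div_two]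
  exact (((Real.hasDerivAt_cos θ).smul_const _).add ((Real.hasDerivAt_sin θ).smul_const _)).congr_of_eventuallyEq
    (Eventually.of_forall unitVec_eq)

lemma continuous_unitVec : Continuous unitVec :=
  continuous_iff_continuousAt.2 fun θ => (hasDerivAt_unitVec θ).continuousAt

lemma eq_smul_unitVec_add (x : Plane) (θ : ℝ) :
    x = inner ℝ x (unitVec θ) • unitVec θ + cross (unitVec θ) x • unitVec (θ + Real.pi / 2) := by
  have h := Real.sin_sq_add_cos_sq θ
  ext i
  fin_cases i <;>
    simp [PiLp.inner_apply, cross, Real.cos_add_pi_div_two, Real.sin_add_pi_div_two]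
  · linear_combination (-(x 0)) * h
  · linear_combination (-(x 1)) * h

lemma inner_unitVec_quarter (x : Plane) (θ : ℝ) :
    inner ℝ x (unitVec (θ + Real.pi / 2)) = cross (unitVec θ) x := by
  simp [PiLp.inner_apply, cross, Real.cos_add_pi_div_two, Real.sin_add_pi_div_two]
  ring

lemma inner_unitVec_sq_add (x : Plane) (θ : ℝ) :
    inner ℝ x (unitVec θ) ^ 2 + cross (unitVec θ) x ^ 2 = ‖x‖ ^ 2 := by
  have h := Real.sin_sq_add_cos_sq θ
  rw [EuclideanSpace.norm_sq_eq]
  simp [PiLp.inner_apply, cross]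
  linear_combination (x 0 ^ 2 + x 1 ^ 2) * h

lemma analyticAt_unitVec (θ : ℝ) : AnalyticAt ℝ unitVec θ := by
  rw [funext unitVec_eq]
  exact (Real.analyticAt_cos.smul analyticAt_const).add (Real.analyticAt_sin.smul analyticAt_const)

lemma isCircularArc_iff {c : Plane} {r : ℝ} {s : Set Plane} : IsCircularArc c r s ↔
    0 ≤ r ∧ ∃ θ₁ θ₂ : ℝ, θ₁ ≤ θ₂ ∧ θ₂ ≤ θ₁ + 2 * Real.pi ∧
      s = (fun θ : ℝ => c + r • unitVec θ) '' Icc θ₁ θ₂ := Iff.rfl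

lemma inner_unitVec (θ φ : ℝ) : inner ℝ (unitVec θ) (unitVec φ) = Real.cos (θ - φ) := by
  simp [PiLp.inner_apply, Real.cos_sub]; ring

/-- Membership in a circular arc as a system of a polynomial equation and an inequality. -/
lemma mem_circularArc_iff {c x : Plane} {r θ₁ θ₂ : ℝ} (hr : 0 < r) (h1 : θ₁ ≤ θ₂)
    (h2 : θ₂ ≤ θ₁ + 2 * Real.pi) : x ∈ (fun θ : ℝ => c + r • unitVec θ) '' Icc θ₁ θ₂ ↔
      ‖x - c‖ = r ∧ r * Real.cos ((θ₂ - θ₁) / 2) ≤ inner ℝ (x - c) (unitVec ((θ₁ + θ₂) / 2)) := by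
  constructor
  · rintro ⟨θ, ⟨ha, hb⟩, rfl⟩
    rw [add_sub_cancel_left, norm_smul, norm_unitVec, mul_one, Real.norm_of_nonneg hr.le,
      real_inner_smul_left, inner_unitVec]
    refine ⟨rfl, mul_le_mul_of_nonneg_left ?_ hr.le⟩
    rw [← Real.cos_abs (θ - _)]
    apply Real.cos_le_cos_of_nonneg_of_le_pi (abs_nonneg _)
    · linarith
    · rw [abs_le]; constructor <;> linarith
  · rintro ⟨hn, hin⟩
    set μ := (θ₁ + θ₂) / 2
    set α := inner ℝ (x - c) (unitVec μ)
    set β := cross (unitVec μ) (x - c)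
    have hsq : α ^ 2 + β ^ 2 = r ^ 2 := by rw [← hn]; exact inner_unitVec_sq_add _ _
    -- `α` and `β` are the coordinates of `x - c` in the frame of the arc's middle direction `μ`, so
    -- the complex argument is the signed angle from the middle of the arc.
    have hz : ‖(⟨α, β⟩ : ℂ)‖ = r := by
      rw [Complex.norm_eq_sqrt_sq_add_sq, hsq, Real.sqrt_sq hr.le]
    have hz0 : (⟨α, β⟩ : ℂ) ≠ 0 := by rw [← norm_pos_iff, hz]; exact hr
    set ψ := Complex.arg ⟨α, β⟩
    have hcos : r * Real.cos ψ = α := by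
      rw [Complex.cos_arg hz0, hz]; field_simp
    have hsin : r * Real.sin ψ = β := by
      rw [Complex.sin_arg, hz]; field_simp
    have hψ : |ψ| ≤ (θ₂ - θ₁) / 2 := by
      by_contra! hc
      have := Real.cos_lt_cos_of_nonneg_of_le_pi (by linarith) (Complex.abs_arg_le_pi ⟨α, β⟩) hc
      rw [Real.cos_abs] at this
      nlinarith
    rw [abs_le] at hψ
    have hμ : μ = (θ₁ + θ₂) / 2 := rfl
    refine ⟨μ + ψ, ⟨by linarith [hψ.1], by linarith [hψ.2]⟩, ?_⟩
    have h3 : x - c = r • unitVec (μ + ψ) := by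
      rw [eq_smul_unitVec_add (x - c) μ]
      change α • _ + β • _ = _
      rw [← hcos, ← hsin]
      ext i
      fin_cases i <;>
        simp [Real.cos_add, Real.sin_add] <;> ring
    simp only [← h3, add_sub_cancel]

lemma MeroRight.decided_mem_circularArc {c : Plane} {r θ₁ θ₂ : ℝ} (hr : 0 < r) (h1 : θ₁ ≤ θ₂)
    (h2 : θ₂ ≤ θ₁ + 2 * Real.pi) {m : ℝ → Plane} (hm : MeroRight m) :
    Decided fun t => m t ∈ (fun θ : ℝ => c + r • unitVec θ) '' Icc θ₁ θ₂ := by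
  have hmc := hm.sub (MeroRight.const c)
  exact ((hmc.norm.decided_eq (MeroRight.const r)).and ((MeroRight.const _).decided_le
    (hmc.inner (MeroRight.const _)))).congr
    (Eventually.of_forall fun t => mem_circularArc_iff hr h1 h2)

lemma IsArc.isCompact {s : Set Plane} (hs : IsArc s) : IsCompact s := by
  rcases hs with ⟨c, r, -, θ₁, θ₂, -, -, rfl⟩ | ⟨a, b, rfl⟩
  · have : Continuous fun θ => c + r • unitVec θ :=
      continuous_const.add (continuous_unitVec.const_smul r)
    exact isCompact_Icc.image this
  · rw [segment_eq_image']
    exact isCompact_Icc.image (by fun_prop)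

lemma ConsistsOfArcs.isCompact {X : Set Plane} (hX : ConsistsOfArcs X) : IsCompact X := by
  obtain ⟨S, hS, harc, rfl⟩ := hX
  exact hS.isCompact_sUnion fun s hs => (harc s hs).isCompact

/-! ### Feet of straight shortest paths and the distance along germs -/

namespace PolygonWithHoles

variable {P : PolygonWithHoles} {R : Set Plane}

/-- A straight shortest path to an inner point of a circular arc is radial. -/
lemma straight_to_circle (hR : IsCompact R) (hRP : R ⊆ P.carrier) {c x : Plane} {r θ₁ θ₂ θ : ℝ}
    (hr : r ≠ 0) (hs : (fun θ : ℝ => c + r • unitVec θ) '' Icc θ₁ θ₂ ⊆ R) (hθ : θ ∈ Ioo θ₁ θ₂)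
    (hv : P.Visible x (c + r • unitVec θ)) (hd : P.geoDistSet x R = edist x (c + r • unitVec θ))
    (hq : ¬ P.IsVertex (c + r • unitVec θ)) : ∃ l : ℝ, x = c + l • unitVec θ := by
  have h := inner_deriv_eq_zero_of_straight hR hRP hv hd hq (κ := fun θ => c + r • unitVec θ)
    (((hasDerivAt_unitVec θ).const_smul r).const_add c) rfl (by
      filter_upwards [Ioo_mem_nhds hθ.1 hθ.2] with t ht
      exact hs ⟨t, Ioo_subset_Icc_self ht, rfl⟩)
  rw [real_inner_smul_right, inner_unitVec_quarter] at h
  have h2 := (mul_eq_zero.1 h).resolve_left hr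
  have h3 : cross (unitVec θ) (x - c) = 0 := by
    rw [← sub_sub, cross_sub_right _ (x - c), cross_smul_right, cross_self, mul_zero, sub_zero] at h2
    exact h2
  refine ⟨inner ℝ (x - c) (unitVec θ), ?_⟩
  have := eq_smul_unitVec_add (x - c) θ
  rw [h3, zero_smul, add_zero] at this
  rw [← this, add_sub_cancel]

/-- A straight shortest path to an inner point of a segment is perpendicular to it. -/
lemma straight_to_segment (hR : IsCompact R) (hRP : R ⊆ P.carrier) {a b x : Plane} {s : ℝ}
    (hs : segment ℝ a b ⊆ R) (h0 : 0 < s) (h1 : s < 1)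
    (hv : P.Visible x (a + s • (b - a))) (hd : P.geoDistSet x R = edist x (a + s • (b - a)))
    (hq : ¬ P.IsVertex (a + s • (b - a))) : inner ℝ (x - (a + s • (b - a))) (b - a) = 0 := by
  have hder : HasDerivAt (fun t : ℝ => a + t • (b - a)) (b - a) s := by
    simpa using ((hasDerivAt_id s).smul_const (b - a)).const_add a
  refine inner_deriv_eq_zero_of_straight hR hRP hv hd hq hder rfl ?_
  filter_upwards [Ioo_mem_nhds h0 h1] with t ht
  exact hs (mem_segment_iff_smul.2 ⟨t, ht.1.le, ht.2.le, rfl⟩)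

/-- Finitely many base points and foot maps describe all straight shortest paths to an arc. -/
lemma exists_feet_of_isArc (hR : IsCompact R) (hRP : R ⊆ P.carrier) {s : Set Plane}
    (hs : IsArc s) (hsR : s ⊆ R) :
    ∃ (W : Set Plane) (F : Set (Plane → Plane)), W.Finite ∧ F.Finite ∧
      (∀ φ ∈ F, ∀ p : ℝ → Plane, MeroRight p →
        MeroRight (fun t => φ (p t)) ∧ Decided fun t => φ (p t) ∈ s) ∧
      ∀ x, ∀ q ∈ s, P.Visible x q → P.geoDistSet x R = edist x q → ¬ P.IsVertex q →
        q ∈ W ∨ x ∈ W ∨ ∃ φ ∈ F, φ x = q := by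
  rcases hs with ⟨c, r, hr, θ₁, θ₂, h12, h21, rfl⟩ | ⟨a, b, rfl⟩
  · change (fun θ : ℝ => c + r • unitVec θ) '' Icc θ₁ θ₂ ⊆ R at hsR
    rcases eq_or_lt_of_le hr with rfl | hr
    · refine ⟨{c}, ∅, finite_singleton _, finite_empty, by simp, ?_⟩
      rintro x _ ⟨θ, -, rfl⟩ - - -
      left; simp
    -- A radial path has its foot on the near or the opposite side of the centre, hence two foot
    -- maps. They are undefined only at the centre, which is therefore a base point, as are the end
    -- points of the arc.
    refine ⟨{c, c + r • unitVec θ₁, c + r • unitVec θ₂},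
      {fun x => c + (r / ‖x - c‖) • (x - c), fun x => c + (-r / ‖x - c‖) • (x - c)},
      by simp, by simp, ?_, ?_⟩
    · have key : ∀ (r' : ℝ) (p : ℝ → Plane), MeroRight p →
          MeroRight fun t => c + (r' / ‖p t - c‖) • (p t - c) := fun r' p hp =>
        (MeroRight.const c).add (((MeroRight.const r').div (hp.sub (MeroRight.const c)).norm).smul
          (hp.sub (MeroRight.const c)))
      rintro φ (rfl | rfl) p hp
      · exact ⟨key r p hp, (key r p hp).decided_mem_circularArc hr h12 h21⟩
      · exact ⟨key (-r) p hp, (key (-r) p hp).decided_mem_circularArc hr h12 h21⟩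
    · rintro x _ ⟨θ, hθ, rfl⟩ hv hd hq
      change P.Visible x (c + r • unitVec θ) at hv
      change _ = edist x (c + r • unitVec θ) at hd
      change ¬ P.IsVertex (c + r • unitVec θ) at hq
      change c + r • unitVec θ ∈ _ ∨ _ ∨ ∃ φ ∈ _, _ = c + r • unitVec θ
      rcases eq_or_lt_of_le hθ.1 with rfl | h1
      · left; simp
      rcases eq_or_lt_of_le hθ.2 with rfl | h2
      · left; simp
      right
      obtain ⟨l, rfl⟩ := straight_to_circle hR hRP hr.ne' hsR ⟨h1, h2⟩ hv hd hq
      rcases lt_trichotomy l 0 with hl | rfl | hl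
      · refine Or.inr ⟨_, Or.inr rfl, ?_⟩
        simp only [add_sub_cancel_left, norm_smul, norm_unitVec, mul_one, Real.norm_eq_abs,
          abs_of_neg hl, smul_smul]
        congr 2; field_simp; exact div_self hl.ne
      · left; simp
      · refine Or.inr ⟨_, Or.inl rfl, ?_⟩
        simp only [add_sub_cancel_left, norm_smul, norm_unitVec, mul_one, Real.norm_eq_abs,
          abs_of_pos hl, smul_smul]
        congr 2; field_simp
  · by_cases hab : a = b
    · subst hab
      refine ⟨{a}, ∅, finite_singleton _, finite_empty, by simp, ?_⟩
      intro x q hq _ _ _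
      rw [segment_same] at hq
      exact Or.inl hq
    refine ⟨{a, b}, {fun x => a + (inner ℝ (x - a) (b - a) / ‖b - a‖ ^ 2) • (b - a)},
      by simp, by simp, ?_, ?_⟩
    · rintro φ rfl p hp
      have hφ : MeroRight fun t => a + (inner ℝ (p t - a) (b - a) / ‖b - a‖ ^ 2) • (b - a) :=
        (MeroRight.const a).add ((((hp.sub (MeroRight.const a)).inner (MeroRight.const _)).div
          (MeroRight.const _)).smul (MeroRight.const _))
      exact ⟨hφ, hφ.decided_mem_segment hab⟩
    · rintro x q hqs hv hd hq
      obtain ⟨s, h0, h1, rfl⟩ := mem_segment_iff_smul.1 hqs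
      rcases eq_or_lt_of_le h0 with rfl | h0
      · left; simp
      rcases eq_or_lt_of_le h1 with rfl | h1
      · left; simp
      refine Or.inr (Or.inr ⟨_, rfl, ?_⟩)
      have h := straight_to_segment hR hRP hsR h0 h1 hv hd hq
      have hne : ‖b - a‖ ^ 2 ≠ 0 := by
        have : b - a ≠ 0 := sub_ne_zero.2 (Ne.symm hab)
        positivity
      rw [← sub_sub, inner_sub_left, real_inner_smul_left, real_inner_self_eq_norm_sq,
        sub_eq_zero] at h
      simp only [h, mul_div_assoc, div_self hne, mul_one]

lemma geoDistSet_eq_zero {q : Plane} (hRP : R ⊆ P.carrier) (hq : q ∈ R) :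
    P.geoDistSet q R = 0 := by
  have := geoDistSet_le_edist (visible_self (hRP hq)) hq
  rwa [edist_self, nonpos_iff_eq_zero] at this

/-- Finitely many base points and foot maps describe the distance. -/
lemma exists_feet (hRP : R ⊆ P.carrier) (hRa : ConsistsOfArcs R) :
    ∃ (W : Set Plane) (F : Set ((Plane → Plane) × Set Plane)), W.Finite ∧ F.Finite ∧
      (∀ φ ∈ F, φ.2 ⊆ R ∧ ∀ p : ℝ → Plane, MeroRight p →
        MeroRight (fun t => φ.1 (p t)) ∧ Decided fun t => φ.1 (p t) ∈ φ.2) ∧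
      ∀ x, P.geoDistSet x R ≠ ⊤ →
        (∃ w ∈ W, P.Visible x w ∧ P.geoDistSet x R = edist x w + P.geoDistSet w R) ∨
        ∃ φ ∈ F, φ.1 x ∈ φ.2 ∧ P.Visible x (φ.1 x) ∧ P.geoDistSet x R = edist x (φ.1 x) := by
  have hR := hRa.isCompact
  obtain ⟨S, hS, harc, rfl⟩ := hRa
  have hsub : ∀ s ∈ S, s ⊆ ⋃₀ S := fun s hs => subset_sUnion_of_mem hs
  have h := fun s (hs : s ∈ S) => exists_feet_of_isArc hR hRP (harc s hs) (hsub s hs)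
  choose! W F hW hF hdec hfeet using h
  refine ⟨{v | P.IsVertex v} ∪ ⋃ s ∈ S, W s, ⋃ s ∈ S, (fun φ => (φ, s)) '' F s,
    P.finite_vertices.union (hS.biUnion hW), hS.biUnion fun s hs => (hF s hs).image _, ?_, ?_⟩
  · intro φ hφ
    obtain ⟨s, hs, ψ, hψ, rfl⟩ := mem_iUnion₂.1 hφ
    exact ⟨hsub s hs, fun p hp => hdec s hs ψ hψ p hp⟩
  · intro x hx
    rcases exists_geoDistSet_eq hR hx with ⟨q, hq, hv, he⟩ | ⟨w, hw, -, hv, he⟩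
    · by_cases hqv : P.IsVertex q
      · exact Or.inl ⟨q, Or.inl hqv, hv, by rw [he, geoDistSet_eq_zero hRP hq, add_zero]⟩
      obtain ⟨s, hs, hqs⟩ := hq
      rcases hfeet s hs x q hqs hv he hqv with h | h | ⟨φ, hφ, rfl⟩
      · exact Or.inl ⟨q, Or.inr (mem_iUnion₂.2 ⟨s, hs, h⟩), hv, by
          rw [he, geoDistSet_eq_zero hRP (hsub s hs hqs), add_zero]⟩
      · exact Or.inl ⟨x, Or.inr (mem_iUnion₂.2 ⟨s, hs, h⟩), visible_self hv.left_mem, by simp⟩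
      · exact Or.inr ⟨(φ, s), mem_iUnion₂.2 ⟨s, hs, φ, hφ, rfl⟩, hqs, hv, he⟩
    · exact Or.inl ⟨w, Or.inl hw, hv, he⟩

lemma decided_ofReal_add {m : ℝ → ℝ} (hm : MeroRight m) (h0 : ∀ t, 0 ≤ m t) (E : ℝ≥0∞) {δ : ℝ}
    (hδ : 0 ≤ δ) : (Decided fun t => ENNReal.ofReal (m t) + E ≤ ENNReal.ofReal δ) ∧
      Decided fun t => ENNReal.ofReal δ ≤ ENNReal.ofReal (m t) + E := by
  by_cases hE : E = ⊤
  · subst hE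
    simp only [add_top]
    exact ⟨Decided.const _, Decided.const _⟩
  · have hadd : ∀ t, ENNReal.ofReal (m t) + E = ENNReal.ofReal (m t + E.toReal) := fun t => by
      rw [ENNReal.ofReal_add (h0 t) ENNReal.toReal_nonneg, ENNReal.ofReal_toReal hE]
    have hs := hm.add (MeroRight.const E.toReal)
    refine ⟨(hs.decided_le (MeroRight.const δ)).congr (Eventually.of_forall fun t => ?_),
      ((MeroRight.const δ).decided_le hs).congr (Eventually.of_forall fun t => ?_)⟩
    · rw [hadd, ENNReal.ofReal_le_ofReal_iff hδ]
    · rw [hadd, ENNReal.ofReal_le_ofReal_iff (add_nonneg (h0 t) ENNReal.toReal_nonneg)]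

/-- The equation splits into two inequalities: the upper bound holds when some base point or foot
realises it, the lower bound when none of them undercuts it. Both are finite combinations of decided
conditions. -/
lemma decided_geoDistSet_eq (hRP : R ⊆ P.carrier) (hRa : ConsistsOfArcs R) {p : ℝ → Plane}
    (hp : MeroRight p) {δ : ℝ} (hδ : 0 ≤ δ) :
    Decided fun t => P.geoDistSet (p t) R = ENNReal.ofReal δ := by
  obtain ⟨W, F, hW, hF, htame, hfeet⟩ := P.exists_feet hRP hRa
  have hle : ∀ x, P.geoDistSet x R ≤ ENNReal.ofReal δ ↔
      (∃ w ∈ W, P.Visible x w ∧ ENNReal.ofReal ‖x - w‖ + P.geoDistSet w R ≤ ENNReal.ofReal δ) ∨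
      ∃ φ ∈ F, φ.1 x ∈ φ.2 ∧ P.Visible x (φ.1 x) ∧
        ENNReal.ofReal ‖x - φ.1 x‖ + 0 ≤ ENNReal.ofReal δ := by
    intro x
    simp only [← dist_eq_norm, ← edist_dist, add_zero]
    constructor
    · intro h
      rcases hfeet x (ne_top_of_le_ne_top ENNReal.ofReal_ne_top h) with
        ⟨w, hw, hv, he⟩ | ⟨φ, hφ, hm, hv, he⟩
      · exact Or.inl ⟨w, hw, hv, he ▸ h⟩
      · exact Or.inr ⟨φ, hφ, hm, hv, he ▸ h⟩
    · rintro (⟨w, hw, hv, he⟩ | ⟨φ, hφ, hm, hv, he⟩)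
      · exact (geoDistSet_le_add hRa.isCompact hv).trans he
      · exact (geoDistSet_le_edist hv ((htame φ hφ).1 hm)).trans he
  have hge : ∀ x, ENNReal.ofReal δ ≤ P.geoDistSet x R ↔
      (∀ w ∈ W, P.Visible x w → ENNReal.ofReal δ ≤ ENNReal.ofReal ‖x - w‖ + P.geoDistSet w R) ∧
      ∀ φ ∈ F, φ.1 x ∈ φ.2 → P.Visible x (φ.1 x) →
        ENNReal.ofReal δ ≤ ENNReal.ofReal ‖x - φ.1 x‖ + 0 := by
    intro x
    simp only [← dist_eq_norm, ← edist_dist, add_zero]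
    constructor
    · intro h
      exact ⟨fun w _ hv => h.trans (geoDistSet_le_add hRa.isCompact hv), fun φ hφ hm hv =>
        h.trans (geoDistSet_le_edist hv ((htame φ hφ).1 hm))⟩
    · rintro ⟨h1, h2⟩
      by_cases htop : P.geoDistSet x R = ⊤
      · rw [htop]; exact le_top
      rcases hfeet x htop with ⟨w, hw, hv, he⟩ | ⟨φ, hφ, hm, hv, he⟩
      · rw [he]; exact h1 w hw hv
      · rw [he]; exact h2 φ hφ hm hv
  have hvw : ∀ w, Decided fun t => P.Visible (p t) w := fun w =>
    decided_visible hp (MeroRight.const w)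
  have hvφ : ∀ φ ∈ F, Decided fun t => P.Visible (p t) (φ.1 (p t)) := fun φ hφ =>
    decided_visible hp ((htame φ hφ).2 p hp).1
  have hmφ : ∀ φ ∈ F, Decided fun t => φ.1 (p t) ∈ φ.2 := fun φ hφ => ((htame φ hφ).2 p hp).2
  have hdw : ∀ w, _ := fun w => decided_ofReal_add (hp.sub (MeroRight.const w)).norm
    (fun t => norm_nonneg _) (P.geoDistSet w R) hδ
  have hdφ : ∀ φ ∈ F, _ := fun φ hφ => decided_ofReal_add (hp.sub ((htame φ hφ).2 p hp).1).norm
    (fun t => norm_nonneg _) 0 hδ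
  have d1 := (Decided.exists_mem hW fun w _ => (hvw w).and (hdw w).1).or
    (Decided.exists_mem hF fun φ hφ => (hmφ φ hφ).and ((hvφ φ hφ).and (hdφ φ hφ).1))
  have d2 := (Decided.forall_mem hW fun w _ => (hvw w).imp (hdw w).2).and
    (Decided.forall_mem hF fun φ hφ => (hmφ φ hφ).imp ((hvφ φ hφ).imp (hdφ φ hφ).2))
  refine (d1.and d2).congr (Eventually.of_forall fun t => ?_)
  rw [le_antisymm_iff, hle, hge]

end PolygonWithHoles

/-! ### Finite unions of arcs -/

/-- `X` is the union of finitely many sets with the property `T`. -/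
def IsFiniteUnionOf (T : Set Plane → Prop) (X : Set Plane) : Prop :=
  ∃ S : Set (Set Plane), S.Finite ∧ (∀ s ∈ S, T s) ∧ ⋃₀ S = X

lemma IsFiniteUnionOf.union {T : Set Plane → Prop} {X Y : Set Plane} (hX : IsFiniteUnionOf T X)
    (hY : IsFiniteUnionOf T Y) : IsFiniteUnionOf T (X ∪ Y) := by
  obtain ⟨S, hS, h1, rfl⟩ := hX
  obtain ⟨S', hS', h1', rfl⟩ := hY
  exact ⟨S ∪ S', hS.union hS', fun s hs => hs.elim (h1 s) (h1' s), sUnion_union _ _⟩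

lemma IsFiniteUnionOf.biUnion {ι : Type*} {I : Set ι} (hI : I.Finite) {T : Set Plane → Prop}
    {X : ι → Set Plane} (h : ∀ i ∈ I, IsFiniteUnionOf T (X i)) :
    IsFiniteUnionOf T (⋃ i ∈ I, X i) := by
  choose! S hS h1 h2 using h
  refine ⟨⋃ i ∈ I, S i, hI.biUnion hS, fun s hs => ?_, ?_⟩
  · obtain ⟨i, hi, hs⟩ := mem_iUnion₂.1 hs
    exact h1 i hi s hs
  · rw [sUnion_iUnion]
    refine iUnion_congr fun i => ?_
    rw [sUnion_iUnion]
    exact iUnion_congr fun hi => h2 i hi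

lemma IsFiniteUnionOf.mono {T T' : Set Plane → Prop} {X : Set Plane} (hX : IsFiniteUnionOf T X)
    (h : ∀ s ⊆ X, T s → T' s) : IsFiniteUnionOf T' X := by
  obtain ⟨S, hS, h1, rfl⟩ := hX
  exact ⟨S, hS, fun s hs => h s (subset_sUnion_of_mem hs) (h1 s hs), rfl⟩

lemma isFiniteUnionOf_empty (T : Set Plane → Prop) : IsFiniteUnionOf T ∅ :=
  ⟨∅, finite_empty, by simp, by simp⟩

/-- A negative `l` occurs when the offset passes through the centre; it amounts to turning the angle
interval by `π`. -/
lemma isCircularArc_image {c : Plane} (l : ℝ) {s t : ℝ} (hst : s ≤ t)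
    (ht : t ≤ s + 2 * Real.pi) :
    IsCircularArc c |l| ((fun θ => c + l • unitVec θ) '' Icc s t) := by
  rcases le_total 0 l with hl | hl
  · rw [abs_of_nonneg hl]
    exact isCircularArc_iff.2 ⟨hl, s, t, hst, ht, rfl⟩
  · rw [abs_of_nonpos hl]
    refine isCircularArc_iff.2 ⟨by linarith, s + Real.pi, t + Real.pi, by linarith, by linarith, ?_⟩
    have h : ∀ θ, unitVec (θ + Real.pi) = -unitVec θ := fun θ => by
      ext i; fin_cases i <;> simp
    rw [← image_add_const_Icc, image_image]
    refine image_congr fun θ _ => ?_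
    rw [h, smul_neg, neg_smul, neg_neg]

lemma image_segment_Icc (c d : Plane) {s t : ℝ} (hst : s ≤ t) :
    (fun r : ℝ => c + r • d) '' Icc s t = segment ℝ (c + s • d) (c + t • d) := by
  have h : (fun r : ℝ => c + r • d) = fun r => AffineMap.lineMap c (c + d) r := by
    funext r; simp [AffineMap.lineMap_apply, add_comm]
  have h2 : ∀ r : ℝ, c + r • d = AffineMap.lineMap c (c + d) r := fun r => congrFun h r
  rw [h, h2, h2, ← segment_eq_Icc hst, image_segment]

/-! ### The expanded boundary and its decomposition into arcs -/

namespace PolygonWithHoles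

variable {P : PolygonWithHoles} {U : Set Plane} {δ : ℝ}

lemma frontier_subset_carrier (hU : U ⊆ P.carrier) : frontier U ⊆ P.carrier :=
  frontier_subset_closure.trans (closure_minimal hU isClosed_carrier)

lemma notMem_frontier_of_geoDistSet_eq (hU : U ⊆ P.carrier) (hδ : 0 < δ) {x : Plane}
    (hx : P.geoDistSet x (frontier U) = ENNReal.ofReal δ) : x ∉ frontier U := by
  intro h
  rw [geoDistSet_eq_zero (frontier_subset_carrier hU) h] at hx
  exact (ENNReal.ofReal_pos.2 hδ).ne hx

lemma eventually_geoDistSet_lt {R : Set Plane} (hR : IsCompact R) {x : Plane}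
    (hx : x ∈ P.carrier) {c : ℝ≥0∞} (hc : P.geoDistSet x R < c) :
    ∀ᶠ y in 𝓝 x, y ∈ P.carrier → P.geoDistSet y R < c := by
  have ht : Tendsto (fun y => edist y x + P.geoDistSet x R) (𝓝 x) (𝓝 (P.geoDistSet x R)) := by
    have hcont : Continuous fun y => edist y x + P.geoDistSet x R :=
      (continuous_id.edist continuous_const).add continuous_const
    exact hcont.tendsto' _ _ (by simp)
  filter_upwards [ht.eventually (gt_mem_nhds hc), eventually_segment_subset hx] with y h1 h2 hy
  exact (geoDistSet_le_add hR (Visible.symm (h2 hy))).trans_lt h1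

/-- Lower semicontinuity bounds the distance at a limit from above, and `eventually_geoDistSet_lt`
excludes a drop. A limit of points outside `U` could lie in `U` only on the frontier, where the
distance is zero. -/
lemma isClosed_expandedBoundary (hU : U ⊆ P.carrier) (hR : IsCompact (frontier U)) (hδ : 0 < δ) :
    IsClosed (P.expandedBoundary U δ) := by
  refine isClosed_of_closure_subset fun x hx => ?_
  have hxK : x ∈ P.carrier := closure_minimal (fun y hy => hy.1.1) isClosed_carrier hx
  have hle : P.geoDistSet x (frontier U) ≤ ENNReal.ofReal δ :=
    closure_minimal (t := (fun x => P.geoDistSet x (frontier U)) ⁻¹' Iic (ENNReal.ofReal δ))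
      (fun y hy => hy.2.le)
      (lowerSemicontinuous_iff_isClosed_preimage.1 (lowerSemicontinuous_geoDistSet hR) _) hx
  have heq : P.geoDistSet x (frontier U) = ENNReal.ofReal δ := by
    refine le_antisymm hle (not_lt.1 fun hlt => ?_)
    obtain ⟨y, hy, hy'⟩ := ((mem_closure_iff_frequently.1 hx).and_eventually
      (eventually_geoDistSet_lt hR hxK hlt)).exists
    exact (hy' hy.1.1).ne hy.2
  refine ⟨⟨hxK, fun hxU => ?_⟩, heq⟩
  refine notMem_frontier_of_geoDistSet_eq hU hδ heq ?_
  rw [frontier_eq_closure_inter_closure]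
  exact ⟨subset_closure hxU, closure_mono (fun y hy => hy.1.2) hx⟩

lemma decided_mem_expandedBoundary (hU : U ⊆ P.carrier) (hbd : ConsistsOfArcs (frontier U))
    (hδ : 0 < δ) {p : ℝ → Plane} (hp : MeroRight p) {x : Plane}
    (hx : Tendsto p (𝓝[>] 0) (𝓝 x)) : Decided fun t => p t ∈ P.expandedBoundary U δ := by
  have hRP := frontier_subset_carrier hU
  by_cases hxR : x ∈ frontier U
  -- Close to the frontier the distance is below `δ`. So membership in `U` has to be decided only at
  -- points off the frontier, where it is locally constant.
  · right
    have hlt : P.geoDistSet x (frontier U) < ENNReal.ofReal δ := by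
      rw [geoDistSet_eq_zero hRP hxR]; exact ENNReal.ofReal_pos.2 hδ
    filter_upwards [hx.eventually (eventually_geoDistSet_lt hbd.isCompact (hRP hxR) hlt)] with t ht hm
    exact (ht hm.1.1).ne hm.2
  · have hdU : Decided fun t => p t ∈ U := by
      by_cases hxU : x ∈ U
      · left
        refine hx.eventually (mem_interior_iff_mem_nhds.1 ?_)
        by_contra h
        exact hxR ⟨subset_closure hxU, h⟩
      · right
        refine hx.eventually (mem_interior_iff_mem_nhds.1 (?_ : x ∈ interior Uᶜ))
        rw [interior_compl]
        intro h
        exact hxR ⟨h, fun h' => hxU (interior_subset h')⟩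
    exact ((decided_mem_carrier hp).and hdU.not).and (decided_geoDistSet_eq hRP hbd hp hδ.le)

/-- The points of an analytic curve in the expanded boundary that see an analytic companion
curve form finitely many subarcs. -/
lemma exists_finite_subarcs (hU : U ⊆ P.carrier) (hbd : ConsistsOfArcs (frontier U))
    (hδ : 0 < δ) {p y : ℝ → Plane} (hp : ∀ s, AnalyticAt ℝ p s) (hy : ∀ s, AnalyticAt ℝ y s)
    (a b : ℝ) : IsFiniteUnionOf
      (fun X => ∃ s t, s ≤ t ∧ Icc s t ⊆ Icc a b ∧ X = p '' Icc s t)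
      {z | ∃ s ∈ Icc a b, p s ∈ P.expandedBoundary U δ ∧ P.Visible (p s) (y s) ∧ p s = z} := by
  have hpc : Continuous p := continuous_iff_continuousAt.2 fun s => (hp s).continuousAt
  have hyc : Continuous y := continuous_iff_continuousAt.2 fun s => (hy s).continuousAt
  set V : Set ℝ := {s | s ∈ Icc a b ∧ p s ∈ P.expandedBoundary U δ ∧ P.Visible (p s) (y s)} with hV
  have hVc : IsCompact V := isCompact_Icc.inter_right
    (((isClosed_expandedBoundary hU hbd.isCompact hδ).preimage hpc).inter
      (isClosed_visible.preimage (hpc.prodMk hyc)))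
  have hdec : ∀ k : ℝ → ℝ, AnalyticAt ℝ k 0 → Decided fun t => k t ∈ V := by
    intro k hk
    have hkm := MeroRight.of_analyticAt hk
    have hpk := (hp (k 0)).comp hk
    have hyk := (hy (k 0)).comp hk
    exact (((MeroRight.const a).decided_le hkm).and (hkm.decided_le (MeroRight.const b))).and
      ((decided_mem_expandedBoundary hU hbd hδ (MeroRight.of_analyticAt hpk)
        (hpk.continuousAt.tendsto.mono_left nhdsWithin_le_nhds)).and
      (decided_visible (MeroRight.of_analyticAt hpk) (MeroRight.of_analyticAt hyk)))
  obtain ⟨F, hF, hFV, hcov⟩ := exists_finite_Icc_cover hVc fun s =>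
    ⟨hdec (fun t => s + t) (by fun_prop), hdec (fun t => s - t) (by fun_prop)⟩
  refine ⟨(fun x => p '' Icc x.1 x.2) '' F, hF.image _, ?_, ?_⟩
  · rintro _ ⟨x, hx, rfl⟩
    exact ⟨x.1, x.2, (hFV x hx).1, fun s hs => ((hFV x hx).2 hs).1, rfl⟩
  · ext z
    simp only [sUnion_image, mem_iUnion, mem_image, exists_prop]
    constructor
    · rintro ⟨x, hx, s, hs, rfl⟩
      have := (hFV x hx).2 hs
      exact ⟨s, this.1, this.2.1, this.2.2, rfl⟩
    · rintro ⟨s, h1, h2, h3, rfl⟩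
      obtain ⟨x, hx, hs⟩ := mem_iUnion₂.1 (hcov (⟨h1, h2, h3⟩ : s ∈ V))
      exact ⟨x, hx, s, hs, rfl⟩

lemma analyticAt_circle (c : Plane) (l s : ℝ) :
    AnalyticAt ℝ (fun θ => c + l • unitVec θ) s :=
  analyticAt_const.add ((analyticAt_unitVec s).const_smul (c := l))

lemma exists_eq_add_smul_unitVec (w p : Plane) :
    ∃ s ∈ Icc (-Real.pi) Real.pi, w + dist p w • unitVec s = p := by
  rcases eq_or_ne p w with rfl | hne
  · exact ⟨0, ⟨by linarith [Real.pi_pos], Real.pi_pos.le⟩, by simp⟩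
  have hpos : 0 < dist p w := dist_pos.2 hne
  have hmem : p ∈ (fun θ => w + dist p w • unitVec θ) '' Icc (-Real.pi) Real.pi := by
    rw [mem_circularArc_iff hpos (by linarith [Real.pi_pos]) (by linarith)]
    refine ⟨(dist_eq_norm _ _).symm, ?_⟩
    have hpi : (Real.pi - -Real.pi) / 2 = Real.pi := by ring
    rw [hpi, Real.cos_pi]
    have := abs_real_inner_le_norm (p - w) (unitVec ((-Real.pi + Real.pi) / 2))
    rw [norm_unitVec, mul_one, ← dist_eq_norm, abs_le] at this
    linarith [this.1]
  exact hmem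

/-- The points of the expanded boundary at a given distance from a visible point form arcs. -/
lemma isFiniteUnionOf_visible_circle (hU : U ⊆ P.carrier) (hbd : ConsistsOfArcs (frontier U))
    (hδ : 0 < δ) (w : Plane) {r : ℝ} (hr : 0 ≤ r) : IsFiniteUnionOf (IsCircularArc w r)
      {p | p ∈ P.expandedBoundary U δ ∧ P.Visible p w ∧ dist p w = r} := by
  have h := exists_finite_subarcs hU hbd hδ (p := fun θ => w + r • unitVec θ) (y := fun _ => w)
    (analyticAt_circle w r) (fun _ => analyticAt_const) (-Real.pi) Real.pi
  have heq : {p | p ∈ P.expandedBoundary U δ ∧ P.Visible p w ∧ dist p w = r} =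
      {z | ∃ s ∈ Icc (-Real.pi) Real.pi, w + r • unitVec s ∈ P.expandedBoundary U δ ∧
        P.Visible (w + r • unitVec s) w ∧ w + r • unitVec s = z} := by
    ext z
    constructor
    · rintro ⟨h1, h2, rfl⟩
      obtain ⟨s, hs, hz⟩ := exists_eq_add_smul_unitVec w z
      exact ⟨s, hs, by rwa [hz], by rwa [hz], hz⟩
    · rintro ⟨s, hs, h1, h2, rfl⟩
      exact ⟨h1, h2, by simp [dist_eq_norm, norm_smul, abs_of_nonneg hr]⟩
  rw [heq]
  refine h.mono ?_
  rintro _ - ⟨s, t, hst, hsub, rfl⟩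
  have h1 := hsub (left_mem_Icc.2 hst)
  have h2 := hsub (right_mem_Icc.2 hst)
  have := isCircularArc_image (c := w) r hst (by linarith [h1.1, h2.2])
  rwa [abs_of_nonneg hr] at this

lemma mem_directPart_iff {p : Plane} : p ∈ P.directPart U δ ↔
    p ∈ P.expandedBoundary U δ ∧
      ∃ q ∈ frontier U, P.Visible p q ∧ P.geoDistSet p (frontier U) = edist p q := by
  simp only [directPart, IsShortestPathTo, mem_ofPred_eq, isPath_nil, List.nil_append,
    chainLength_pair]
  constructor
  · rintro ⟨h, q, h1, h2, h3⟩; exact ⟨h, q, h1, h2, h3.symm⟩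
  · rintro ⟨h, q, h1, h2, h3⟩; exact ⟨h, q, h1, h2, h3.symm⟩

lemma mem_directPart_of_dist {p q : Plane} (hp : p ∈ P.expandedBoundary U δ)
    (hq : q ∈ frontier U) (hv : P.Visible p q) (hd : dist p q = δ) : p ∈ P.directPart U δ :=
  mem_directPart_iff.2 ⟨hp, q, hq, hv, by rw [hp.2, edist_dist, hd]⟩

/-- Once the length is right, any shortest path from `v` completes the segment from `p`, so the
condition no longer mentions paths. -/
lemma mem_partVia_iff (hR : IsCompact (frontier U)) {v p : Plane} (hv : P.IsVertex v) :
    p ∈ P.partVia U δ v ↔ p ∈ P.expandedBoundary U δ ∧ p ≠ v ∧ P.Visible p v ∧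
      edist p v + P.geoDistSet v (frontier U) = ENNReal.ofReal δ := by
  constructor
  · rintro ⟨hp, hne, l, q, hq, hpath, hlen⟩
    obtain ⟨-, hpv, hl⟩ := isPath_cons.1 hpath
    refine ⟨hp, hne, hpv, ?_⟩
    rw [← hp.2]
    refine le_antisymm ?_ (geoDistSet_le_add hR hpv)
    rw [← hlen, List.cons_append, chainLength_cons_cons]
    gcongr
    exact geoDistSet_le_of_isPath hl hq
  · rintro ⟨hp, hne, hpv, hd⟩
    have htop : P.geoDistSet v (frontier U) ≠ ⊤ := fun h => by
      rw [h, add_top] at hd; exact ENNReal.ofReal_ne_top hd.symm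
    obtain ⟨l, q, hq, hl, hlen⟩ := exists_isShortestPathTo hR htop
    refine ⟨hp, hne, l, q, hq, isPath_cons.2 ⟨hv, hpv, hl⟩, ?_⟩
    rw [List.cons_append, chainLength_cons_cons, hlen, hd, hp.2]

lemma IsReflexVertex.isVertex {v : Plane} (hv : P.IsReflexVertex v) : P.IsVertex v := by
  obtain ⟨Q, hQ, i, h, -⟩ := hv
  exact ⟨Q, hQ, _, h⟩

lemma isFiniteUnionOf_partVia (hU : U ⊆ P.carrier) (hbd : ConsistsOfArcs (frontier U))
    (hδ : 0 < δ) {v : Plane} (hv : P.IsVertex v) :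
    IsFiniteUnionOf (IsViaArc P U δ v) (P.partVia U δ v) := by
  by_cases hlt : P.geoDistSet v (frontier U) < ENNReal.ofReal δ
  · have htop := hlt.ne_top
    set d := (P.geoDistSet v (frontier U)).toReal with hd
    have hdv : P.geoDistSet v (frontier U) = ENNReal.ofReal d := (ENNReal.ofReal_toReal htop).symm
    have hd0 : 0 ≤ d := ENNReal.toReal_nonneg
    have hdδ : d < δ := by
      rw [hdv] at hlt
      exact (ENNReal.ofReal_lt_ofReal_iff hδ).1 hlt
    have hsum : ENNReal.ofReal (δ - d) + P.geoDistSet v (frontier U) = ENNReal.ofReal δ := by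
      rw [hdv, ← ENNReal.ofReal_add (by linarith) hd0, sub_add_cancel]
    have heq : P.partVia U δ v =
        {p | p ∈ P.expandedBoundary U δ ∧ P.Visible p v ∧ dist p v = δ - d} := by
      ext p
      rw [mem_partVia_iff hbd.isCompact hv, mem_ofPred_eq, edist_dist, hdv,
        ← ENNReal.ofReal_add dist_nonneg hd0, ENNReal.ofReal_eq_ofReal_iff (by positivity) hδ.le]
      constructor
      · rintro ⟨h1, -, h2, h3⟩; exact ⟨h1, h2, by linarith⟩
      · rintro ⟨h1, h2, h3⟩
        exact ⟨h1, fun h => by rw [h, dist_self] at h3; linarith, h2, by linarith⟩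
    rw [heq]
    exact (isFiniteUnionOf_visible_circle hU hbd hδ v (by linarith)).mono
      fun s _ hs => ⟨δ - d, hsum, hs⟩
  · have : P.partVia U δ v = ∅ := by
      refine eq_empty_of_forall_notMem fun p hp => hlt ?_
      obtain ⟨-, hne, -, h⟩ := (mem_partVia_iff hbd.isCompact hv).1 hp
      have htop : P.geoDistSet v (frontier U) ≠ ⊤ := fun h' => by
        rw [h', add_top] at h; exact ENNReal.ofReal_ne_top h.symm
      rw [← h, add_comm]
      exact ENNReal.lt_add_right htop (edist_pos.2 hne).ne'
    rw [this]
    exact isFiniteUnionOf_empty _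

/-- The straight shortest paths ending in a given arc of the boundary, apart from those ending in
finitely many points, start in finitely many arcs. -/
lemma exists_direct_arcs (hU : U ⊆ P.carrier) (hbd : ConsistsOfArcs (frontier U)) (hδ : 0 < δ)
    {s : Set Plane} (hs : IsArc s) (hsR : s ⊆ frontier U) :
    ∃ W X : Set Plane, W.Finite ∧ W ⊆ s ∧ X ⊆ P.directPart U δ ∧ IsFiniteUnionOf IsArc X ∧
      ∀ p ∈ P.expandedBoundary U δ, ∀ q ∈ s, P.Visible p q →
        P.geoDistSet p (frontier U) = edist p q → ¬ P.IsVertex q → q ∈ W ∨ p ∈ X := by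
  have hR := hbd.isCompact
  have hRP := frontier_subset_carrier hU
  have hdist : ∀ {p q}, p ∈ P.expandedBoundary U δ →
      P.geoDistSet p (frontier U) = edist p q → dist p q = δ := by
    intro p q hp hd
    rw [hp.2, edist_dist, eq_comm, ENNReal.ofReal_eq_ofReal_iff dist_nonneg hδ.le] at hd
    exact hd
  rcases hs with ⟨c, r, hr, θ₁, θ₂, h12, h21, rfl⟩ | ⟨a, b, rfl⟩
  · change (fun θ : ℝ => c + r • unitVec θ) '' Icc θ₁ θ₂ ⊆ _ at hsR
    -- `Y l` is the part of the concentric offset of signed radius `l` that sees the radially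
    -- corresponding point of the arc. Perpendicularity leaves only `l = r + δ` and `l = r - δ`.
    set Y : ℝ → Set Plane := fun l => {z | ∃ θ ∈ Icc θ₁ θ₂,
      c + l • unitVec θ ∈ P.expandedBoundary U δ ∧
      P.Visible (c + l • unitVec θ) (c + r • unitVec θ) ∧ c + l • unitVec θ = z} with hY
    have hYarc : ∀ l, IsFiniteUnionOf IsArc (Y l) := fun l => by
      refine (exists_finite_subarcs hU hbd hδ (p := fun θ => c + l • unitVec θ)
        (y := fun θ => c + r • unitVec θ) (analyticAt_circle c l) (analyticAt_circle c r)
        θ₁ θ₂).mono ?_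
      rintro _ - ⟨s, t, hst, hsub, rfl⟩
      have h1 := hsub (left_mem_Icc.2 hst)
      have h2 := hsub (right_mem_Icc.2 hst)
      exact Or.inl ⟨c, |l|, isCircularArc_image l hst (by linarith [h1.1, h2.2])⟩
    have hYd : ∀ l, |l - r| = δ → Y l ⊆ P.directPart U δ := by
      rintro l hl _ ⟨θ, hθ, h1, h2, rfl⟩
      refine mem_directPart_of_dist h1 (hsR ⟨θ, hθ, rfl⟩) h2 ?_
      rw [dist_add_left, dist_eq_norm, ← sub_smul, norm_smul, norm_unitVec, mul_one,
        Real.norm_eq_abs, hl]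
    refine ⟨{c + r • unitVec θ₁, c + r • unitVec θ₂}, Y (r + δ) ∪ Y (r - δ), by simp, ?_,
      union_subset (hYd _ ?_) (hYd _ ?_), (hYarc _).union (hYarc _), ?_⟩
    · rintro x (rfl | rfl)
      · exact ⟨θ₁, ⟨le_rfl, h12⟩, rfl⟩
      · exact ⟨θ₂, ⟨h12, le_rfl⟩, rfl⟩
    · rw [add_sub_cancel_left, abs_of_pos hδ]
    · rw [sub_sub_cancel_left, abs_neg, abs_of_pos hδ]
    · rintro p hp _ ⟨θ, hθ, rfl⟩ hv hd hq
      change P.Visible p (c + r • unitVec θ) at hv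
      change _ = edist p (c + r • unitVec θ) at hd
      change ¬ P.IsVertex (c + r • unitVec θ) at hq
      change c + r • unitVec θ ∈ _ ∨ _
      rcases eq_or_ne r 0 with rfl | hr0
      · left; simp
      rcases eq_or_lt_of_le hθ.1 with rfl | h1
      · left; simp
      rcases eq_or_lt_of_le hθ.2 with rfl | h2
      · left; simp
      right
      obtain ⟨l, rfl⟩ := straight_to_circle hR hRP hr0 hsR ⟨h1, h2⟩ hv hd hq
      have hl := hdist hp hd
      rw [dist_add_left, dist_eq_norm, ← sub_smul, norm_smul, norm_unitVec, mul_one,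
        Real.norm_eq_abs] at hl
      rcases (abs_eq hδ.le).1 hl with h | h
      · obtain rfl : l = r + δ := by linarith
        exact Or.inl ⟨θ, hθ, hp, hv, rfl⟩
      · obtain rfl : l = r - δ := by linarith
        exact Or.inr ⟨θ, hθ, hp, hv, rfl⟩
  · by_cases hab : a = b
    · subst hab
      refine ⟨{a}, ∅, finite_singleton _, by simp, empty_subset _, isFiniteUnionOf_empty _, ?_⟩
      intro p _ q hq _ _ _
      rw [segment_same] at hq
      exact Or.inl hq
    have hne : b - a ≠ 0 := sub_ne_zero.2 (Ne.symm hab)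
    -- A unit normal of the segment; the candidates are its translates by `δ • n` and `-δ • n`.
    set n : Plane := ‖b - a‖⁻¹ • !₂[-(b - a) 1, (b - a) 0] with hn
    have hrot : ‖(!₂[-(b - a) 1, (b - a) 0] : Plane)‖ = ‖b - a‖ := by
      rw [EuclideanSpace.norm_eq, EuclideanSpace.norm_eq]
      congr 1
      simp; ring
    have hn1 : ‖n‖ = 1 := by
      rw [hn, norm_smul, hrot, norm_inv, norm_norm, inv_mul_cancel₀ (norm_ne_zero_iff.2 hne)]
    have hnx : ∀ x : Plane, inner ℝ x (b - a) = 0 → ∃ l : ℝ, x = l • n := by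
      intro x hx
      refine exists_smul_of_cross_eq_zero (fun h => by rw [h, norm_zero] at hn1; norm_num at hn1) ?_
      rw [hn, cross_smul_left]
      have : cross !₂[-(b - a) 1, (b - a) 0] x = -inner ℝ x (b - a) := by
        simp [cross, PiLp.inner_apply]; ring
      rw [this, hx]; simp
    set Y : ℝ → Set Plane := fun l => {z | ∃ s ∈ Icc (0 : ℝ) 1,
      a + l • n + s • (b - a) ∈ P.expandedBoundary U δ ∧
      P.Visible (a + l • n + s • (b - a)) (a + s • (b - a)) ∧ a + l • n + s • (b - a) = z} with hY
    have hYarc : ∀ l, IsFiniteUnionOf IsArc (Y l) := fun l => by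
      refine (exists_finite_subarcs hU hbd hδ (p := fun s => a + l • n + s • (b - a))
        (y := fun s => a + s • (b - a)) (fun s => by fun_prop) (fun s => by fun_prop) 0 1).mono ?_
      rintro _ - ⟨s, t, hst, -, rfl⟩
      exact Or.inr ⟨_, _, image_segment_Icc _ _ hst⟩
    have hds : ∀ l s : ℝ, dist (a + l • n + s • (b - a)) (a + s • (b - a)) = |l| := fun l s => by
      rw [dist_eq_norm, show a + l • n + s • (b - a) - (a + s • (b - a)) = l • n by abel,
        norm_smul, hn1, mul_one, Real.norm_eq_abs]
    have hYd : ∀ l, |l| = δ → Y l ⊆ P.directPart U δ := by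
      rintro l hl _ ⟨s, hs, h1, h2, rfl⟩
      exact mem_directPart_of_dist h1 (hsR (mem_segment_iff_smul.2 ⟨s, hs.1, hs.2, rfl⟩)) h2
        (by rw [hds, hl])
    refine ⟨{a, b}, Y δ ∪ Y (-δ), by simp, ?_,
      union_subset (hYd _ (abs_of_pos hδ)) (hYd _ (by rw [abs_neg, abs_of_pos hδ])),
      (hYarc _).union (hYarc _), ?_⟩
    · rintro x (rfl | rfl)
      · exact left_mem_segment _ _ _
      · exact right_mem_segment _ _ _
    · rintro p hp q hqs hv hd hq
      obtain ⟨s, h0, h1, rfl⟩ := mem_segment_iff_smul.1 hqs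
      rcases eq_or_lt_of_le h0 with rfl | h0
      · left; simp
      rcases eq_or_lt_of_le h1 with rfl | h1
      · left; simp
      right
      obtain ⟨l, hl⟩ := hnx _ (straight_to_segment hR hRP hsR h0 h1 hv hd hq)
      obtain rfl : p = a + l • n + s • (b - a) := by
        rw [add_right_comm, ← hl, add_sub_cancel]
      have hld := hdist hp hd
      rw [hds] at hld
      rcases (abs_eq hδ.le).1 hld with rfl | rfl
      · exact Or.inl ⟨s, ⟨h0.le, h1.le⟩, hp, hv, rfl⟩
      · exact Or.inr ⟨s, ⟨h0.le, h1.le⟩, hp, hv, rfl⟩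

lemma isFiniteUnionOf_directPart (hU : U ⊆ P.carrier) (hbd : ConsistsOfArcs (frontier U))
    (hδ : 0 < δ) : IsFiniteUnionOf IsArc (P.directPart U δ) := by
  have hbd' := hbd
  obtain ⟨S, hS, harc, hSU⟩ := hbd'
  have hsub : ∀ s ∈ S, s ⊆ frontier U := fun s hs => hSU ▸ subset_sUnion_of_mem hs
  have h := fun s (hs : s ∈ S) => exists_direct_arcs hU hbd hδ (harc s hs) (hsub s hs)
  choose! W X hW hWs hXd hX hcov using h
  -- The exceptional feet: vertices on the frontier, where the first-order condition is unavailable,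
  -- and the finitely many points excluded on each arc. Each contributes arcs of a circle of radius
  -- `δ`.
  set Z : Set Plane := {v | P.IsVertex v ∧ v ∈ frontier U} ∪ ⋃ s ∈ S, W s with hZ
  have hZf : Z.Finite := (P.finite_vertices.subset fun v hv => hv.1).union (hS.biUnion hW)
  have hZR : Z ⊆ frontier U := by
    rintro z (hz | hz)
    · exact hz.2
    · obtain ⟨s, hs, hz⟩ := mem_iUnion₂.1 hz
      exact hsub s hs (hWs s hs hz)
  have heq : P.directPart U δ =
      (⋃ w ∈ Z, {p | p ∈ P.expandedBoundary U δ ∧ P.Visible p w ∧ dist p w = δ}) ∪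
        ⋃ s ∈ S, X s := by
    refine Subset.antisymm ?_ (union_subset (iUnion₂_subset ?_) (iUnion₂_subset hXd))
    · intro p hp
      obtain ⟨hp, q, hq, hv, hd⟩ := mem_directPart_iff.1 hp
      have hdist : dist p q = δ := by
        have h2 := hd
        rwa [hp.2, edist_dist, eq_comm, ENNReal.ofReal_eq_ofReal_iff dist_nonneg hδ.le] at h2
      by_cases hqZ : q ∈ Z
      · exact Or.inl (mem_iUnion₂.2 ⟨q, hqZ, hp, hv, hdist⟩)
      · obtain ⟨s, hs, hqs⟩ := hSU.symm ▸ hq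
        rcases hcov s hs p hp q hqs hv hd fun h => hqZ (Or.inl ⟨h, hq⟩) with h | h
        · exact (hqZ (Or.inr (mem_iUnion₂.2 ⟨s, hs, h⟩))).elim
        · exact Or.inr (mem_iUnion₂.2 ⟨s, hs, h⟩)
    · rintro w hw p ⟨h1, h2, h3⟩
      exact mem_directPart_of_dist h1 (hZR hw) h2 h3
  rw [heq]
  exact (IsFiniteUnionOf.biUnion hZf fun w _ =>
    (isFiniteUnionOf_visible_circle hU hbd hδ w hδ.le).mono fun s _ hs => Or.inl ⟨w, δ, hs⟩).union
    (IsFiniteUnionOf.biUnion hS hX)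

lemma expandedBoundary_eq (hR : IsCompact (frontier U)) : P.expandedBoundary U δ =
    P.directPart U δ ∪ ⋃ v ∈ {v | P.IsReflexVertex v}, P.partVia U δ v := by
  refine Subset.antisymm (fun p hp => ?_)
    (union_subset (fun p hp => hp.1) (iUnion₂_subset fun v _ p hp => hp.1))
  obtain ⟨l, q, hl⟩ := exists_isShortestPathTo hR (x := p)
    (by rw [hp.2]; exact ENNReal.ofReal_ne_top)
  rcases straight_or_reflex_of_isShortestPathTo hR hp hl with ⟨h, -⟩ | ⟨-, v, -, -, hv, -, h⟩
  · exact Or.inl h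
  · exact Or.inr (mem_iUnion₂.2 ⟨v, hv, h⟩)

end PolygonWithHoles
end PolygonalGeodesic

open PolygonalGeodesic in
theorem mainTheorem8 (P : PolygonWithHoles) (U : Set Plane) (hU : U ⊆ P.carrier)
    (hbd : ConsistsOfArcs (frontier U)) (dI : ℝ) (hdI : 0 < dI) :
    -- the expanded boundary is a finite union of arcs, each of which either consists of points
    -- joined to the boundary by a straight shortest path or is centred at a reflex vertex through
    -- which shortest paths from its points pass first
    (∃ S : Set (Set Plane), S.Finite ∧ ⋃₀ S = P.expandedBoundary U dI ∧
      ∀ s ∈ S, (IsArc s ∧ s ⊆ P.directPart U dI) ∨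
        ∃ v, P.IsReflexVertex v ∧ IsViaArc P U dI v s ∧ s ⊆ P.partVia U dI v) ∧
    -- for each reflex vertex, the points whose shortest path visits it first form such arcs
    (∀ v, P.IsReflexVertex v →
      ∃ S : Set (Set Plane), S.Finite ∧ (∀ s ∈ S, IsViaArc P U dI v s) ∧
        ⋃₀ S = P.partVia U dI v) ∧
    -- every shortest path is straight or makes its first turn at a reflex vertex
    (∀ p ∈ P.expandedBoundary U dI, ∀ l q, P.IsShortestPathTo (frontier U) p l q →
      (p ∈ P.directPart U dI ∧ chainLength (p :: (l ++ [q])) = edist p q) ∨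
      ∃ l₁ v l₂, l = l₁ ++ v :: l₂ ∧ P.IsReflexVertex v ∧
        chainLength (p :: (l₁ ++ [v])) = edist p v ∧ p ∈ P.partVia U dI v) := by
  have hvia : ∀ v, P.IsReflexVertex v →
      IsFiniteUnionOf (IsViaArc P U dI v) (P.partVia U dI v) := fun v hv =>
    PolygonWithHoles.isFiniteUnionOf_partVia hU hbd hdI hv.isVertex
  refine ⟨?_, hvia, fun p hp l q hl =>
    PolygonWithHoles.straight_or_reflex_of_isShortestPathTo hbd.isCompact hp hl⟩
  have hall : IsFiniteUnionOf (fun s => (IsArc s ∧ s ⊆ P.directPart U dI) ∨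
      ∃ v, P.IsReflexVertex v ∧ IsViaArc P U dI v s ∧ s ⊆ P.partVia U dI v)
      (P.expandedBoundary U dI) := by
    rw [PolygonWithHoles.expandedBoundary_eq hbd.isCompact]
    refine IsFiniteUnionOf.union
      ((PolygonWithHoles.isFiniteUnionOf_directPart hU hbd hdI).mono
        fun s hs h => Or.inl ⟨h, hs⟩)
      (IsFiniteUnionOf.biUnion (P.finite_vertices.subset fun v hv => hv.isVertex) fun v hv =>
        (hvia v hv).mono fun s hs h => Or.inr ⟨v, hv, h, hs⟩)
  obtain ⟨S, hS, h1, h2⟩ := hall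
  exact ⟨S, hS, h2, h1⟩
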